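/- **Setting.** Let $0<c_0<c_1$, $x_0<0$, $1<\underline k<\overline k$. Let $c^*\in C^2(\mathbb R)$ satisfy $c_0\le c^*\le c_1$, $c^*=1$ outside $(0,1)$, and $\beta^*:=c^*-1\ge 0$. For $k>0$ let $u^*(\cdot,k)$ be the solution of $u''+k^2c^*u=-\delta(x-x_0)$ on $\mathbb R$ (in the sense of distributions) with $\lim_{x\to\infty}(u'+iku)=0$, $\lim_{x\to-\infty}(u'-iku)=0$ and $u-u_0\in C^3(\mathbb R)$, where $u_0(x,k)=e^{-ik|x-x_0|}/(2ik)$. Put $w^*=u^*/u_0$, $g_0^*(k)=w^*(0,k)$, $\theta(x)=\int_{x_0}^x\sqrt{c^*(\xi)}\,d\xi-(x-x_0)$, and suppose that $\overline k$ is so large that $$|R(x,k)-1|<\tfrac12,\quad R(x,k):=w^*(x,k)\,c^*(x)^{1/4}e^{ik\theta(x)},\qquad x\in[0,1],\ k\ge\overline k .$$ Set $\log w^*=\ln|w^*|-ik\theta+i\arg R$ (principal argument) for $k\ge\overline k$ and $\log w^*(x,k)=-\int_k^{\overline k}\frac{\partial_kw^*}{w^*}(x,\kappa)\,d\kappa+\log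 w^*(x,\overline k)$ for $k<\overline k$; $v^*=\log w^*/k^2$, $q^*=\partial_kv^*$, and $V^*(x)=v^*(x,\overline k)$ (the exact tail). Let $N\ge1$, $h=(\overline k-\underline k)/N$, $k_n=\overline k-nh$, $q_0^*=0$, $q_n^*(x)=q^*(x,k_n)$ for $n\ge1$, where $q_n^*\in C^1[0,1]\cap H^2(0,1)$. **Data.** Let $\delta>0$ and $\eta=h+\delta$. The data are a differentiable function $g_0$ on $[\underline k,\overline k]$ and a logarithm $\log g_0$ of it with $$|\log g_0-\log g_0^*|\le\delta,\quad |g_0-g_0^*|\le\delta,\quad |g_0'-(g_0^*)'|\le\delta\quad\text{on }[\underline k,\overline k],$$ where $\log g_0^*(k)=\log w^*(0,k)$. Put $g_1(k)=2ik(g_0(k)-1)$ and $$\psi_n^0=\frac1h\Big(\frac{\log g_0(k_{n-1})}{k_{n-1}^2}-\frac{\log g_0(k_n)}{k_n^2}\Big),\qquad \psi_n^1=\frac1h\Big(\frac{2i}{k_{n-1}}\Big(1-\frac1{g_0(k_{n-1})}\Big)-\frac{2i}{k_n}\Big(1-\frac1{g_0(k_n)}\Big)\Big),$$ and assume $|\psi_n^0-q_n^*(0)|\le\eta$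 and $|\psi_n^1-(q_n^*)'(0)|\le\eta$ for $1\le n\le N$. **Algorithm (no inner iterations).** The QRM solution with parameter $\alpha$ of $y''+ay'+by=d$ on $(0,1)$, $y(0)=p_0$, $y'(0)=p_1$, $y'(1)=0$ is a minimizer of $\frac12\big(\|y''+ay'+by-d\|_{L^2(0,1)}^2+\alpha\|y\|_{H^3(0,1)}^2\big)$ over the $y\in H^3(0,1)$ with these boundary values. Let $V_1=V_0$ be the QRM solution, with $\alpha=\delta^2$, for $a=b=d=0$, $p_0=\log g_0(\overline k)/\overline k^2$, $p_1=g_1(\overline k)/(\overline k^2g_0(\overline k))$. For $n=1,2,\dots$, with $q_0=0$ and $Q_{n-1}=h\sum_{j=0}^{n-1}q_j$: 1. $q_n$ is the QRM solution, with $\alpha=\eta^2$, for $a=2k_n^2(-Q_{n-1}'+V_n')-2ik_n$, $b=0$, $d=-2k_n(-Q_{n-1}'+V_n')^2+2i(-Q_{n-1}'+V_n')$, $p_0=\psi_n^0$, $p_1=\psi_n^1$; 2. $\beta_n=\min\{\max\{|-v_n''-k_n^2(v_n')^2+2ik_nv_n'|,\,c_0-1\},\,c_1-1\}$, where $v_n^{(s)}=-hq_n^{(s)}-Q_{n-1}^{(s)}+V_n^{(s)}$,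 $s=1,2$; 3. $w_n$ is the QRM solution, with $\alpha=\eta^2$, for $a=-2i\overline k$, $b=\overline k^2\beta_n$, $d=0$, $p_0=g_0(\overline k)$, $p_1=g_1(\overline k)$; 4. $V_{n+1}'=\dfrac{w_n'}{\overline k^2w_n}$ and $V_{n+1}''=\dfrac{w_n''}{\overline k^2w_n}-\dfrac{(w_n')^2}{\overline k^2w_n^2}$. **Assumptions with the constant $M$.** Let $Q_{n-1}^*$ and $v_n^*$ be formed from the $q_j^*$ and $V^*$ as above, and let $$F_n^*=\beta^*+(v_n^*)''+k_n^2((v_n^*)')^2-2ik_n(v_n^*)',$$ $$G_n^*=(q_n^*)''+\big[2k_n^2(-(Q_{n-1}^*)'+(V^*)')-2ik_n\big](q_n^*)'+2k_n\big(-(Q_{n-1}^*)'+(V^*)'\big)^2-2i\big(-(Q_{n-1}^*)'+(V^*)'\big).$$ Let $M>1$ satisfy $M>24\overline k^2$, $M>16\sqrt{c_1}$ and, for $1\le n\le N$, $$\|F_n^*\|_{L^2(0,1)}\le M\eta,\quad\|G_n^*\|_{L^2(0,1)}\le M\eta,\quad\|q_n^*\|_{C^1[0,1]}\le M,\quad\|q_n^*\|_{H^2(0,1)}\le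 M,$$ $$\|(V^*)'\|_{C[0,1]}\le M,\quad\|(V^*)''\|_{L^2(0,1)}\le M,\quad\|(w^*)'(\cdot,\overline k)\|_{C[0,1]}\le M,\quad\|(w^*)''(\cdot,\overline k)\|_{L^2(0,1)}\le M .$$ Assume moreover that the exact solution has the form $v^*(x,k)=p(x)/k$ for $k\ge\overline k$ up to an error of size $M\eta/k^2$: there is $p\in C^2[0,1]$ with $\|v^*(\cdot,k)-p/k\|_{H^2(0,1)}\le M\eta/k^2$ for all $k\ge\overline k$. **Theorem 5.1.** There is a positive number $M_1=M_1(M\overline k^2)$, depending only on the product $M\overline k^2$, such that the following holds in the setting above. Let $1\le N_1\le N$ and $$\eta<\frac1{4c_1^{1/4}\,(M_1M^{16})^{2N_1}} .$$ Then for every outcome of the first $N_1$ steps of the algorithm and for every $n=1,\dots,N_1$: the function $w_n$ has no zeros on $[0,1]$, $(M_1M^{16})^n\eta<\sqrt\eta$, and each of $$\|\beta_n-\beta^*\|_{L^2(0,1)},\ \ \|q_n-q_n^*\|_{C^1[0,1]},\ \ \|q_n-q_n^*\|_{H^2(0,1)},\ \ \|V_{n+1}'-(V^*)'\|_{C[0,1]},\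 \ \|V_{n+1}''-(V^*)''\|_{L^2(0,1)}$$ is at most $(M_1M^{16})^n\eta$. -/

import Mathlib

open MeasureTheory Set Filter Topology
open scoped ENNReal ContDiff

noncomputable section

namespace Helmholtz

/-! ### Function spaces on the unit interval -/

/-- Lebesgue measure on `(0,1)`. -/
def unitMeasure : Measure ℝ := volume.restrict (Ioo 0 1)

/-- The norm of `L²(0,1)`, with value `∞` for functions that are not square integrable. -/
def normL2 (f : ℝ → ℂ) : ℝ≥0∞ := eLpNorm f 2 unitMeasure

/-- The square of the `H^m(0,1)` norm of a function whose derivative of order `j` is `D j`. -/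
def sobolevSq (m : ℕ) (D : ℕ → ℝ → ℂ) : ℝ≥0∞ := ∑ j ∈ Finset.range (m + 1), normL2 (D j) ^ 2

/-- The `H^m(0,1)` norm of a function whose derivative of order `j` is `D j`. -/
def normH (m : ℕ) (D : ℕ → ℝ → ℂ) : ℝ≥0∞ := sobolevSq m D ^ (1 / 2 : ℝ)

/-- An element of the complex Sobolev space `H^m(0,1)`: `D 0` is the continuous representative,
`D j` for `j ≤ m` is the derivative of order `j`. For `j < m` the function `D j` is absolutely
continuous on `[0,1]` with derivative `D (j + 1)`, and `D m` is square integrable.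
The values `D j` for `j > m` carry no meaning. -/
structure SobolevFn (m : ℕ) where
  D : ℕ → ℝ → ℂ
  memLp_top : MemLp (D m) 2 unitMeasure
  primitive : ∀ j < m, ∀ x ∈ Icc (0 : ℝ) 1, D j x = D j 0 + ∫ t in (0 : ℝ)..x, D (j + 1) t

/-- The `C[0,1]` norm of `f` is at most `B`. -/
def CLe (f : ℝ → ℂ) (B : ℝ) : Prop := ∀ x ∈ Icc (0 : ℝ) 1, ‖f x‖ ≤ B

/-- The `C¹[0,1]` norm (sup of the function plus sup of the derivative) of a function with
derivatives `D j` is at most `B`. -/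
def C1Le (D : ℕ → ℝ → ℂ) (B : ℝ) : Prop :=
  ∀ x ∈ Icc (0 : ℝ) 1, ∀ y ∈ Icc (0 : ℝ) 1, ‖D 0 x‖ + ‖D 1 y‖ ≤ B

/-! ### The quasi-reversibility method -/

/-- The functional `J_α(w) = (‖w'' + a w' + b w - d‖²_{L²} + α ‖w‖²_{H³}) / 2`. -/
def qrmFunctional (α : ℝ) (a b d : ℝ → ℂ) (w : SobolevFn 3) : ℝ≥0∞ :=
  (normL2 (fun x => w.D 2 x + a x * w.D 1 x + b x * w.D 0 x - d x) ^ 2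
    + ENNReal.ofReal α * sobolevSq 3 w.D) / 2

/-- The boundary conditions `w(0) = p₀`, `w'(0) = p₁`, `w'(1) = 0`. -/
def BoundaryCond (p₀ p₁ : ℂ) (w : SobolevFn 3) : Prop :=
  w.D 0 0 = p₀ ∧ w.D 1 0 = p₁ ∧ w.D 1 1 = 0

/-- `w` is the QRM solution with parameter `α` of `w'' + a w' + b w = d`, `w(0) = p₀`,
`w'(0) = p₁`, `w'(1) = 0`: it minimizes `J_α` over the functions of `H³(0,1)` with these
boundary values. -/
def IsQRMSolution (α : ℝ) (a b d : ℝ → ℂ) (p₀ p₁ : ℂ) (w : SobolevFn 3) : Prop :=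
  BoundaryCond p₀ p₁ w ∧
    ∀ z : SobolevFn 3, BoundaryCond p₀ p₁ z → qrmFunctional α a b d w ≤ qrmFunctional α a b d z

/-! ### The forward problem -/

/-- `c ∈ C²(ℝ)` with values in `[c₀, c₁]`, and `c = 1` outside `(0,1)`. -/
structure IsAdmissible (c₀ c₁ : ℝ) (c : ℝ → ℝ) : Prop where
  contDiff : ContDiff ℝ 2 c
  mem_Icc : ∀ x, c x ∈ Icc c₀ c₁
  eq_one : ∀ x, x ∉ Ioo (0 : ℝ) 1 → c x = 1

/-- The incident field `u₀(x, k) = exp(-i k |x - x₀|) / (2 i k)`. -/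
def incident (x₀ x k : ℝ) : ℂ :=
  Complex.exp (-Complex.I * k * |x - x₀|) / (2 * Complex.I * k)

/-- `u` solves `u'' + k² c u = -δ(x - x₀)` on `ℝ` in the sense of distributions, satisfies the
radiation conditions, and `u - u₀ ∈ C³(ℝ)`. -/
structure IsForwardSolution (c : ℝ → ℝ) (x₀ k : ℝ) (u : ℝ → ℂ) : Prop where
  contDiff : ContDiff ℝ 3 (fun x => u x - incident x₀ x k)
  equation : ∀ φ : ℝ → ℂ, ContDiff ℝ ∞ φ → HasCompactSupport φ →
    ∫ x, u x * (deriv (deriv φ) x + (k : ℂ) ^ 2 * c x * φ x) = -φ x₀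
  radiation_top : Tendsto (fun x => deriv u x + Complex.I * k * u x) atTop (𝓝 0)
  radiation_bot : Tendsto (fun x => deriv u x - Complex.I * k * u x) atBot (𝓝 0)

/-! ### Functions derived from the wave field `u(x, k)` -/

/-- `w(x, k) = u(x, k) / u₀(x, k)`. -/
def wField (x₀ : ℝ) (u : ℝ → ℝ → ℂ) (x k : ℝ) : ℂ := u x k / incident x₀ x k

/-- `∫_{x₀}^x √c(ξ) dξ - (x - x₀)`. -/
def phase (c : ℝ → ℝ) (x₀ x : ℝ) : ℝ := (∫ t in x₀..x, Real.sqrt (c t)) - (x - x₀)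

/-- The quantity `1 + O(1/k)` in the high frequency representation
`w(x,k) = c(x)^{-1/4} exp(-i k phase(x)) (1 + O(1/k))`. -/
def highFreqFactor (c : ℝ → ℝ) (x₀ : ℝ) (u : ℝ → ℝ → ℂ) (x k : ℝ) : ℂ :=
  wField x₀ u x k * ((c x ^ (1 / 4 : ℝ) : ℝ) : ℂ) * Complex.exp (Complex.I * k * phase c x₀ x)

/-- The logarithm of `w` for large `k`:
`ln |w| - i k phase(x) + i arg (1 + O(1/k))`, with the principal argument. -/
def logHigh (c : ℝ → ℝ) (x₀ : ℝ) (u : ℝ → ℝ → ℂ) (x k : ℝ) : ℂ :=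
  (Real.log ‖wField x₀ u x k‖ : ℂ) - Complex.I * k * phase c x₀ x
    + Complex.I * Complex.arg (highFreqFactor c x₀ u x k)

/-- The branch of `log w(x, k)`: for `k ≥ kmax` the function `logHigh`, and for `k < kmax` its
continuation `-∫_k^{kmax} ∂_k w / w dκ + log w(x, kmax)`. -/
def logW (c : ℝ → ℝ) (x₀ kmax : ℝ) (u : ℝ → ℝ → ℂ) (x k : ℝ) : ℂ :=
  open Classical in
  if kmax ≤ k then logHigh c x₀ u x k
  else -(∫ κ in k..kmax, deriv (fun s => wField x₀ u x s) κ / wField x₀ u x κ)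
    + logHigh c x₀ u x kmax

/-- `v(x, k) = log w(x, k) / k²`. -/
def vField (c : ℝ → ℝ) (x₀ kmax : ℝ) (u : ℝ → ℝ → ℂ) (x k : ℝ) : ℂ :=
  logW c x₀ kmax u x k / (k : ℂ) ^ 2

/-- `q(x, k) = ∂_k v(x, k)`. -/
def qField (c : ℝ → ℝ) (x₀ kmax : ℝ) (u : ℝ → ℝ → ℂ) (x k : ℝ) : ℂ :=
  deriv (fun s => vField c x₀ kmax u x s) k

/-- The derivative of order `s` of the tail `V(x) = v(x, kmax)`. -/
def tailDeriv (c : ℝ → ℝ) (x₀ kmax : ℝ) (u : ℝ → ℝ → ℂ) (s : ℕ) (x : ℝ) : ℂ :=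
  iteratedDeriv s (fun y => vField c x₀ kmax u y kmax) x

/-- For `k ≥ kmax` one has `v(x, k) = p(x) / k + r(x, k)` with `p ∈ C²[0,1]` and
`‖r(·, k)‖_{H²(0,1)} ≤ ε / k²`. -/
def TailForm (c : ℝ → ℝ) (x₀ kmax : ℝ) (u : ℝ → ℝ → ℂ) (ε : ℝ) : Prop :=
  ∃ p : ℝ → ℂ, ContDiff ℝ 2 p ∧ ∀ k, kmax ≤ k →
    normH 2 (fun j => iteratedDeriv j (fun x => vField c x₀ kmax u x k - p x / k))
      ≤ ENNReal.ofReal (ε / k ^ 2)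

/-! ### Data -/

/-- The grid `k_n = kmax - n h`. -/
def grid (kmax h : ℝ) (n : ℕ) : ℝ := kmax - n * h

/-- `g₁(k) = 2 i k (g₀(k) - 1)`. -/
def g₁ (g₀ : ℝ → ℂ) (k : ℝ) : ℂ := 2 * Complex.I * k * (g₀ k - 1)

/-- The boundary value `ψ_n⁰`, where `l` is the logarithm of `g₀`. -/
def psi0 (kmax h : ℝ) (l : ℝ → ℂ) (n : ℕ) : ℂ :=
  (l (grid kmax h (n - 1)) / (grid kmax h (n - 1) : ℂ) ^ 2
    - l (grid kmax h n) / (grid kmax h n : ℂ) ^ 2) / h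

/-- The boundary value `ψ_n¹`. -/
def psi1 (kmax h : ℝ) (g₀ : ℝ → ℂ) (n : ℕ) : ℂ :=
  (2 * Complex.I / (grid kmax h (n - 1) : ℂ) * (1 - 1 / g₀ (grid kmax h (n - 1)))
    - 2 * Complex.I / (grid kmax h n : ℂ) * (1 - 1 / g₀ (grid kmax h n))) / h

/-- The data `g₀`, with logarithm `l`, differ from the exact data `gs`, with logarithm `ls`, by at
most `δ` on `[kmin, kmax]`. -/
structure DataError (kmin kmax δ : ℝ) (g₀ l gs ls : ℝ → ℂ) : Prop where
  exp_log : ∀ k ∈ Icc kmin kmax, Complex.exp (l k) = g₀ k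
  log_le : ∀ k ∈ Icc kmin kmax, ‖l k - ls k‖ ≤ δ
  val_le : ∀ k ∈ Icc kmin kmax, ‖g₀ k - gs k‖ ≤ δ
  differentiableOn : DifferentiableOn ℝ g₀ (Icc kmin kmax)
  deriv_le : ∀ k ∈ Icc kmin kmax,
    ‖derivWithin g₀ (Icc kmin kmax) k - derivWithin gs (Icc kmin kmax) k‖ ≤ δ

/-! ### The discretized equations -/

/-- `-Q_{n-1}^{(s)} + V^{(s)}` with `Q_{n-1} = h (q_0 + … + q_{n-1})` and `q_0 = 0`; `q j s` is the
derivative of order `s` of `q_j`, and `V` is the derivative of order `s` of the tail. -/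
def tailMinusQ (h : ℝ) (q : ℕ → ℕ → ℝ → ℂ) (V : ℝ → ℂ) (n s : ℕ) (x : ℝ) : ℂ :=
  -(h * ∑ j ∈ Finset.Ico 1 n, q j s x) + V x

/-- `v_n^{(s)} = -h q_n^{(s)} - Q_{n-1}^{(s)} + V^{(s)}`. -/
def vDisc (h : ℝ) (q : ℕ → ℕ → ℝ → ℂ) (V : ℝ → ℂ) (n s : ℕ) (x : ℝ) : ℂ :=
  -(h * q n s x) + tailMinusQ h q V n s x

/-- The coefficient `2 k_n² (-Q_{n-1}' + V') - 2 i k_n` of `q_n'`. -/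
def coeffA (kmax h : ℝ) (q : ℕ → ℕ → ℝ → ℂ) (V' : ℝ → ℂ) (n : ℕ) (x : ℝ) : ℂ :=
  2 * (grid kmax h n : ℂ) ^ 2 * tailMinusQ h q V' n 1 x - 2 * Complex.I * grid kmax h n

/-- The right hand side `-2 k_n (-Q_{n-1}' + V')² + 2 i (-Q_{n-1}' + V')`. -/
def rhsD (kmax h : ℝ) (q : ℕ → ℕ → ℝ → ℂ) (V' : ℝ → ℂ) (n : ℕ) (x : ℝ) : ℂ :=
  -2 * (grid kmax h n : ℂ) * tailMinusQ h q V' n 1 x ^ 2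
    + 2 * Complex.I * tailMinusQ h q V' n 1 x

/-- `-v_n'' - k_n² (v_n')² + 2 i k_n v_n'`. -/
def betaExpr (kmax h : ℝ) (q : ℕ → ℕ → ℝ → ℂ) (V' V'' : ℝ → ℂ) (n : ℕ) (x : ℝ) : ℂ :=
  -vDisc h q V'' n 2 x - (grid kmax h n : ℂ) ^ 2 * vDisc h q V' n 1 x ^ 2
    + 2 * Complex.I * grid kmax h n * vDisc h q V' n 1 x

/-- The algorithm without inner iterations, up to step `N₁`. `V' n` and `V'' n` are the derivatives
of the tail that is used in step `n`; `V 1` is the initial tail `V₀`, and `V (n + 1)` is the tail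
that is computed at the end of step `n`. The QRM parameter is `δ²` for the initial tail and `η²` in
the steps. -/
structure IsAlgorithmRun (c₀ c₁ kmax h δ η : ℝ) (N₁ : ℕ) (g₀ l : ℝ → ℂ)
    (V₀ : SobolevFn 3) (q w : ℕ → SobolevFn 3) (β : ℕ → ℝ → ℝ) (V' V'' : ℕ → ℝ → ℂ) : Prop where
  init : IsQRMSolution (δ ^ 2) 0 0 0 (l kmax / (kmax : ℂ) ^ 2)
    (g₁ g₀ kmax / ((kmax : ℂ) ^ 2 * g₀ kmax)) V₀
  tail_one : V' 1 = V₀.D 1 ∧ V'' 1 = V₀.D 2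
  step_q : ∀ n ∈ Finset.Icc 1 N₁,
    IsQRMSolution (η ^ 2) (coeffA kmax h (fun j => (q j).D) (V' n) n) 0
      (rhsD kmax h (fun j => (q j).D) (V' n) n) (psi0 kmax h l n) (psi1 kmax h g₀ n) (q n)
  step_β : ∀ n ∈ Finset.Icc 1 N₁, ∀ x,
    β n x = min (max ‖betaExpr kmax h (fun j => (q j).D) (V' n) (V'' n) n x‖ (c₀ - 1)) (c₁ - 1)
  step_w : ∀ n ∈ Finset.Icc 1 N₁,
    IsQRMSolution (η ^ 2) (fun _ => -2 * Complex.I * kmax) (fun x => (kmax : ℂ) ^ 2 * β n x) 0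
      (g₀ kmax) (g₁ g₀ kmax) (w n)
  step_V' : ∀ n ∈ Finset.Icc 1 N₁, ∀ x,
    V' (n + 1) x = (w n).D 1 x / ((kmax : ℂ) ^ 2 * (w n).D 0 x)
  step_V'' : ∀ n ∈ Finset.Icc 1 N₁, ∀ x,
    V'' (n + 1) x = (w n).D 2 x / ((kmax : ℂ) ^ 2 * (w n).D 0 x)
      - (w n).D 1 x ^ 2 / ((kmax : ℂ) ^ 2 * (w n).D 0 x ^ 2)

/-- The functions `q_n^*(x) = q^*(x, k_n)`, `n = 1, …, N`, belong to `H²(0,1)`, and `qs n` carries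
their derivatives. -/
def Represents (c : ℝ → ℝ) (x₀ kmax h : ℝ) (u : ℝ → ℝ → ℂ) (N : ℕ) (qs : ℕ → SobolevFn 2) :
    Prop :=
  ∀ n ∈ Finset.Icc 1 N, ∀ x ∈ Icc (0 : ℝ) 1,
    (qs n).D 0 x = qField c x₀ kmax u x (grid kmax h n) ∧
      HasDerivAt (fun y => qField c x₀ kmax u y (grid kmax h n)) ((qs n).D 1 x) x

/-- The error function `F_n^*`: what is missing in the formula that expresses `β^* = c - 1` through
`v_n^*`. -/
def errF (c : ℝ → ℝ) (x₀ kmax h : ℝ) (u : ℝ → ℝ → ℂ) (qs : ℕ → SobolevFn 2) (n : ℕ) (x : ℝ) : ℂ :=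
  ((c x - 1 : ℝ) : ℂ) - betaExpr kmax h (fun j => (qs j).D) (tailDeriv c x₀ kmax u 1)
    (tailDeriv c x₀ kmax u 2) n x

/-- The error function `G_n^*`: the residual of `q_n^*` in the discretized equation. -/
def errG (c : ℝ → ℝ) (x₀ kmax h : ℝ) (u : ℝ → ℝ → ℂ) (qs : ℕ → SobolevFn 2) (n : ℕ) (x : ℝ) : ℂ :=
  (qs n).D 2 x + coeffA kmax h (fun j => (qs j).D) (tailDeriv c x₀ kmax u 1) n x * (qs n).D 1 x
    - rhsD kmax h (fun j => (qs j).D) (tailDeriv c x₀ kmax u 1) n x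

/-- The bounds on the exact solution with the constant `M`. -/
structure ExactBounds (c : ℝ → ℝ) (x₀ kmax h η M : ℝ) (u : ℝ → ℝ → ℂ) (N : ℕ)
    (qs : ℕ → SobolevFn 2) : Prop where
  errF_le : ∀ n ∈ Finset.Icc 1 N, normL2 (errF c x₀ kmax h u qs n) ≤ ENNReal.ofReal (M * η)
  errG_le : ∀ n ∈ Finset.Icc 1 N, normL2 (errG c x₀ kmax h u qs n) ≤ ENNReal.ofReal (M * η)
  q_C1 : ∀ n ∈ Finset.Icc 1 N, C1Le (qs n).D M
  q_H2 : ∀ n ∈ Finset.Icc 1 N, normH 2 (qs n).D ≤ ENNReal.ofReal M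
  tail_one : CLe (tailDeriv c x₀ kmax u 1) M
  tail_two : normL2 (tailDeriv c x₀ kmax u 2) ≤ ENNReal.ofReal M
  w_one : CLe (iteratedDeriv 1 (fun y => wField x₀ u y kmax)) M
  w_two : normL2 (iteratedDeriv 2 (fun y => wField x₀ u y kmax)) ≤ ENNReal.ofReal M

end Helmholtz

end

/-!
Every stage of the algorithm is a quasi-reversibility problem or an algebraic expression in its
solution, and each of them depends on its data in a Lipschitz way. Consequently one step multiplies
the error by at most a constant, and `n` steps by its `n`-th power. All constants depend on
`s = M * kmax ^ 2` only, since `M`, `kmax`, `c₁` and `4 c₁^{1/4}` are at most `1 + s ^ 2`.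

*Quasi-reversibility.* Let `s` solve `s'' + a s' + b s = d` up to `e` in `L²(0,1)`, with boundary values
`e`-close to the data. If some competitor, bounded in `H³(0,1)` and with the given boundary values,
is `O(e)`-close to `s` in `H²(0,1)`, then comparison of the functionals at the minimizer `y` and at
the competitor shows that the residual of `y` is `O(e)` for a parameter `α ≤ e²`, and Grönwall's
inequality bounds `y - s` (`qrm_stability`). No Carleman estimate is needed, because both Cauchy data
at `0` are prescribed. As `s` is only in `H²(0,1)`, the existence of the competitor is the
essential point. It is obtained by integrating twice a function `f`, bounded in `H¹(0,1)` and
`O(e)`-close to `s''`, after adding a small constant that restores the boundary condition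
`s'(1) = 0` (`exists_competitor`).

*The competitors.* For `q_n` the equation itself provides `f`: it is the right-hand side minus the
first-order term, both of which are in `H¹(0,1)` when they are formed from the exact solution
(`q_step`). For the initial tail and for `w_n` one takes `f = 0`, because the second derivatives of
`V` and of `w` are `O(η)` for the exact solution (`initial_tail`, `w_step`). This is where the
assumed form `v = p / k` of the high frequency solution enters (`tail_derivs_le`). The exact `v`
satisfies the Riccati equation `v'' + k² (v')² - 2ik v' + c - 1 = 0`, hence
`p'' / k + (p')² - 2ip' + c - 1 = O(η)` for every `k ≥ kmax`. The difference of these relations at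
`kmax` and `2 kmax` is `p'' / (2 kmax) = O(η)`. As `v'(1) = 0`, the first derivative is `O(η)`, too.

*The exact solution.* To the right of the source the normalized field `w = u / u₀` satisfies
`w'' - 2ik w' + k² (c - 1) w = 0`, and the radiation conditions turn into `w'(0) = 2ik (w(0) - 1)` and
`w' = 0` on `[1,∞)` (`IsForwardSolution.exists_normalizedField`). The last fact gives `v'(1) = 0` and
`q_n'(1) = 0`, and the first one explains the boundary values for `w_n`. By
`|R - 1| < 1/2` the exact `w` is bounded below by `1 / (2 c₁^{1/4})`; as the error of `w_n` is at most
`1 / (4 c₁^{1/4})`, the function `w_n` has no zeros, and the tail can be updated.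
-/

namespace Helmholtz

/-! ### Square integrable functions on the unit interval -/

/-- `f` is measurable on `(0,1)` and `‖f‖_{L²(0,1)} ≤ e`. -/
structure L2Le (f : ℝ → ℂ) (e : ℝ) : Prop where
  nonneg : 0 ≤ e
  meas : AEStronglyMeasurable f unitMeasure
  norm_le : normL2 f ≤ ENNReal.ofReal e

instance : IsProbabilityMeasure unitMeasure :=
  ⟨by simp [unitMeasure]⟩

theorem ae_unitMeasure {p : ℝ → Prop} (h : ∀ x ∈ Icc (0 : ℝ) 1, p x) :
    ∀ᵐ x ∂unitMeasure, p x := by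
  refine (ae_restrict_iff' measurableSet_Ioo).2 (Eventually.of_forall fun x hx => ?_)
  exact h x (Ioo_subset_Icc_self hx)

namespace L2Le

variable {f g : ℝ → ℂ} {a b : ℝ}

theorem congr (hf : L2Le f a) (h : ∀ x ∈ Icc (0 : ℝ) 1, f x = g x) : L2Le g a := by
  have h' : f =ᵐ[unitMeasure] g := ae_unitMeasure h
  refine ⟨hf.nonneg, hf.meas.congr h', ?_⟩
  have : normL2 g = normL2 f := (eLpNorm_congr_ae h').symm
  rw [this]
  exact hf.norm_le

theorem mono (hf : L2Le f a) (h : a ≤ b) : L2Le f b :=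
  ⟨hf.nonneg.trans h, hf.meas, hf.norm_le.trans (ENNReal.ofReal_le_ofReal h)⟩

theorem add (hf : L2Le f a) (hg : L2Le g b) : L2Le (fun x => f x + g x) (a + b) := by
  refine ⟨add_nonneg hf.nonneg hg.nonneg, hf.meas.add hg.meas, ?_⟩
  rw [ENNReal.ofReal_add hf.nonneg hg.nonneg]
  exact (eLpNorm_add_le hf.meas hg.meas (by norm_num)).trans (add_le_add hf.norm_le hg.norm_le)

theorem neg (hf : L2Le f a) : L2Le (fun x => -f x) a :=
  ⟨hf.nonneg, hf.meas.neg, (eLpNorm_neg f 2 unitMeasure).trans_le hf.norm_le⟩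

theorem sub (hf : L2Le f a) (hg : L2Le g b) : L2Le (fun x => f x - g x) (a + b) :=
  (hf.add hg.neg).congr fun x _ => by ring

/-- Comparison of the norm of `f` with a multiple of the norm of `g`. -/
theorem of_le_mul (hg : L2Le g b) (ha : 0 ≤ a) (hf : AEStronglyMeasurable f unitMeasure)
    (h : ∀ x ∈ Icc (0 : ℝ) 1, ‖f x‖ ≤ a * ‖g x‖) : L2Le f (a * b) := by
  refine ⟨mul_nonneg ha hg.nonneg, hf, ?_⟩
  have := eLpNorm_le_mul_eLpNorm_of_ae_le_mul (μ := unitMeasure) (f := f) (g := g)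
    (ae_unitMeasure h) 2
  rw [ENNReal.ofReal_mul ha]
  exact this.trans (mul_le_mul_right hg.norm_le _)

theorem mul (hf : AEStronglyMeasurable f unitMeasure) (ha : ∀ x ∈ Icc (0 : ℝ) 1, ‖f x‖ ≤ a)
    (hg : L2Le g b) : L2Le (fun x => f x * g x) (a * b) := by
  have h0 : 0 ≤ a := (norm_nonneg _).trans (ha 0 (by simp))
  refine hg.of_le_mul h0 (hf.mul hg.meas) fun x hx => ?_
  rw [norm_mul]
  exact mul_le_mul_of_nonneg_right (ha x hx) (norm_nonneg _)

theorem const_mul (c : ℂ) (hg : L2Le g b) : L2Le (fun x => c * g x) (‖c‖ * b) :=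
  mul aestronglyMeasurable_const (fun _ _ => le_rfl) hg

theorem of_bound (hf : AEStronglyMeasurable f unitMeasure)
    (h : ∀ x ∈ Icc (0 : ℝ) 1, ‖f x‖ ≤ a) : L2Le f a := by
  have h0 : 0 ≤ a := (norm_nonneg _).trans (h 0 (by simp))
  refine ⟨h0, hf, ?_⟩
  have := eLpNorm_le_of_ae_bound (p := 2) (μ := unitMeasure) (ae_unitMeasure h)
  simpa [normL2] using this

theorem sum {ι : Type*} (s : Finset ι) {F : ι → ℝ → ℂ} {e : ι → ℝ}
    (h : ∀ i ∈ s, L2Le (F i) (e i)) : L2Le (fun x => ∑ i ∈ s, F i x) (∑ i ∈ s, e i) := by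
  classical
  induction s using Finset.induction_on with
  | empty => simpa using of_bound (f := fun _ => 0) (a := 0) aestronglyMeasurable_const (by simp)
  | insert i s hi ih =>
    simp only [Finset.sum_insert hi]
    exact (h i (by simp)).add (ih fun j hj => h j (by simp [hj]))

theorem integrable (hf : L2Le f a) : Integrable f unitMeasure := by
  have : MemLp f 2 unitMeasure := ⟨hf.meas, hf.norm_le.trans_lt ENNReal.ofReal_lt_top⟩
  exact this.integrable (by norm_num)

theorem intervalIntegrable (hf : L2Le f a) : IntervalIntegrable f volume 0 1 := by
  rw [intervalIntegrable_iff_integrableOn_Ioo_of_le zero_le_one]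
  exact hf.integrable

theorem eLpNorm_one_le (hf : L2Le f a) : eLpNorm f 1 unitMeasure ≤ ENNReal.ofReal a :=
  (eLpNorm_le_eLpNorm_of_exponent_le (by norm_num) hf.meas).trans hf.norm_le

theorem integral_norm_le (hf : L2Le f a) : ∫ t, ‖f t‖ ∂unitMeasure ≤ a := by
  have h1 := hf.eLpNorm_one_le
  rw [eLpNorm_one_eq_lintegral_enorm] at h1
  rw [integral_norm_eq_lintegral_enorm hf.meas]
  exact ENNReal.toReal_le_of_le_ofReal hf.nonneg h1

theorem integral_norm_le_of_mem (hf : L2Le f a) {x y : ℝ} (hx : x ∈ Icc (0 : ℝ) 1)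
    (hy : y ∈ Icc (0 : ℝ) 1) (hxy : x ≤ y) : ∫ t in x..y, ‖f t‖ ≤ a := by
  refine le_trans ?_ hf.integral_norm_le
  have h1 : IntegrableOn (fun t => ‖f t‖) (Ioc 0 1) volume :=
    (integrableOn_Ioc_iff_integrableOn_Ioo (by finiteness)).2 hf.integrable.norm
  rw [intervalIntegral.integral_of_le hxy, unitMeasure, ← integral_Ioc_eq_integral_Ioo]
  exact setIntegral_mono_set h1 (Eventually.of_forall fun _ => norm_nonneg _)
    (Ioc_subset_Ioc hx.1 hy.2).eventuallyLE

theorem norm_integral_le (hf : L2Le f a) {x y : ℝ} (hx : x ∈ Icc (0 : ℝ) 1)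
    (hy : y ∈ Icc (0 : ℝ) 1) : ‖∫ t in x..y, f t‖ ≤ a := by
  rcases le_total x y with hxy | hxy
  · exact (intervalIntegral.norm_integral_le_integral_norm hxy).trans
      (hf.integral_norm_le_of_mem hx hy hxy)
  · rw [intervalIntegral.integral_symm, norm_neg]
    exact (intervalIntegral.norm_integral_le_integral_norm hxy).trans
      (hf.integral_norm_le_of_mem hy hx hxy)

/-- A function of norm at most `a` is somewhere at most `a` in modulus. -/
theorem le_of_forall_le (hf : L2Le f a) {c : ℝ} (h : ∀ x ∈ Icc (0 : ℝ) 1, c ≤ ‖f x‖) :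
    c ≤ a := by
  have h1 : ∫ _, c ∂unitMeasure ≤ ∫ t, ‖f t‖ ∂unitMeasure :=
    integral_mono_ae (integrable_const c) hf.integrable.norm (ae_unitMeasure h)
  simpa using h1.trans hf.integral_norm_le

end L2Le

theorem aestronglyMeasurable_of_continuousOn {f : ℝ → ℂ} (hf : ContinuousOn f (Icc 0 1)) :
    AEStronglyMeasurable f unitMeasure :=
  (hf.mono Ioo_subset_Icc_self).aestronglyMeasurable measurableSet_Ioo

theorem sobolevSq_le {m : ℕ} {D : ℕ → ℝ → ℂ} {e : ℝ} (h : ∀ j ≤ m, L2Le (D j) e) :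
    sobolevSq m D ≤ ENNReal.ofReal ((m + 1) * e ^ 2) := by
  have he : 0 ≤ e := (h 0 (Nat.zero_le _)).nonneg
  have h1 : sobolevSq m D ≤ ∑ j ∈ Finset.range (m + 1), ENNReal.ofReal (e ^ 2) := by
    refine Finset.sum_le_sum fun j hj => ?_
    rw [ENNReal.ofReal_pow he]
    exact pow_le_pow_left' (h j (by simpa [Nat.lt_succ_iff] using hj)).norm_le 2
  refine h1.trans_eq ?_
  rw [Finset.sum_const, Finset.card_range, nsmul_eq_mul, ENNReal.ofReal_mul (by positivity)]
  congr 1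
  rw [← Nat.cast_one (R := ℝ), ← Nat.cast_add, ENNReal.ofReal_natCast]

theorem normH_two_le {D : ℕ → ℝ → ℂ} {e : ℝ} (h : ∀ j ≤ 2, L2Le (D j) e) :
    normH 2 D ≤ ENNReal.ofReal (2 * e) := by
  have he : 0 ≤ e := (h 0 (Nat.zero_le _)).nonneg
  have h1 : sobolevSq 2 D ≤ ENNReal.ofReal (2 * e) ^ (2 : ℝ) := by
    refine (sobolevSq_le h).trans ?_
    rw [ENNReal.ofReal_rpow_of_nonneg (by positivity) (by norm_num)]
    refine ENNReal.ofReal_le_ofReal ?_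
    norm_num
    nlinarith [sq_nonneg e]
  have h2 := ENNReal.rpow_le_rpow h1 (show (0 : ℝ) ≤ 1 / 2 by norm_num)
  rw [← ENNReal.rpow_mul] at h2
  simpa [normH] using h2

theorem normL2_le_normH {m j : ℕ} (hj : j ≤ m) (D : ℕ → ℝ → ℂ) : normL2 (D j) ≤ normH m D := by
  have h1 : normL2 (D j) ^ 2 ≤ sobolevSq m D :=
    Finset.single_le_sum (f := fun j => normL2 (D j) ^ 2) (fun _ _ => zero_le)
      (Finset.mem_range.2 (Nat.lt_succ_of_le hj))
  have h2 := ENNReal.rpow_le_rpow h1 (show (0 : ℝ) ≤ 1 / 2 by norm_num)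
  rw [← ENNReal.rpow_natCast, ← ENNReal.rpow_mul] at h2
  simpa [normH] using h2

/-! ### Absolutely continuous functions -/

/-- `f` is absolutely continuous on `[0,1]` with derivative `F`. -/
def IsPrimitive (f F : ℝ → ℂ) : Prop :=
  IntervalIntegrable F volume 0 1 ∧ ∀ x ∈ Icc (0 : ℝ) 1, f x = f 0 + ∫ t in (0 : ℝ)..x, F t

namespace IsPrimitive

variable {f g F G : ℝ → ℂ}

theorem intervalIntegrable (h : IsPrimitive f F) {x y : ℝ} (hx : x ∈ Icc (0 : ℝ) 1)
    (hy : y ∈ Icc (0 : ℝ) 1) : IntervalIntegrable F volume x y :=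
  h.1.mono_set (by rw [uIcc_of_le zero_le_one]; exact uIcc_subset_Icc hx hy)

theorem continuousOn (h : IsPrimitive f F) : ContinuousOn f (Icc 0 1) := by
  have h1 : ContinuousOn (fun x => f 0 + ∫ t in (0 : ℝ)..x, F t) (Icc 0 1) := by
    refine continuousOn_const.add ?_
    have := intervalIntegral.continuousOn_primitive_interval (μ := volume) (f := F) (a := 0) (b := 1)
      ((intervalIntegrable_iff_integrableOn_Icc_of_le zero_le_one).1 h.1 |>.mono_set
        (by rw [uIcc_of_le zero_le_one]))
    rwa [uIcc_of_le zero_le_one] at this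
  exact h1.congr h.2

theorem meas (h : IsPrimitive f F) : AEStronglyMeasurable f unitMeasure :=
  aestronglyMeasurable_of_continuousOn h.continuousOn

theorem sub_eq (h : IsPrimitive f F) {x y : ℝ} (hx : x ∈ Icc (0 : ℝ) 1)
    (hy : y ∈ Icc (0 : ℝ) 1) : f y - f x = ∫ t in x..y, F t := by
  rw [h.2 x hx, h.2 y hy, ← intervalIntegral.integral_add_adjacent_intervals
    (h.intervalIntegrable (by simp) hx) (h.intervalIntegrable hx hy)]
  ring

theorem congr (h : IsPrimitive f F) (hf : ∀ x ∈ Icc (0 : ℝ) 1, f x = g x)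
    (hF : ∀ x ∈ Icc (0 : ℝ) 1, F x = G x) : IsPrimitive g G := by
  have hs : ∀ x ∈ Icc (0 : ℝ) 1, uIcc 0 x ⊆ Icc (0 : ℝ) 1 := fun x hx =>
    uIcc_subset_Icc (by simp) hx
  refine ⟨h.1.congr fun x hx => ?_, fun x hx => ?_⟩
  · rw [uIoc_of_le zero_le_one] at hx
    exact hF x (Ioc_subset_Icc_self hx)
  · rw [← hf x hx, ← hf 0 (by simp), h.2 x hx]
    congr 1
    exact intervalIntegral.integral_congr fun t ht => hF t (hs x hx ht)

theorem add (hf : IsPrimitive f F) (hg : IsPrimitive g G) :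
    IsPrimitive (fun x => f x + g x) (fun x => F x + G x) := by
  refine ⟨hf.1.add hg.1, fun x hx => ?_⟩
  have h0 : (0 : ℝ) ∈ Icc (0 : ℝ) 1 := by simp
  rw [intervalIntegral.integral_add (hf.intervalIntegrable h0 hx) (hg.intervalIntegrable h0 hx)]
  linear_combination hf.2 x hx + hg.2 x hx

theorem const_mul (c : ℂ) (hf : IsPrimitive f F) :
    IsPrimitive (fun x => c * f x) (fun x => c * F x) := by
  refine ⟨hf.1.const_mul c, fun x hx => ?_⟩
  rw [intervalIntegral.integral_const_mul]
  linear_combination c * hf.2 x hx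

theorem sub (hf : IsPrimitive f F) (hg : IsPrimitive g G) :
    IsPrimitive (fun x => f x - g x) (fun x => F x - G x) :=
  (hf.add (hg.const_mul (-1))).congr (fun x _ => by ring) (fun x _ => by ring)

theorem const (c : ℂ) : IsPrimitive (fun _ => c) (fun _ => 0) :=
  ⟨by simp, by simp⟩

theorem sum {ι : Type*} (s : Finset ι) {f F : ι → ℝ → ℂ} (h : ∀ i ∈ s, IsPrimitive (f i) (F i)) :
    IsPrimitive (fun x => ∑ i ∈ s, f i x) (fun x => ∑ i ∈ s, F i x) := by
  classical
  induction s using Finset.induction_on with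
  | empty => simpa using const 0
  | insert i s hi ih =>
    simp only [Finset.sum_insert hi]
    exact (h i (by simp)).add (ih fun j hj => h j (by simp [hj]))

/-- Real and imaginary parts reduce absolute continuity of a complex indefinite integral to the
real case. -/
theorem absolutelyContinuous_integral (h : IntervalIntegrable F volume 0 1) :
    AbsolutelyContinuousOnInterval (fun x => ∫ t in (0 : ℝ)..x, F t) 0 1 := by
  have hre : IntervalIntegrable (fun t => (F t).re) volume 0 1 := ⟨h.1.re, h.2.re⟩
  have him : IntervalIntegrable (fun t => (F t).im) volume 0 1 := ⟨h.1.im, h.2.im⟩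
  have hc : ∀ c : ℂ, AbsolutelyContinuousOnInterval (fun _ : ℝ => c) 0 1 := fun c =>
    ((LipschitzWith.const c).lipschitzOnWith (s := uIcc 0 1)).absolutelyContinuousOnInterval
  have h1 := ((hre.absolutelyContinuousOnInterval_intervalIntegral
    (left_mem_uIcc)).fun_smul (hc 1)).add
    ((him.absolutelyContinuousOnInterval_intervalIntegral (left_mem_uIcc)).fun_smul
      (hc Complex.I))
  have h2 : ∀ x ∈ uIcc (0 : ℝ) 1, (∫ t in (0 : ℝ)..x, F t) =
      (∫ t in (0 : ℝ)..x, (F t).re) • (1 : ℂ) + (∫ t in (0 : ℝ)..x, (F t).im) • Complex.I := by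
    intro x hx
    have hx' : IntervalIntegrable F volume 0 x :=
      h.mono_set (uIcc_subset_uIcc left_mem_uIcc hx)
    have e1 := Complex.reCLM.intervalIntegral_comp_comm hx'
    have e2 := Complex.imCLM.intervalIntegral_comp_comm hx'
    simp only [Complex.reCLM_apply, Complex.imCLM_apply] at e1 e2
    rw [e1, e2]
    simp [Complex.re_add_im]
  rw [absolutelyContinuousOnInterval_iff] at h1 ⊢
  intro ε hε
  obtain ⟨δ, hδ, H⟩ := h1 ε hε
  refine ⟨δ, hδ, fun E hE hlt => ?_⟩
  convert H E hE hlt using 3 with i hi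
  · exact h2 _ (hE.1 i hi).1
  · exact h2 _ (hE.1 i hi).2

/-- The product rule. -/
theorem mul (hf : IsPrimitive f F) (hg : IsPrimitive g G) :
    IsPrimitive (fun x => f x * g x) (fun x => F x * g x + f x * G x) := by
  have hfc : ContinuousOn f (uIcc 0 1) := by
    rw [uIcc_of_le zero_le_one]; exact hf.continuousOn
  have hgc : ContinuousOn g (uIcc 0 1) := by
    rw [uIcc_of_le zero_le_one]; exact hg.continuousOn
  have hi : IntervalIntegrable (fun x => F x * g x + f x * G x) volume 0 1 :=
    (hf.1.mul_continuousOn hgc).add (hg.1.continuousOn_mul hfc)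
  refine ⟨hi, ?_⟩
  -- The difference of the two sides is absolutely continuous with derivative zero almost everywhere.
  set Φ : ℝ → ℂ := fun x => f 0 + ∫ t in (0 : ℝ)..x, F t
  set Γ : ℝ → ℂ := fun x => g 0 + ∫ t in (0 : ℝ)..x, G t
  have hc : ∀ c : ℂ, AbsolutelyContinuousOnInterval (fun _ : ℝ => c) 0 1 := fun c =>
    ((LipschitzWith.const c).lipschitzOnWith (s := uIcc 0 1)).absolutelyContinuousOnInterval
  have hΦ : AbsolutelyContinuousOnInterval Φ 0 1 :=
    (hc _).fun_add (absolutelyContinuous_integral hf.1)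
  have hΓ : AbsolutelyContinuousOnInterval Γ 0 1 :=
    (hc _).fun_add (absolutelyContinuous_integral hg.1)
  have hD := (hΦ.fun_smul hΓ).fun_sub (absolutelyContinuous_integral hi)
  obtain ⟨C, hC⟩ := hD.const_of_ae_hasDerivAt_zero (by
    filter_upwards [hf.1.ae_hasDerivAt_integral, hg.1.ae_hasDerivAt_integral,
      hi.ae_hasDerivAt_integral] with x h1 h2 h3 hx
    have d1 := (h1 hx 0 left_mem_uIcc).const_add (f 0)
    have d2 := (h2 hx 0 left_mem_uIcc).const_add (g 0)
    have d3 := h3 hx 0 left_mem_uIcc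
    have hx' : x ∈ Icc (0 : ℝ) 1 := by rwa [uIcc_of_le zero_le_one] at hx
    refine ((d1.mul d2).sub d3).congr_deriv ?_
    rw [← hf.2 x hx', ← hg.2 x hx']
    ring)
  have hmem : ∀ x ∈ Icc (0 : ℝ) 1, x ∈ uIcc (0 : ℝ) 1 := fun x hx => by
    rwa [uIcc_of_le zero_le_one]
  intro x hx
  have e1 := hC x (hmem x hx)
  have e0 := hC 0 left_mem_uIcc
  have e2 : Φ x = f x := (hf.2 x hx).symm
  have e3 : Γ x = g x := (hg.2 x hx).symm
  have e4 : Φ 0 = f 0 := by simp [Φ]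
  have e5 : Γ 0 = g 0 := by simp [Γ]
  simp only [e2, e3, e4, e5, smul_eq_mul, intervalIntegral.integral_same, sub_zero] at e1 e0
  linear_combination e1 - e0

/-- The Sobolev inequality on the unit interval. -/
theorem norm_le (hf : IsPrimitive f F) {a b : ℝ} (h0 : L2Le f a) (h1 : L2Le F b) :
    CLe f (a + b) := by
  intro x hx
  have := h0.le_of_forall_le (c := ‖f x‖ - b) fun y hy => ?_
  · linarith
  have h2 := h1.norm_integral_le hy hx
  rw [← hf.sub_eq hy hx] at h2
  have := norm_sub_norm_le (f x) (f y)
  linarith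

theorem of_hasDerivAt (h : ∀ x ∈ Icc (0 : ℝ) 1, HasDerivAt f (F x) x)
    (hF : ContinuousOn F (Icc 0 1)) : IsPrimitive f F := by
  have hi : ∀ x ∈ Icc (0 : ℝ) 1, IntervalIntegrable F volume 0 x := fun x hx =>
    (hF.mono (by rw [uIcc_of_le hx.1]; exact Icc_subset_Icc_right hx.2)).intervalIntegrable
  refine ⟨hi 1 (by simp), fun x hx => ?_⟩
  rw [intervalIntegral.integral_eq_sub_of_hasDerivAt (fun t ht => h t ?_) (hi x hx)]
  · ring
  · rw [uIcc_of_le hx.1] at ht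
    exact ⟨ht.1, ht.2.trans hx.2⟩

end IsPrimitive

theorem SobolevFn.intervalIntegrable_top {m : ℕ} (y : SobolevFn m) :
    IntervalIntegrable (y.D m) volume 0 1 := by
  rw [intervalIntegrable_iff_integrableOn_Ioo_of_le zero_le_one]
  exact y.memLp_top.integrable (by norm_num)

theorem SobolevFn.isPrimitive {m : ℕ} (y : SobolevFn m) {j : ℕ} (hj : j < m) :
    IsPrimitive (y.D j) (y.D (j + 1)) := by
  have key : ∀ i j, j + i + 1 = m → IsPrimitive (y.D j) (y.D (j + 1)) := by
    intro i
    induction i with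
    | zero => intro j hj; subst hj; exact ⟨y.intervalIntegrable_top, y.primitive j (by omega)⟩
    | succ i ih =>
      intro j hj
      refine ⟨?_, y.primitive j (by omega)⟩
      refine ContinuousOn.intervalIntegrable ?_
      rw [uIcc_of_le zero_le_one]
      exact (ih (j + 1) (by omega)).continuousOn
  exact key (m - 1 - j) j (by omega)

/-! ### Stability of the initial value problem -/

/-- Grönwall's inequality in integral form. -/
theorem le_mul_exp_of_le_add_integral {φ : ℝ → ℝ} {A K : ℝ} (hφ : ContinuousOn φ (Icc 0 1))
    (h0 : ∀ x ∈ Icc (0 : ℝ) 1, 0 ≤ φ x) (hK : 0 ≤ K)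
    (h : ∀ x ∈ Icc (0 : ℝ) 1, φ x ≤ A + K * ∫ t in (0 : ℝ)..x, φ t) :
    ∀ x ∈ Icc (0 : ℝ) 1, φ x ≤ A * Real.exp K := by
  have hA : 0 ≤ A := by simpa using (h0 0 (by simp)).trans (h 0 (by simp))
  have hi : IntervalIntegrable φ volume 0 1 :=
    ContinuousOn.intervalIntegrable (by rwa [uIcc_of_le zero_le_one])
  have hΦ0 : ∀ x ∈ Icc (0 : ℝ) 1, 0 ≤ A + K * ∫ t in (0 : ℝ)..x, φ t := fun x hx =>
    (h0 x hx).trans (h x hx)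
  have hc : ContinuousOn (fun x => A + K * ∫ t in (0 : ℝ)..x, φ t) (Icc 0 1) := by
    refine continuousOn_const.add (continuousOn_const.mul ?_)
    have := intervalIntegral.continuousOn_primitive_interval (μ := volume) (f := φ) (a := 0) (b := 1)
      ((intervalIntegrable_iff_integrableOn_Icc_of_le zero_le_one).1 hi |>.mono_set
        (by rw [uIcc_of_le zero_le_one]))
    rwa [uIcc_of_le zero_le_one] at this
  have key := norm_le_gronwallBound_of_norm_deriv_right_le (δ := A) (K := K) (ε := 0)
    (f := fun x => A + K * ∫ t in (0 : ℝ)..x, φ t) (f' := fun x => K * φ x) (a := 0) (b := 1) hc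
    (fun x hx => ?_) (by simp [abs_of_nonneg hA]) (fun x hx => ?_)
  · intro x hx
    have h1 := key x hx
    rw [Real.norm_of_nonneg (hΦ0 x hx), gronwallBound_ε0, sub_zero] at h1
    refine (h x hx).trans (h1.trans ?_)
    have : Real.exp (K * x) ≤ Real.exp K := Real.exp_le_exp.2 (mul_le_of_le_one_right hK hx.2)
    exact mul_le_mul_of_nonneg_left this hA
  · have hx' : x ∈ Icc (0 : ℝ) 1 := Ico_subset_Icc_self hx
    have hcx : ContinuousWithinAt φ (Ici x) x := by
      refine (hφ x hx').mono_of_mem_nhdsWithin ?_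
      filter_upwards [Ico_mem_nhdsGE hx.2] with y hy
      exact ⟨hx.1.trans hy.1, hy.2.le⟩
    have := intervalIntegral.integral_hasDerivWithinAt_right (a := 0) (b := x) (f := φ)
      (s := Ici x) (t := Ioi x)
      (hi.mono_set (by rw [uIcc_of_le zero_le_one]; exact uIcc_subset_Icc (by simp) hx')) ?_
      (hcx.mono Ioi_subset_Ici_self)
    · exact (this.const_mul K).const_add A
    · refine ⟨Icc x 1, ?_, ?_⟩
      · filter_upwards [Ioo_mem_nhdsGT hx.2] with y hy using ⟨hy.1.le, hy.2.le⟩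
      · exact (hφ.mono (Icc_subset_Icc_left hx.1)).aestronglyMeasurable measurableSet_Icc
  · have hx' : x ∈ Icc (0 : ℝ) 1 := Ico_subset_Icc_self hx
    rw [Real.norm_of_nonneg (hΦ0 x hx'), Real.norm_of_nonneg (mul_nonneg hK (h0 x hx')), add_zero]
    exact mul_le_mul_of_nonneg_left (h x hx') hK

theorem IsPrimitive.norm_le_add_integral {f F : ℝ → ℂ} (hf : IsPrimitive f F) {x : ℝ}
    (hx : x ∈ Icc (0 : ℝ) 1) : ‖f x‖ ≤ ‖f 0‖ + ∫ t in (0 : ℝ)..x, ‖F t‖ := by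
  rw [hf.2 x hx]
  exact (norm_add_le _ _).trans
    (add_le_add_right (intervalIntegral.norm_integral_le_integral_norm hx.1) _)

/-- The solution of `Y'' + a Y' + b Y = r` depends continuously on `r ∈ L²` and on the initial
values, uniformly for coefficients bounded by `K`. -/
theorem initial_value_stability {Y₀ Y₁ Y₂ a b : ℝ → ℂ} {K e : ℝ} (hY₀ : IsPrimitive Y₀ Y₁)
    (hY₁ : IsPrimitive Y₁ Y₂) (ha : CLe a K) (hb : CLe b K)
    (ham : AEStronglyMeasurable a unitMeasure) (hbm : AEStronglyMeasurable b unitMeasure)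
    (hr : L2Le (fun x => Y₂ x + a x * Y₁ x + b x * Y₀ x) e) (h0 : ‖Y₀ 0‖ ≤ e) (h1 : ‖Y₁ 0‖ ≤ e) :
    CLe Y₀ (3 * (1 + 2 * K) * Real.exp (K + 1) * e) ∧
      CLe Y₁ (3 * (1 + 2 * K) * Real.exp (K + 1) * e) ∧
      L2Le Y₂ (3 * (1 + 2 * K) * Real.exp (K + 1) * e) := by
  have hK : 0 ≤ K := (norm_nonneg _).trans (ha 0 (by simp))
  have he : 0 ≤ e := hr.nonneg
  set φ : ℝ → ℝ := fun x => ‖Y₀ x‖ + ‖Y₁ x‖ with hφ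
  have hcφ : ContinuousOn φ (Icc 0 1) := hY₀.continuousOn.norm.add hY₁.continuousOn.norm
  have hmain : ∀ x ∈ Icc (0 : ℝ) 1, φ x ≤ 3 * e + (K + 1) * ∫ t in (0 : ℝ)..x, φ t := by
    intro x hx
    have hsub : ∀ {g : ℝ → ℝ}, ContinuousOn g (Icc 0 1) → IntervalIntegrable g volume 0 x :=
      fun hg => (hg.mono (uIcc_subset_Icc (by simp) hx)).intervalIntegrable
    have i0 := hsub hY₀.continuousOn.norm
    have i1 := hsub hY₁.continuousOn.norm
    have iφ := hsub hcφ
    have i2 : IntervalIntegrable (fun t => ‖Y₂ t‖) volume 0 x :=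
      (hY₁.intervalIntegrable (by simp) hx).norm
    have ir : IntervalIntegrable (fun t => ‖Y₂ t + a t * Y₁ t + b t * Y₀ t‖) volume 0 x :=
      (hr.intervalIntegrable.mono_set
        (by rw [uIcc_of_le zero_le_one]; exact uIcc_subset_Icc (by simp) hx)).norm
    have e0 := hY₀.norm_le_add_integral hx
    have e1 := hY₁.norm_le_add_integral hx
    have e2 : ∫ t in (0 : ℝ)..x, ‖Y₂ t‖ ≤
        (∫ t in (0 : ℝ)..x, ‖Y₂ t + a t * Y₁ t + b t * Y₀ t‖) + K * ∫ t in (0 : ℝ)..x, φ t := by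
      rw [← intervalIntegral.integral_const_mul, ← intervalIntegral.integral_add ir
        (iφ.const_mul K)]
      refine intervalIntegral.integral_mono_on hx.1 i2 (ir.add (iφ.const_mul K)) fun t ht => ?_
      have ht' : t ∈ Icc (0 : ℝ) 1 := ⟨ht.1, ht.2.trans hx.2⟩
      have n1 : ‖a t * Y₁ t‖ ≤ K * ‖Y₁ t‖ := by
        rw [norm_mul]; exact mul_le_mul_of_nonneg_right (ha t ht') (norm_nonneg _)
      have n0 : ‖b t * Y₀ t‖ ≤ K * ‖Y₀ t‖ := by
        rw [norm_mul]; exact mul_le_mul_of_nonneg_right (hb t ht') (norm_nonneg _)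
      have n2 : ‖Y₂ t‖ ≤ ‖Y₂ t + a t * Y₁ t + b t * Y₀ t‖ + ‖a t * Y₁ t‖ + ‖b t * Y₀ t‖ := by
        calc ‖Y₂ t‖ = ‖(Y₂ t + a t * Y₁ t + b t * Y₀ t) - a t * Y₁ t - b t * Y₀ t‖ := by
              congr 1; ring
          _ ≤ _ := (norm_sub_le _ _).trans (add_le_add_left (norm_sub_le _ _) _)
      simp only [hφ]
      linarith
    have e3 := hr.integral_norm_le_of_mem (x := 0) (by simp) hx hx.1
    have e4 : ∫ t in (0 : ℝ)..x, ‖Y₁ t‖ ≤ ∫ t in (0 : ℝ)..x, φ t :=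
      intervalIntegral.integral_mono_on hx.1 i1 iφ fun t _ => by
        simp only [hφ]; linarith [norm_nonneg (Y₀ t)]
    have : φ x = ‖Y₀ x‖ + ‖Y₁ x‖ := rfl
    linarith
  have hφ' := le_mul_exp_of_le_add_integral hcφ (fun x _ => by positivity) (by linarith) hmain
  have hE : 1 ≤ Real.exp (K + 1) := Real.one_le_exp (by linarith)
  set E := Real.exp (K + 1)
  have hKE : 0 ≤ K * E * e := by positivity
  have b0 : CLe Y₀ (3 * e * E) := fun x hx =>
    le_trans (by simp [hφ]) (hφ' x hx)
  have b1 : CLe Y₁ (3 * e * E) := fun x hx =>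
    le_trans (by simp [hφ]) (hφ' x hx)
  have hle : 3 * e * E ≤ 3 * (1 + 2 * K) * E * e := by nlinarith
  refine ⟨fun x hx => (b0 x hx).trans hle, fun x hx => (b1 x hx).trans hle, ?_⟩
  have m1 : L2Le (fun x => a x * Y₁ x) (K * (3 * e * E)) :=
    L2Le.mul ham ha (L2Le.of_bound hY₁.meas b1)
  have m0 : L2Le (fun x => b x * Y₀ x) (K * (3 * e * E)) :=
    L2Le.mul hbm hb (L2Le.of_bound hY₀.meas b0)
  refine (((hr.sub m1).sub m0).congr fun x _ => by ring).mono ?_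
  nlinarith

/-! ### Stability of the quasi-reversibility method -/

/-- The minimizing property of the QRM solution `y` bounds its residual through a competitor. -/
theorem IsQRMSolution.residual_le {α : ℝ} {a b d : ℝ → ℂ} {p₀ p₁ : ℂ} {y z : SobolevFn 3}
    (hy : IsQRMSolution α a b d p₀ p₁ y) (hz : BoundaryCond p₀ p₁ z) {e t B : ℝ}
    (ha : AEStronglyMeasurable a unitMeasure) (hb : AEStronglyMeasurable b unitMeasure)
    (hd : AEStronglyMeasurable d unitMeasure) (hα : α = t ^ 2) (ht : 0 ≤ t)
    (hr : L2Le (fun x => z.D 2 x + a x * z.D 1 x + b x * z.D 0 x - d x) e)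
    (hB : ∀ j ≤ 3, L2Le (z.D j) B) :
    L2Le (fun x => y.D 2 x + a x * y.D 1 x + b x * y.D 0 x - d x) (e + 2 * B * t) := by
  have hB0 : 0 ≤ B := (hB 0 (by norm_num)).nonneg
  have he := hr.nonneg
  refine ⟨by positivity, ?_, ?_⟩
  · exact ((((y.isPrimitive (j := 2) (by norm_num)).meas).add
      (ha.mul (y.isPrimitive (j := 1) (by norm_num)).meas)).add
      (hb.mul (y.isPrimitive (j := 0) (by norm_num)).meas)).sub hd
  · have h1 := hy.2 z hz
    unfold qrmFunctional at h1
    have h2 : normL2 (fun x => y.D 2 x + a x * y.D 1 x + b x * y.D 0 x - d x) ^ 2 / 2 ≤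
        ENNReal.ofReal ((e + 2 * B * t) ^ 2) / 2 := by
      refine (ENNReal.div_le_div_right le_self_add 2).trans (h1.trans ?_)
      refine ENNReal.div_le_div_right ?_ 2
      have h3 : ENNReal.ofReal α * sobolevSq 3 z.D ≤ ENNReal.ofReal (t ^ 2 * (4 * B ^ 2)) := by
        rw [hα, ENNReal.ofReal_mul (by positivity)]
        refine mul_le_mul_right ((sobolevSq_le hB).trans_eq ?_) _
        norm_num
      have h4 : normL2 (fun x => z.D 2 x + a x * z.D 1 x + b x * z.D 0 x - d x) ^ 2 ≤
          ENNReal.ofReal (e ^ 2) := by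
        rw [ENNReal.ofReal_pow he]
        exact pow_le_pow_left' hr.norm_le 2
      refine (add_le_add h4 h3).trans ?_
      rw [← ENNReal.ofReal_add (by positivity) (by positivity)]
      refine ENNReal.ofReal_le_ofReal ?_
      have : 0 ≤ e * (B * t) := by positivity
      nlinarith
    have h5 : normL2 (fun x => y.D 2 x + a x * y.D 1 x + b x * y.D 0 x - d x) ^ 2 ≤
        ENNReal.ofReal ((e + 2 * B * t) ^ 2) := by
      have := mul_le_mul_left h2 2
      rwa [ENNReal.div_mul_cancel (by norm_num) (by norm_num),
        ENNReal.div_mul_cancel (by norm_num) (by norm_num)] at this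
    rw [ENNReal.ofReal_pow (by positivity)] at h5
    exact (ENNReal.pow_le_pow_left_iff (by norm_num)).1 h5

/-- The element of `H³(0,1)` with second derivative `f` and the given values of the function and of
its derivative at `0`. -/
noncomputable def SobolevFn.ofSecondDeriv (f f' : ℝ → ℂ) (p₀ p₁ : ℂ) (hf : IsPrimitive f f')
    (hf' : MemLp f' 2 unitMeasure) : SobolevFn 3 where
  D j := match j with
    | 0 => fun x => p₀ + ∫ s in (0 : ℝ)..x, (p₁ + ∫ t in (0 : ℝ)..s, f t)
    | 1 => fun x => p₁ + ∫ t in (0 : ℝ)..x, f t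
    | 2 => f
    | _ => f'
  memLp_top := hf'
  primitive := by
    intro j hj x hx
    match j, hj with
    | 0, _ => simp
    | 1, _ => simp
    | 2, _ => exact hf.2 x hx

/-- Let `s ∈ H²(0,1)` satisfy `s'(1) = 0` and `s'' = f + O(e)`, where `f` is bounded in `H¹(0,1)`.
Then there is an element of `H³(0,1)` with any boundary values `O(e)`-close to those of `s` that is
bounded in `H³(0,1)` and `O(e)`-close to `s` in `H²(0,1)`. -/
theorem exists_competitor {s₀ s₁ s₂ f f' : ℝ → ℂ} {p₀ p₁ : ℂ} {K e : ℝ} (he1 : e ≤ 1)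
    (hs₀ : IsPrimitive s₀ s₁) (hs₁ : IsPrimitive s₁ s₂) (hs1 : s₁ 1 = 0)
    (hf : IsPrimitive f f') (hfK : CLe f K) (hf' : L2Le f' K)
    (hfs : L2Le (fun x => s₂ x - f x) e) (hp₀ : ‖p₀ - s₀ 0‖ ≤ e) (hp₁ : ‖p₁ - s₁ 0‖ ≤ e)
    (hK₀ : ‖s₀ 0‖ ≤ K) (hK₁ : ‖s₁ 0‖ ≤ K) :
    ∃ z : SobolevFn 3, BoundaryCond p₀ p₁ z ∧ (∀ j ≤ 3, L2Le (z.D j) (3 * K + 7)) ∧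
      CLe (fun x => z.D 0 x - s₀ x) (5 * e) ∧ CLe (fun x => z.D 1 x - s₁ x) (4 * e) ∧
      L2Le (fun x => z.D 2 x - s₂ x) (3 * e) := by
  have h0m : (0 : ℝ) ∈ Icc (0 : ℝ) 1 := by simp
  have h1m : (1 : ℝ) ∈ Icc (0 : ℝ) 1 := by simp
  have hK : 0 ≤ K := hf'.nonneg
  -- The constant `κ` enforces the boundary condition at `1`.
  set κ : ℂ := -p₁ - ∫ t in (0 : ℝ)..1, f t with hκ
  have hfi : IntervalIntegrable f volume 0 1 :=
    ContinuousOn.intervalIntegrable (by rw [uIcc_of_le zero_le_one]; exact hf.continuousOn)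
  have hκe : ‖κ‖ ≤ 2 * e := by
    have h2 : κ = -(p₁ - s₁ 0) + ∫ t in (0 : ℝ)..1, (s₂ t - f t) := by
      rw [intervalIntegral.integral_sub hs₁.1 hfi, ← hs₁.sub_eq h0m h1m, hs1, hκ]
      ring
    have h3 := hfs.norm_integral_le h0m h1m
    rw [h2]
    refine (norm_add_le _ _).trans ?_
    rw [norm_neg]
    linarith
  have hfκ : IsPrimitive (fun x => f x + κ) f' :=
    (hf.add (IsPrimitive.const κ)).congr (fun _ _ => rfl) (fun x _ => add_zero _)
  have hL : MemLp f' 2 unitMeasure := ⟨hf'.meas, hf'.norm_le.trans_lt ENNReal.ofReal_lt_top⟩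
  set z := SobolevFn.ofSecondDeriv (fun x => f x + κ) f' p₀ p₁ hfκ hL with hz
  have z0 : z.D 0 0 = p₀ := by simp [hz, SobolevFn.ofSecondDeriv]
  have z1 : z.D 1 0 = p₁ := by simp [hz, SobolevFn.ofSecondDeriv]
  have z2 : z.D 2 = fun x => f x + κ := rfl
  have P0 := z.isPrimitive (j := 0) (by norm_num)
  have P1 := z.isPrimitive (j := 1) (by norm_num)
  have P2 := z.isPrimitive (j := 2) (by norm_num)
  have d2 : L2Le (fun x => z.D 2 x - s₂ x) (3 * e) := by
    have hc : L2Le (fun _ => κ) (2 * e) :=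
      L2Le.of_bound aestronglyMeasurable_const fun _ _ => hκe
    refine ((hc.sub hfs).congr fun x _ => ?_).mono (by linarith)
    rw [z2]; ring
  have d1 : CLe (fun x => z.D 1 x - s₁ x) (4 * e) := by
    intro x hx
    have h2 := (P1.sub hs₁).sub_eq h0m hx
    have h3 := d2.norm_integral_le h0m hx
    rw [← h2] at h3
    have h4 : ‖z.D 1 0 - s₁ 0‖ ≤ e := by rwa [z1]
    have := norm_sub_norm_le (z.D 1 x - s₁ x) (z.D 1 0 - s₁ 0)
    linarith
  have d0 : CLe (fun x => z.D 0 x - s₀ x) (5 * e) := by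
    intro x hx
    have h2 := (P0.sub hs₀).sub_eq h0m hx
    have h3 := (L2Le.of_bound (P1.sub hs₁).meas d1).norm_integral_le h0m hx
    rw [← h2] at h3
    have h4 : ‖z.D 0 0 - s₀ 0‖ ≤ e := by rwa [z0]
    have := norm_sub_norm_le (z.D 0 x - s₀ x) (z.D 0 0 - s₀ 0)
    linarith
  have b2 : CLe (z.D 2) (K + 2) := fun x hx => by
    rw [z2]
    exact (norm_add_le _ _).trans (add_le_add (hfK x hx) (by linarith))
  have b1 : CLe (z.D 1) (2 * K + 3) := fun x hx => by
    have h2 := (L2Le.of_bound P2.meas b2).norm_integral_le h0m hx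
    rw [← P1.sub_eq h0m hx, z1] at h2
    have h3 := norm_sub_norm_le (z.D 1 x) p₁
    have h4 := norm_sub_norm_le p₁ (s₁ 0)
    linarith
  have b0 : CLe (z.D 0) (3 * K + 4) := fun x hx => by
    have h2 := (L2Le.of_bound P1.meas b1).norm_integral_le h0m hx
    rw [← P0.sub_eq h0m hx, z0] at h2
    have h3 := norm_sub_norm_le (z.D 0 x) p₀
    have h4 := norm_sub_norm_le p₀ (s₀ 0)
    linarith
  refine ⟨z, ⟨z0, z1, ?_⟩, ?_, d0, d1, d2⟩
  · have h2 := P1.sub_eq h0m h1m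
    have h3 : ∫ t in (0 : ℝ)..1, z.D 2 t = (∫ t in (0 : ℝ)..1, f t) + κ := by
      rw [z2, intervalIntegral.integral_add hfi (by simp)]
      simp
    rw [z1, h3, hκ] at h2
    linear_combination h2
  · intro j hj
    interval_cases j
    · exact (L2Le.of_bound P0.meas b0).mono (by linarith)
    · exact (L2Le.of_bound P1.meas b1).mono (by linarith)
    · exact (L2Le.of_bound P2.meas b2).mono (by linarith)
    · exact hf'.mono (by linarith)

/-- The Lipschitz rate of the quasi-reversibility method: if `s` solves the equation up to `e`, has
boundary values `e`-close to the data and `s'(1) = 0`, and if `s''` is `e`-close in `L²(0,1)` to a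
bounded set of `H¹(0,1)`, then the QRM solution with parameter at most `e²` is `O(e)`-close to `s`
in `H²(0,1)`. -/
theorem qrm_stability (K : ℝ) (hK : 0 ≤ K) : ∃ C : ℝ, 1 ≤ C ∧
    ∀ (s₀ s₁ s₂ f f' a b d : ℝ → ℂ) (p₀ p₁ : ℂ) (e α t : ℝ) (y : SobolevFn 3),
      0 ≤ e → e ≤ 1 → IsPrimitive s₀ s₁ → IsPrimitive s₁ s₂ → s₁ 1 = 0 →
      IsPrimitive f f' → CLe f K → L2Le f' K → L2Le (fun x => s₂ x - f x) e →
      ‖p₀ - s₀ 0‖ ≤ e → ‖p₁ - s₁ 0‖ ≤ e → ‖s₀ 0‖ ≤ K → ‖s₁ 0‖ ≤ K → CLe a K → CLe b K →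
      AEStronglyMeasurable a unitMeasure → AEStronglyMeasurable b unitMeasure →
      AEStronglyMeasurable d unitMeasure →
      L2Le (fun x => s₂ x + a x * s₁ x + b x * s₀ x - d x) e →
      α = t ^ 2 → 0 ≤ t → t ≤ e → IsQRMSolution α a b d p₀ p₁ y →
      CLe (fun x => y.D 0 x - s₀ x) (C * e) ∧ CLe (fun x => y.D 1 x - s₁ x) (C * e) ∧
        L2Le (fun x => y.D 2 x - s₂ x) (C * e) := by
  have hE : 1 ≤ Real.exp (K + 1) := Real.one_le_exp (by linarith)
  set C₁ : ℝ := 19 + 15 * K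
  refine ⟨3 * (1 + 2 * K) * Real.exp (K + 1) * C₁, ?_, ?_⟩
  · have h1 : 1 ≤ 3 * (1 + 2 * K) := by linarith
    have h2 : 1 ≤ C₁ := by simp only [C₁]; linarith
    exact one_le_mul_of_one_le_of_one_le (one_le_mul_of_one_le_of_one_le h1 hE) h2
  intro s₀ s₁ s₂ f f' a b d p₀ p₁ e α t y he he1 hs₀ hs₁ hs1 hf hfK hf' hfs hp₀ hp₁ hK₀ hK₁ ha hb
    ham hbm hdm hres hα ht hte hy
  obtain ⟨z, hz, hzB, z0, z1, z2⟩ :=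
    exists_competitor he1 hs₀ hs₁ hs1 hf hfK hf' hfs hp₀ hp₁ hK₀ hK₁
  have P0 := (z.isPrimitive (j := 0) (by norm_num)).sub hs₀
  have P1 := (z.isPrimitive (j := 1) (by norm_num)).sub hs₁
  have hrz : L2Le (fun x => z.D 2 x + a x * z.D 1 x + b x * z.D 0 x - d x)
      (e + 3 * e + K * (4 * e) + K * (5 * e)) :=
    (((hres.add z2).add (L2Le.mul ham ha (L2Le.of_bound P1.meas z1))).add
      (L2Le.mul hbm hb (L2Le.of_bound P0.meas z0))).congr fun x _ => by ring
  have hry := hy.residual_le hz ham hbm hdm hα ht hrz hzB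
  have hmono : 2 * (3 * K + 7) * t ≤ 2 * (3 * K + 7) * e :=
    mul_le_mul_of_nonneg_left hte (by positivity)
  have hY₀ := (y.isPrimitive (j := 0) (by norm_num)).sub hs₀
  have hY₁ := (y.isPrimitive (j := 1) (by norm_num)).sub hs₁
  have hC₁ : C₁ * e = 19 * e + 15 * K * e := by simp only [C₁]; ring
  have hKe : 0 ≤ K * e := by positivity
  have hry' : L2Le (fun x => (y.D 2 x - s₂ x) + a x * (y.D 1 x - s₁ x)
      + b x * (y.D 0 x - s₀ x)) (C₁ * e) :=
    ((hry.sub hres).congr fun x _ => by ring).mono (by rw [hC₁]; linarith)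
  have hle : e ≤ C₁ * e := by rw [hC₁]; linarith
  have := initial_value_stability hY₀ hY₁ ha hb ham hbm hry'
    (by rw [hy.1.1]; exact hp₀.trans hle) (by rw [hy.1.2.1]; exact hp₁.trans hle)
  simpa only [mul_assoc] using this

/-! ### The wave field outside the source -/

theorem hasDerivAt_deriv_of_contDiff {f : ℝ → ℂ} {n : WithTop ℕ∞} (hf : ContDiff ℝ n f)
    (hn : 1 ≤ n) (x : ℝ) : HasDerivAt f (deriv f x) x :=
  (hf.differentiable (by intro h; simp [h] at hn) x).hasDerivAt

/-- Away from the source the distributional Helmholtz equation holds in the classical sense for any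
smooth function that agrees with the wave field there. -/
theorem IsForwardSolution.classical {c : ℝ → ℝ} {x₀ k : ℝ} {u U : ℝ → ℂ}
    (hu : IsForwardSolution c x₀ k u) (hc : Continuous c) (hU : ContDiff ℝ 2 U) {Ω : Set ℝ}
    (hΩ : IsOpen Ω) (hx₀ : x₀ ∉ Ω) (h : EqOn u U Ω) :
    ∀ x ∈ Ω, deriv (deriv U) x + (k : ℂ) ^ 2 * c x * U x = 0 := by
  have hU' : ContDiff ℝ 1 (deriv U) := (contDiff_succ_iff_deriv (n := 1).1 hU).2.2
  have hU'' : Continuous (deriv (deriv U)) := hU'.continuous_deriv le_rfl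
  have hcc : Continuous fun x => (c x : ℂ) := Complex.continuous_ofReal.comp hc
  set R : ℝ → ℂ := fun x => deriv (deriv U) x + (k : ℂ) ^ 2 * c x * U x with hR
  have hRc : Continuous R := hU''.add ((continuous_const.mul hcc).mul hU.continuous)
  have hae := hΩ.ae_eq_zero_of_integral_contDiff_smul_eq_zero (μ := volume) (f := R)
    (hRc.locallyIntegrable.locallyIntegrableOn Ω) (fun g hg hgs hgΩ => ?_)
  · have h1 : R =ᵐ[volume.restrict Ω] fun _ => 0 :=
      (ae_restrict_iff' hΩ.measurableSet).2 hae
    exact Measure.eqOn_open_of_ae_eq h1 hΩ hRc.continuousOn continuousOn_const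
  · set φ : ℝ → ℂ := fun x => (g x : ℂ) with hφdef
    have hφ : ContDiff ℝ ∞ φ := Complex.ofRealCLM.contDiff.comp hg
    have hφs : HasCompactSupport φ := hgs.comp_left (g := fun r : ℝ => (r : ℂ)) (by simp)
    have hφ' : ContDiff ℝ ∞ (deriv φ) := (contDiff_infty_iff_deriv.1 hφ).2
    have hφ'' : Continuous (deriv (deriv φ)) := hφ'.continuous_deriv (by simp)
    have hts : tsupport φ ⊆ Ω := by
      refine (closure_mono ?_).trans hgΩ
      intro x hx
      simpa [φ] using hx
    have hzero : ∀ x, x ∉ Ω → φ x = 0 ∧ deriv (deriv φ) x = 0 := by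
      intro x hx
      have h1 : φ =ᶠ[𝓝 x] 0 := notMem_tsupport_iff_eventuallyEq.1 fun h2 => hx (hts h2)
      refine ⟨h1.eq_of_nhds, ?_⟩
      have h2 := h1.deriv.deriv.eq_of_nhds
      simpa using h2
    have hs' : HasCompactSupport (deriv φ) := hφs.deriv
    have hs'' : HasCompactSupport (deriv (deriv φ)) := hs'.deriv
    have h0 : ∫ x, U x * (deriv (deriv φ) x + (k : ℂ) ^ 2 * c x * φ x) = 0 := by
      have h1 := hu.equation φ hφ hφs
      rw [(hzero x₀ hx₀).1, neg_zero] at h1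
      rw [← h1]
      refine integral_congr_ae (Eventually.of_forall fun x => ?_)
      by_cases hx : x ∈ Ω
      · simp only [h hx]
      · simp [hzero x hx]
    have i1 : Integrable (fun x => U x * deriv (deriv φ) x) :=
      (hU.continuous.mul hφ'').integrable_of_hasCompactSupport hs''.mul_left
    have i2 : Integrable (fun x => deriv U x * deriv φ x) :=
      (hU'.continuous.mul hφ'.continuous).integrable_of_hasCompactSupport hs'.mul_left
    have i3 : Integrable (fun x => U x * deriv φ x) :=
      (hU.continuous.mul hφ'.continuous).integrable_of_hasCompactSupport hs'.mul_left
    have i4 : Integrable (fun x => deriv (deriv U) x * φ x) :=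
      (hU''.mul hφ.continuous).integrable_of_hasCompactSupport hφs.mul_left
    have i5 : Integrable (fun x => deriv U x * φ x) :=
      (hU'.continuous.mul hφ.continuous).integrable_of_hasCompactSupport hφs.mul_left
    have i6 : Integrable (fun x => (k : ℂ) ^ 2 * c x * U x * φ x) :=
      (((continuous_const.mul hcc).mul hU.continuous).mul
        hφ.continuous).integrable_of_hasCompactSupport hφs.mul_left
    have dU := hasDerivAt_deriv_of_contDiff hU (by norm_num)
    have dU' := hasDerivAt_deriv_of_contDiff hU' le_rfl
    have dφ := hasDerivAt_deriv_of_contDiff hφ (by norm_num)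
    have dφ' := hasDerivAt_deriv_of_contDiff hφ' (by norm_num)
    have p1 := integral_mul_deriv_eq_deriv_mul_of_integrable (fun x _ => dU x) (fun x _ => dφ' x)
      i1 i2 i3
    have p2 := integral_mul_deriv_eq_deriv_mul_of_integrable (fun x _ => dU' x) (fun x _ => dφ x)
      i2 i4 i5
    have e1 : ∫ x, U x * (deriv (deriv φ) x + (k : ℂ) ^ 2 * c x * φ x) =
        (∫ x, U x * deriv (deriv φ) x) + ∫ x, (k : ℂ) ^ 2 * c x * U x * φ x := by
      rw [← integral_add i1 i6]
      exact integral_congr_ae (Eventually.of_forall fun x => by ring)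
    have e2 : ∫ x, g x • R x =
        (∫ x, deriv (deriv U) x * φ x) + ∫ x, (k : ℂ) ^ 2 * c x * U x * φ x := by
      rw [← integral_add i4 i6]
      refine integral_congr_ae (Eventually.of_forall fun x => ?_)
      simp only [hR, hφdef, Complex.real_smul]
      ring
    rw [e2]
    rw [e1] at h0
    rw [← h0]
    linear_combination -p1 + p2

/-- Solutions of `Z' = i m Z` with real `m` have constant modulus. -/
theorem norm_eq_of_hasDerivAt_I_mul {Z : ℝ → ℂ} {m a b : ℝ} (hab : a ≤ b)
    (h : ∀ x ∈ Icc a b, HasDerivAt Z (Complex.I * m * Z x) x) : ‖Z b‖ = ‖Z a‖ := by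
  have hexp : ∀ x : ℝ, HasDerivAt (fun x : ℝ => Complex.exp (-Complex.I * m * x))
      (Complex.exp (-Complex.I * m * x) * (-Complex.I * m)) x := fun x => by
    have h1 : HasDerivAt (fun x : ℝ => -Complex.I * m * (x : ℂ)) (-Complex.I * m) x := by
      simpa using (Complex.ofRealCLM.hasDerivAt (x := x)).const_mul (-Complex.I * m)
    exact h1.cexp
  have hd : ∀ x ∈ Icc a b,
      HasDerivAt (fun x : ℝ => Z x * Complex.exp (-Complex.I * m * x)) 0 x := fun x hx =>
    ((h x hx).mul (hexp x)).congr_deriv (by ring)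
  have hconst := constant_of_has_deriv_right_zero
    (fun x hx => (hd x hx).continuousAt.continuousWithinAt)
    (fun x hx => (hd x (Ico_subset_Icc_self hx)).hasDerivWithinAt) b ⟨hab, le_rfl⟩
  have hn : ∀ x : ℝ, ‖Complex.exp (-Complex.I * m * x)‖ = 1 := fun x => by
    rw [Complex.norm_exp]; simp
  have := congrArg norm hconst
  simpa only [norm_mul, hn, mul_one] using this

/-- `W` is a `C³` extension to `ℝ` of the normalized field `w(·, k) = u / u₀` to the right of the
source. There `w'' - 2ikw' + k²(c - 1)w = 0`, and the radiation conditions have become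
`w'(0) = 2ik(w(0) - 1)` and `w = const` on `[1,∞)`. -/
structure IsNormalizedField (c : ℝ → ℝ) (x₀ k : ℝ) (u : ℝ → ℝ → ℂ) (W : ℝ → ℂ) : Prop where
  contDiff : ContDiff ℝ 3 W
  eq_wField : ∀ x, x₀ ≤ x → wField x₀ u x k = W x
  ode : ∀ x, x₀ < x → deriv (deriv W) x - 2 * Complex.I * k * deriv W x
    + (k : ℂ) ^ 2 * ((c x - 1 : ℝ) : ℂ) * W x = 0
  deriv_zero : deriv W 0 = 2 * Complex.I * k * (W 0 - 1)
  deriv_eq_zero : ∀ x, 1 ≤ x → deriv W x = 0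
  eq_one : ∀ x, 1 ≤ x → W x = W 1

/-- The regular part `D = u - u₀` satisfies `D'' + k² D = 0` on either side of the inhomogeneity, even
across the source. Hence `D' ± ikD` has constant modulus on `[1,∞)` and on `(-∞,0]`, respectively, and
vanishes there by the radiation conditions. The normalized field is `1 + D exp(ik(x - x₀)) * 2ik`. -/
theorem IsForwardSolution.exists_normalizedField {c₀ c₁ : ℝ} {c : ℝ → ℝ} {x₀ k : ℝ}
    {u : ℝ → ℝ → ℂ} (hu : IsForwardSolution c x₀ k (fun x => u x k))
    (hc : IsAdmissible c₀ c₁ c) (hx₀ : x₀ < 0) (hk : 0 < k) :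
    ∃ W : ℝ → ℂ, IsNormalizedField c x₀ k u W := by
  have hkC : (k : ℂ) ≠ 0 := by exact_mod_cast hk.ne'
  have h2ik : 2 * Complex.I * k ≠ 0 := by simp [hkC]
  have hcc : Continuous c := hc.contDiff.continuous
  set D : ℝ → ℂ := fun x => u x k - incident x₀ x k with hD
  have hD3 : ContDiff ℝ 3 D := hu.contDiff
  have hlin : ContDiff ℝ 3 fun x : ℝ => Complex.I * k * ((x : ℂ) - x₀) :=
    contDiff_const.mul (Complex.ofRealCLM.contDiff.sub contDiff_const)
  -- `E` and `E'` continue the incident field analytically from the right and from the left.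
  set E : ℝ → ℂ := fun x => Complex.exp (-(Complex.I * k * ((x : ℂ) - x₀))) / (2 * Complex.I * k)
    with hE
  set E' : ℝ → ℂ := fun x => Complex.exp (Complex.I * k * ((x : ℂ) - x₀)) / (2 * Complex.I * k)
    with hE'
  have hE3 : ContDiff ℝ 3 E := hlin.neg.cexp.div_const _
  have hE'3 : ContDiff ℝ 3 E' := hlin.cexp.div_const _
  have hincR : ∀ x, x₀ ≤ x → incident x₀ x k = E x := fun x hx => by
    simp only [incident, hE, abs_of_nonneg (sub_nonneg.2 hx)]
    congr 2
    push_cast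
    ring
  have hincL : ∀ x, x ≤ x₀ → incident x₀ x k = E' x := fun x hx => by
    simp only [incident, hE', abs_of_nonpos (sub_nonpos.2 hx)]
    congr 2
    push_cast
    ring
  have dlin : ∀ x : ℝ, HasDerivAt (fun x : ℝ => Complex.I * k * ((x : ℂ) - x₀))
      (Complex.I * k) x := fun x => by
    simpa using ((Complex.ofRealCLM.hasDerivAt (x := x)).sub_const (x₀ : ℂ)).const_mul
      (Complex.I * k)
  have dE : ∀ x, HasDerivAt E (-(Complex.I * k) * E x) x := fun x =>
    ((dlin x).fun_neg.cexp.div_const _).congr_deriv (by simp only [hE]; ring)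
  have dE' : ∀ x, HasDerivAt E' (Complex.I * k * E' x) x := fun x =>
    ((dlin x).cexp.div_const _).congr_deriv (by simp only [hE']; ring)
  set e : ℝ → ℂ := fun x => 2 * Complex.I * k * Complex.exp (Complex.I * k * ((x : ℂ) - x₀))
    with he
  have he3 : ContDiff ℝ 3 e := contDiff_const.mul hlin.cexp
  have de : ∀ x, HasDerivAt e (Complex.I * k * e x) x := fun x =>
    ((dlin x).cexp.const_mul _).congr_deriv (by simp only [he]; ring)
  have hEe : ∀ x, E x * e x = 1 := fun x => by
    simp only [hE, he, Complex.exp_neg]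
    field_simp
  have dD := hasDerivAt_deriv_of_contDiff hD3 (by norm_num)
  have hD'2 : ContDiff ℝ 2 (deriv D) := (contDiff_succ_iff_deriv (n := 2).1 hD3).2.2
  have dD' := hasDerivAt_deriv_of_contDiff hD'2 (by norm_num)
  have hD''c : Continuous (deriv (deriv D)) := hD'2.continuous_deriv (by norm_num)
  have eqR : ∀ x, x₀ < x → deriv (deriv D) x + -(Complex.I * k) * (-(Complex.I * k) * E x)
      + (k : ℂ) ^ 2 * c x * (D x + E x) = 0 := by
    have h1 := hu.classical (U := fun x => D x + E x) hcc
      ((hD3.add hE3).of_le (by norm_num)) isOpen_Ioi (self_notMem_Ioi)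
      (fun x hx => by simp only [hD, hincR x (le_of_lt hx)]; ring)
    have d1 : deriv (fun x => D x + E x) = fun x => deriv D x + -(Complex.I * k) * E x :=
      funext fun x => ((dD x).add (dE x)).deriv
    have d2 : ∀ x, deriv (fun x => deriv D x + -(Complex.I * k) * E x) x =
        deriv (deriv D) x + -(Complex.I * k) * (-(Complex.I * k) * E x) :=
      fun x => ((dD' x).add ((dE x).const_mul _)).deriv
    intro x hx
    have := h1 x hx
    rwa [d1, d2] at this
  have eqL : ∀ x, x < x₀ → deriv (deriv D) x + (k : ℂ) ^ 2 * D x = 0 := by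
    have h1 := hu.classical (U := fun x => D x + E' x) hcc
      ((hD3.add hE'3).of_le (by norm_num)) isOpen_Iio (self_notMem_Iio)
      (fun x hx => by simp only [hD, hincL x (le_of_lt hx)]; ring)
    have d1 : deriv (fun x => D x + E' x) = fun x => deriv D x + Complex.I * k * E' x :=
      funext fun x => ((dD x).add (dE' x)).deriv
    have d2 : ∀ x, deriv (fun x => deriv D x + Complex.I * k * E' x) x =
        deriv (deriv D) x + Complex.I * k * (Complex.I * k * E' x) :=
      fun x => ((dD' x).add ((dE' x).const_mul _)).deriv
    intro x hx
    have := h1 x hx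
    rw [d1, d2, hc.eq_one x (fun h => by linarith [h.1])] at this
    push_cast at this
    linear_combination this - (k : ℂ) ^ 2 * E' x * Complex.I_sq
  have eqL' : ∀ x, x ≤ 0 → deriv (deriv D) x + (k : ℂ) ^ 2 * D x = 0 := by
    intro x hx
    rcases lt_or_ge x₀ x with h | h
    · have := eqR x h
      rw [hc.eq_one x (fun h => by linarith [h.1])] at this
      push_cast at this
      linear_combination this - (k : ℂ) ^ 2 * E x * Complex.I_sq
    · have hcl : EqOn (fun x => deriv (deriv D) x + (k : ℂ) ^ 2 * D x) (fun _ => 0)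
          (closure (Iio x₀)) :=
        EqOn.closure (fun x hx => eqL x hx)
          (hD''c.add (continuous_const.mul hD3.continuous)) continuous_const
      rw [closure_Iio] at hcl
      exact hcl h
  have hW3 : ContDiff ℝ 3 fun x => 1 + D x * e x := contDiff_const.add (hD3.mul he3)
  have dW : ∀ x, HasDerivAt (fun x => 1 + D x * e x) ((deriv D x + Complex.I * k * D x) * e x) x :=
    fun x => (((dD x).mul (de x)).const_add 1).congr_deriv (by ring)
  have dW' : deriv (fun x => 1 + D x * e x) = fun x => (deriv D x + Complex.I * k * D x) * e x :=
    funext fun x => (dW x).deriv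
  have dW2 : ∀ x, HasDerivAt (fun x => (deriv D x + Complex.I * k * D x) * e x)
      ((deriv (deriv D) x + Complex.I * k * deriv D x) * e x
        + (deriv D x + Complex.I * k * D x) * (Complex.I * k * e x)) x := fun x =>
    ((dD' x).add ((dD x).const_mul _)).mul (de x)
  have hode : ∀ x, x₀ < x → ((deriv (deriv D) x + Complex.I * k * deriv D x) * e x
        + (deriv D x + Complex.I * k * D x) * (Complex.I * k * e x))
      - 2 * Complex.I * k * ((deriv D x + Complex.I * k * D x) * e x)
        + (k : ℂ) ^ 2 * ((c x - 1 : ℝ) : ℂ) * (1 + D x * e x) = 0 := fun x hx => by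
    push_cast
    linear_combination e x * eqR x hx - (k : ℂ) ^ 2 * (c x - 1) * hEe x
      - ((k : ℂ) ^ 2 * D x + (k : ℂ) ^ 2 * E x) * e x * Complex.I_sq
  have hright : ∀ x, 1 ≤ x → (deriv D x + Complex.I * k * D x) = 0 := by
    have hd : ∀ x, 1 ≤ x → HasDerivAt (fun x => deriv D x + Complex.I * k * D x)
        (Complex.I * k * (deriv D x + Complex.I * k * D x)) x := fun x hx => by
      refine ((dD' x).add ((dD x).const_mul (Complex.I * k))).congr_deriv ?_
      have := eqR x (by linarith)
      rw [hc.eq_one x (fun h => by linarith [h.2])] at this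
      push_cast at this
      linear_combination this - (k : ℂ) ^ 2 * (D x + E x) * Complex.I_sq
    have hrad : Tendsto (fun x => deriv D x + Complex.I * k * D x) atTop (𝓝 0) := by
      refine hu.radiation_top.congr' ?_
      filter_upwards [eventually_gt_atTop x₀] with x hx
      have h1 : (fun x => u x k) =ᶠ[𝓝 x] fun x => D x + E x := by
        filter_upwards [Ioi_mem_nhds hx] with y hy
        simp only [hD, hincR y (le_of_lt hy)]
        ring
      rw [h1.deriv_eq, ((dD x).fun_add (dE x)).deriv, h1.eq_of_nhds]
      ring
    intro x hx
    have hn : ∀ y, x ≤ y → ‖deriv D y + Complex.I * k * D y‖ = ‖deriv D x + Complex.I * k * D x‖ :=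
      fun y hy => norm_eq_of_hasDerivAt_I_mul hy fun z hz => hd z (hx.trans hz.1)
    have hlim : Tendsto (fun x => ‖deriv D x + Complex.I * k * D x‖) atTop (𝓝 0) := by
      simpa using hrad.norm
    have := tendsto_nhds_unique (hlim.congr' (by
      filter_upwards [eventually_ge_atTop x] with y hy using hn y hy)) tendsto_const_nhds
    exact norm_eq_zero.1 this.symm
  have hleft : deriv D 0 - Complex.I * k * D 0 = 0 := by
    have hd : ∀ x, x ≤ 0 → HasDerivAt (fun x => deriv D x - Complex.I * k * D x)
        (Complex.I * ((-k : ℝ) : ℂ) * (deriv D x - Complex.I * k * D x)) x := fun x hx => by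
      refine ((dD' x).sub ((dD x).const_mul (Complex.I * k))).congr_deriv ?_
      push_cast
      linear_combination eqL' x hx - (k : ℂ) ^ 2 * D x * Complex.I_sq
    have hrad : Tendsto (fun x => deriv D x - Complex.I * k * D x) atBot (𝓝 0) := by
      refine hu.radiation_bot.congr' ?_
      filter_upwards [eventually_lt_atBot x₀] with x hx
      have h1 : (fun x => u x k) =ᶠ[𝓝 x] fun x => D x + E' x := by
        filter_upwards [Iio_mem_nhds hx] with y hy
        simp only [hD, hincL y (le_of_lt hy)]
        ring
      rw [h1.deriv_eq, ((dD x).fun_add (dE' x)).deriv, h1.eq_of_nhds]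
      ring
    have hn : ∀ y, y ≤ 0 → ‖deriv D y - Complex.I * k * D y‖ = ‖deriv D 0 - Complex.I * k * D 0‖ :=
      fun y hy => (norm_eq_of_hasDerivAt_I_mul hy fun z hz => hd z hz.2).symm
    have hlim : Tendsto (fun x => ‖deriv D x - Complex.I * k * D x‖) atBot (𝓝 0) := by
      simpa using hrad.norm
    have := tendsto_nhds_unique (hlim.congr' (by
      filter_upwards [eventually_le_atBot 0] with y hy using hn y hy)) tendsto_const_nhds
    exact norm_eq_zero.1 this.symm
  refine ⟨fun x => 1 + D x * e x, hW3, ?_, ?_, ?_, ?_, ?_⟩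
  · intro x hx
    have hE0 : E x ≠ 0 := left_ne_zero_of_mul_eq_one (hEe x)
    rw [wField, hincR x hx, div_eq_iff hE0]
    simp only [hD, hincR x hx]
    linear_combination -(u x k - E x) * hEe x
  · intro x hx
    rw [dW', (dW2 x).deriv]
    exact hode x hx
  · rw [dW']
    linear_combination e 0 * hleft
  · intro x hx
    rw [dW']
    simp [hright x hx]
  · intro x hx
    exact constant_of_has_deriv_right_zero hW3.continuous.continuousOn
      (fun y hy => (dW y).hasDerivWithinAt.congr_deriv (by simp [hright y hy.1])) x ⟨hx, le_rfl⟩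

/-! ### The logarithm of the field at high frequency -/

theorem hasDerivAt_phase {c : ℝ → ℝ} (hc : Continuous c) (x₀ x : ℝ) :
    HasDerivAt (phase c x₀) (Real.sqrt (c x) - 1) x := by
  have h1 : Continuous fun t => Real.sqrt (c t) := hc.sqrt
  have h2 := intervalIntegral.integral_hasDerivAt_right (h1.intervalIntegrable x₀ x)
    (h1.stronglyMeasurableAtFilter _ _) h1.continuousAt
  exact h2.sub ((hasDerivAt_id x).sub_const x₀)

theorem phase_zero {c₀ c₁ : ℝ} {c : ℝ → ℝ} {x₀ : ℝ} (hc : IsAdmissible c₀ c₁ c) (hx₀ : x₀ < 0) :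
    phase c x₀ 0 = 0 := by
  have h : ∫ t in x₀..0, Real.sqrt (c t) = ∫ t in x₀..0, (1 : ℝ) := by
    refine intervalIntegral.integral_congr fun t ht => ?_
    rw [uIcc_of_le hx₀.le] at ht
    simp [hc.eq_one t fun h => by linarith [h.1, ht.2]]
  simp [phase, h]

theorem phase_of_one_le {c₀ c₁ : ℝ} {c : ℝ → ℝ} {x₀ x : ℝ} (hc : IsAdmissible c₀ c₁ c)
    (hx : 1 ≤ x) : phase c x₀ x = phase c x₀ 1 := by
  have h : ∫ t in (1 : ℝ)..x, Real.sqrt (c t) = ∫ t in (1 : ℝ)..x, (1 : ℝ) := by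
    refine intervalIntegral.integral_congr fun t ht => ?_
    rw [uIcc_of_le hx] at ht
    simp [hc.eq_one t fun h => by linarith [h.2, ht.1]]
  have hi : ∀ a b : ℝ, IntervalIntegrable (fun t => Real.sqrt (c t)) volume a b := fun a b =>
    hc.contDiff.continuous.sqrt.intervalIntegrable a b
  rw [phase, phase, ← intervalIntegral.integral_add_adjacent_intervals (hi x₀ 1) (hi 1 x), h]
  simp only [intervalIntegral.integral_const, smul_eq_mul, mul_one]
  ring

section

variable {c₀ c₁ x₀ k : ℝ} {c : ℝ → ℝ} {u : ℝ → ℝ → ℂ} {W : ℝ → ℂ}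

theorem norm_highFreqFactor (hc1 : ∀ x, 1 ≤ c x) (hW : IsNormalizedField c x₀ k u W) {x : ℝ}
    (hx : x₀ ≤ x) : ‖highFreqFactor c x₀ u x k‖ = ‖W x‖ * c x ^ (1 / 4 : ℝ) := by
  have h0 : 0 ≤ c x ^ (1 / 4 : ℝ) := Real.rpow_nonneg (by linarith [hc1 x]) _
  rw [highFreqFactor, hW.eq_wField x hx, norm_mul, norm_mul, Complex.norm_real,
    Real.norm_of_nonneg h0, Complex.norm_exp]
  simp

theorem IsNormalizedField.norm_bounds (hW : IsNormalizedField c x₀ k u W)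
    (hc : IsAdmissible c₀ c₁ c) (hc1 : ∀ x, 1 ≤ c x) {x : ℝ} (hx : x₀ ≤ x)
    (hR : ‖highFreqFactor c x₀ u x k - 1‖ < 1 / 2) :
    1 / (2 * c₁ ^ (1 / 4 : ℝ)) ≤ ‖W x‖ ∧ ‖W x‖ ≤ 3 / 2 := by
  have h1 : 1 ≤ c x ^ (1 / 4 : ℝ) := Real.one_le_rpow (hc1 x) (by norm_num)
  have h2 : c x ^ (1 / 4 : ℝ) ≤ c₁ ^ (1 / 4 : ℝ) :=
    Real.rpow_le_rpow (by linarith [hc1 x]) (hc.mem_Icc x).2 (by norm_num)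
  have h3 := norm_highFreqFactor hc1 hW hx
  have h4 := norm_sub_norm_le (1 : ℂ) (highFreqFactor c x₀ u x k)
  have h5 := norm_sub_norm_le (highFreqFactor c x₀ u x k) (1 : ℂ)
  rw [norm_one] at h4 h5
  rw [norm_sub_rev] at h4
  have h6 := norm_nonneg (W x)
  constructor
  · rw [div_le_iff₀ (by linarith)]
    nlinarith
  · nlinarith

/-- The explicit logarithm `logHigh` of the field has the logarithmic derivative `w' / w`: near a point
where `R` is close to `1`, the principal logarithm of `R` is smooth. -/
theorem IsNormalizedField.eventually_hasDerivAt_logHigh (hW : IsNormalizedField c x₀ k u W)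
    (hc : IsAdmissible c₀ c₁ c) (hc1 : ∀ x, 1 ≤ c x) {x : ℝ} (hx : x₀ < x)
    (hR : ‖highFreqFactor c x₀ u x k - 1‖ < 1 / 2) :
    ∀ᶠ y in 𝓝 x, W y ≠ 0 ∧ HasDerivAt (fun y => logHigh c x₀ u y k) (deriv W y / W y) y := by
  have hcc : Continuous c := hc.contDiff.continuous
  have hcpos : ∀ y, 0 < c y := fun y => by linarith [hc1 y]
  have dc : Differentiable ℝ c := hc.contDiff.differentiable (by norm_num)
  have dθ : Differentiable ℝ (phase c x₀) := fun y => (hasDerivAt_phase hcc x₀ y).differentiableAt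
  have dθC : Differentiable ℝ fun y => (phase c x₀ y : ℂ) := fun y =>
    (Complex.ofRealCLM.differentiableAt).comp y (dθ y)
  have dr : Differentiable ℝ fun y => c y ^ (1 / 4 : ℝ) := fun y =>
    (dc y).rpow_const (Or.inl (hcpos y).ne')
  have drC : Differentiable ℝ fun y => ((c y ^ (1 / 4 : ℝ) : ℝ) : ℂ) := fun y =>
    (Complex.ofRealCLM.differentiableAt).comp y (dr y)
  have dl : Differentiable ℝ fun y => ((1 / 4 * Real.log (c y) : ℝ) : ℂ) := fun y =>
    (Complex.ofRealCLM.differentiableAt).comp y (((dc y).log (hcpos y).ne').const_mul _)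
  have dW : Differentiable ℝ W := hW.contDiff.differentiable (by norm_num)
  set R : ℝ → ℂ := fun y => W y * ((c y ^ (1 / 4 : ℝ) : ℝ) : ℂ)
    * Complex.exp (Complex.I * k * phase c x₀ y) with hRdef
  have dR : Differentiable ℝ R := (dW.mul drC).mul (dθC.const_mul _).cexp
  set L : ℝ → ℂ := fun y => Complex.log (R y) - ((1 / 4 * Real.log (c y) : ℝ) : ℂ)
    - Complex.I * k * phase c x₀ y with hL
  have hRR : ∀ y, x₀ ≤ y → highFreqFactor c x₀ u y k = R y := fun y hy => by
    simp only [highFreqFactor, hW.eq_wField y hy, hRdef]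
  set S : Set ℝ := {y | x₀ < y ∧ ‖R y - 1‖ < 1 / 2} with hS
  have hSo : IsOpen S :=
    isOpen_Ioi.inter (isOpen_lt (dR.continuous.sub continuous_const).norm continuous_const)
  have hslit : ∀ y ∈ S, R y ∈ Complex.slitPlane := fun y hy => by
    have h1 : R y - 1 + 1 ∈ Complex.slitPlane := by
      rw [add_comm]
      exact Complex.mem_slitPlane_of_norm_lt_one (by linarith [hy.2])
    simpa using h1
  have hW0 : ∀ y ∈ S, W y ≠ 0 := fun y hy h => by
    have := Complex.slitPlane_ne_zero (hslit y hy)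
    simp [hRdef, h] at this
  have hlogL : ∀ y ∈ S, logHigh c x₀ u y k = L y := fun y hy => by
    have h1 : ‖R y‖ = ‖W y‖ * c y ^ (1 / 4 : ℝ) := by
      rw [← hRR y hy.1.le, norm_highFreqFactor hc1 hW hy.1.le]
    have h2 : Real.log ‖R y‖ = Real.log ‖W y‖ + 1 / 4 * Real.log (c y) := by
      rw [h1, Real.log_mul (norm_ne_zero_iff.2 (hW0 y hy))
        (Real.rpow_pos_of_pos (hcpos y) _).ne', Real.log_rpow (hcpos y)]
    simp only [logHigh, hL, hRR y hy.1.le, hW.eq_wField y hy.1.le, Complex.log, h2]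
    push_cast
    ring
  have hexpL : ∀ y ∈ S, Complex.exp (L y) = W y := fun y hy => by
    have h1 : Complex.exp ((1 / 4 * Real.log (c y) : ℝ) : ℂ) = ((c y ^ (1 / 4 : ℝ) : ℝ) : ℂ) := by
      rw [← Complex.ofReal_exp, Real.rpow_def_of_pos (hcpos y), mul_comm]
    have h2 : ((c y ^ (1 / 4 : ℝ) : ℝ) : ℂ) ≠ 0 := by
      exact_mod_cast (Real.rpow_pos_of_pos (hcpos y) _).ne'
    rw [hL, Complex.exp_sub, Complex.exp_sub, Complex.exp_log (Complex.slitPlane_ne_zero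
      (hslit y hy)), h1, hRdef]
    field_simp
  filter_upwards [hSo.mem_nhds (show x ∈ S from ⟨hx, by rwa [← hRR x hx.le]⟩)] with y hy
  refine ⟨hW0 y hy, ?_⟩
  have hev : ∀ᶠ z in 𝓝 y, z ∈ S := hSo.mem_nhds hy
  have dL : DifferentiableAt ℝ L y :=
    (((dR y).hasDerivAt.clog_real (hslit y hy)).differentiableAt.sub (dl y)).sub
      ((dθC y).const_mul _)
  have h1 : HasDerivAt W (Complex.exp (L y) * deriv L y) y :=
    dL.hasDerivAt.cexp.congr_of_eventuallyEq (hev.mono fun z hz => (hexpL z hz).symm)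
  have h2 : deriv L y = deriv W y / W y := by
    rw [h1.deriv, hexpL y hy]
    field_simp [hW0 y hy]
  rw [← h2]
  exact dL.hasDerivAt.congr_of_eventuallyEq (hev.mono fun z hz => hlogL z hz)

/-- `∂ₓ v = w' / (k² w)`. -/
noncomputable def logDeriv₁ (k : ℝ) (W : ℝ → ℂ) (x : ℝ) : ℂ := deriv W x / ((k : ℂ) ^ 2 * W x)

/-- `∂ₓ² v = w'' / (k² w) - (w')² / (k² w²)`. -/
noncomputable def logDeriv₂ (k : ℝ) (W : ℝ → ℂ) (x : ℝ) : ℂ :=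
  deriv (deriv W) x / ((k : ℂ) ^ 2 * W x) - deriv W x ^ 2 / ((k : ℂ) ^ 2 * W x ^ 2)

theorem IsNormalizedField.hasDerivAt (hW : IsNormalizedField c x₀ k u W) (x : ℝ) :
    HasDerivAt W (deriv W x) x :=
  hasDerivAt_deriv_of_contDiff hW.contDiff (by norm_num) x

theorem IsNormalizedField.contDiff_deriv (hW : IsNormalizedField c x₀ k u W) :
    ContDiff ℝ 2 (deriv W) := (contDiff_succ_iff_deriv (n := 2).1 hW.contDiff).2.2

theorem IsNormalizedField.hasDerivAt_deriv (hW : IsNormalizedField c x₀ k u W) (x : ℝ) :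
    HasDerivAt (deriv W) (deriv (deriv W) x) x :=
  hasDerivAt_deriv_of_contDiff hW.contDiff_deriv (by norm_num) x

theorem IsNormalizedField.continuous_deriv_deriv (hW : IsNormalizedField c x₀ k u W) :
    Continuous (deriv (deriv W)) := hW.contDiff_deriv.continuous_deriv (by norm_num)

theorem IsNormalizedField.hasDerivAt_logDeriv₁ (hW : IsNormalizedField c x₀ k u W) (hk : 0 < k)
    {x : ℝ} (hx : W x ≠ 0) : HasDerivAt (logDeriv₁ k W) (logDeriv₂ k W x) x := by
  have hkC : (k : ℂ) ≠ 0 := by exact_mod_cast hk.ne'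
  refine ((hW.hasDerivAt_deriv x).div ((hW.hasDerivAt x).const_mul ((k : ℂ) ^ 2))
    (by simp [hkC, hx])).congr_deriv ?_
  rw [logDeriv₂]
  field_simp

theorem IsNormalizedField.isPrimitive_logDeriv₁ (hW : IsNormalizedField c x₀ k u W) (hk : 0 < k)
    (h0 : ∀ x ∈ Icc (0 : ℝ) 1, W x ≠ 0) : IsPrimitive (logDeriv₁ k W) (logDeriv₂ k W) := by
  have hkC : (k : ℂ) ≠ 0 := by exact_mod_cast hk.ne'
  refine IsPrimitive.of_hasDerivAt (fun x hx => hW.hasDerivAt_logDeriv₁ hk (h0 x hx)) ?_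
  have hWc : ContinuousOn W (Icc 0 1) := hW.contDiff.continuous.continuousOn
  refine (hW.continuous_deriv_deriv.continuousOn.div (continuousOn_const.mul hWc) ?_).sub
    ((hW.contDiff_deriv.continuous.continuousOn.pow 2).div (continuousOn_const.mul (hWc.pow 2)) ?_)
  · intro x hx; simp [hkC, h0 x hx]
  · intro x hx; simp [hkC, h0 x hx]

/-- The Riccati equation `v'' + k² (v')² - 2ik v' + c - 1 = 0`. -/
theorem IsNormalizedField.riccati (hW : IsNormalizedField c x₀ k u W) (hk : 0 < k) {x : ℝ}
    (hx : x₀ < x) (h0 : W x ≠ 0) :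
    logDeriv₂ k W x + (k : ℂ) ^ 2 * logDeriv₁ k W x ^ 2 - 2 * Complex.I * k * logDeriv₁ k W x
      + ((c x - 1 : ℝ) : ℂ) = 0 := by
  have hkC : (k : ℂ) ≠ 0 := by exact_mod_cast hk.ne'
  have h := hW.ode x hx
  rw [logDeriv₁, logDeriv₂]
  field_simp
  linear_combination W x * h

theorem IsNormalizedField.eventually_hasDerivAt_vField (hW : IsNormalizedField c x₀ k u W)
    (hc : IsAdmissible c₀ c₁ c) (hc1 : ∀ x, 1 ≤ c x) {kmax : ℝ} (hk : 0 < k) (hkm : kmax ≤ k) {x : ℝ}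
    (hx : x₀ < x) (hR : ‖highFreqFactor c x₀ u x k - 1‖ < 1 / 2) :
    ∀ᶠ y in 𝓝 x, W y ≠ 0 ∧ HasDerivAt (fun y => vField c x₀ kmax u y k) (logDeriv₁ k W y) y := by
  have hkC : (k : ℂ) ≠ 0 := by exact_mod_cast hk.ne'
  filter_upwards [hW.eventually_hasDerivAt_logHigh hc hc1 hx hR] with y hy
  refine ⟨hy.1, ?_⟩
  have h1 : (fun y => vField c x₀ kmax u y k) = fun y => logHigh c x₀ u y k / (k : ℂ) ^ 2 := by
    funext y
    simp [vField, logW, hkm]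
  rw [h1]
  refine (hy.2.div_const _).congr_deriv ?_
  rw [logDeriv₁]
  field_simp

end

/-- At `x = 0` the phase vanishes and `c = 1`, so that `R = w` there. -/
theorem norm_logHigh_zero_le {c₀ c₁ : ℝ} {c : ℝ → ℝ} {x₀ k : ℝ} {u : ℝ → ℝ → ℂ}
    (hc : IsAdmissible c₀ c₁ c) (hx₀ : x₀ < 0)
    (hR : ‖highFreqFactor c x₀ u 0 k - 1‖ < 1 / 2) :
    ‖wField x₀ u 0 k - 1‖ < 1 / 2 ∧ ‖logHigh c x₀ u 0 k‖ ≤ 5 := by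
  have hθ := phase_zero hc hx₀
  have hc0 : c 0 = 1 := hc.eq_one 0 (by simp)
  have hRw : highFreqFactor c x₀ u 0 k = wField x₀ u 0 k := by
    simp [highFreqFactor, hθ, hc0]
  rw [hRw] at hR
  refine ⟨hR, ?_⟩
  set w := wField x₀ u 0 k
  have h1 : 1 / 2 ≤ ‖w‖ := by
    have := norm_sub_norm_le (1 : ℂ) w
    rw [norm_one, norm_sub_rev] at this
    linarith
  have h2 : ‖w‖ ≤ 3 / 2 := by
    have := norm_sub_norm_le w (1 : ℂ)
    rw [norm_one] at this
    linarith
  have h3 : |Real.log ‖w‖| ≤ 1 := by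
    rw [abs_le]
    constructor
    · have := Real.one_sub_inv_le_log_of_pos (show 0 < ‖w‖ by linarith)
      have h4 : ‖w‖⁻¹ ≤ 2 := by
        rw [inv_le_comm₀ (by linarith) (by norm_num)]; linarith
      linarith
    · have := Real.log_le_sub_one_of_pos (show 0 < ‖w‖ by linarith)
      linarith
  have h4 : logHigh c x₀ u 0 k = (Real.log ‖w‖ : ℂ) + Complex.I * Complex.arg w := by
    simp only [logHigh, hθ, hRw, w]
    simp
  rw [h4]
  refine (norm_add_le _ _).trans ?_
  rw [norm_mul, Complex.norm_I, one_mul, Complex.norm_real, Complex.norm_real, Real.norm_eq_abs,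
    Real.norm_eq_abs]
  have := Complex.abs_arg_le_pi w
  linarith [Real.pi_lt_four]

/-! ### The tail -/

/-- The first two derivatives of `v(·, k) - g` for a wave number `k ≥ kmax`. The case `g = 0` identifies
the derivatives of the exact tail, the case `g = p / k` those of the remainder in its assumed form. -/
theorem IsNormalizedField.vField_derivs {c₀ c₁ x₀ k kmax : ℝ} {c : ℝ → ℝ} {u : ℝ → ℝ → ℂ}
    {W : ℝ → ℂ} (hW : IsNormalizedField c x₀ k u W)
    (hc : IsAdmissible c₀ c₁ c) (hc1 : ∀ x, 1 ≤ c x) (hk : 0 < k) (hkm : kmax ≤ k) {x : ℝ}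
    (hx : x₀ < x) (hR : ‖highFreqFactor c x₀ u x k - 1‖ < 1 / 2) {g : ℝ → ℂ} (hg : ContDiff ℝ 2 g) :
    iteratedDeriv 1 (fun y => vField c x₀ kmax u y k - g y) x = logDeriv₁ k W x - deriv g x ∧
      iteratedDeriv 2 (fun y => vField c x₀ kmax u y k - g y) x =
        logDeriv₂ k W x - deriv (deriv g) x := by
  have hev := hW.eventually_hasDerivAt_vField hc hc1 hk hkm hx hR
  have hg' : ContDiff ℝ 1 (deriv g) := (contDiff_succ_iff_deriv (n := 1).1 hg).2.2
  have hev' : deriv (fun y => vField c x₀ kmax u y k - g y) =ᶠ[𝓝 x]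
      fun y => logDeriv₁ k W y - deriv g y := by
    filter_upwards [hev] with y hy
    exact (hy.2.fun_sub (hasDerivAt_deriv_of_contDiff hg (by norm_num) y)).deriv
  rw [iteratedDeriv_one, iteratedDeriv_succ, iteratedDeriv_one, hev'.deriv_eq]
  refine ⟨hev'.eq_of_nhds, ?_⟩
  exact ((hW.hasDerivAt_logDeriv₁ hk hev.self_of_nhds.1).fun_sub
    (hasDerivAt_deriv_of_contDiff hg' le_rfl x)).deriv

/-- With `v = p/k + r` the Riccati equation reads `p''/k + (p'² - 2ip' + c - 1) = -E`; this is the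
bound of `E`. -/
theorem riccati_error_le {k ε B : ℝ} {p₁ r₁ r₂ : ℝ → ℂ} (hk : 1 ≤ k) (hp : CLe p₁ B)
    (hpm : AEStronglyMeasurable p₁ unitMeasure) (hr : IsPrimitive r₁ r₂)
    (h1 : L2Le r₁ (ε / k ^ 2)) (h2 : L2Le r₂ (ε / k ^ 2)) :
    L2Le (fun x => r₂ x + 2 * k * p₁ x * r₁ x + (k : ℂ) ^ 2 * r₁ x ^ 2
      - 2 * Complex.I * k * r₁ x) ((3 + 2 * B + 2 * ε) * ε) := by
  have hk0 : 0 < k := by linarith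
  have hB : 0 ≤ B := (norm_nonneg _).trans (hp 0 (by simp))
  have hs := hr.norm_le h1 h2
  have hεk : 0 ≤ ε / k ^ 2 := h1.nonneg
  have hε : 0 ≤ ε := by
    have := mul_nonneg hεk (sq_nonneg k)
    rwa [div_mul_cancel₀ _ (by positivity)] at this
  have hle : ε / k ^ 2 ≤ ε := div_le_self hε (one_le_pow₀ hk)
  have hle' : k * (ε / k ^ 2) ≤ ε := by
    rw [← mul_div_assoc, div_le_iff₀ (by positivity)]
    nlinarith [mul_nonneg hε (mul_nonneg hk0.le (sub_nonneg.2 hk))]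
  have hle2 : k ^ 2 * (ε / k ^ 2) = ε := mul_div_cancel₀ _ (by positivity)
  have nk : ‖(k : ℂ)‖ = k := by rw [Complex.norm_real, Real.norm_of_nonneg hk0.le]
  have t1 : L2Le (fun x => 2 * (k : ℂ) * (p₁ x * r₁ x)) (2 * B * ε) := by
    refine ((L2Le.mul hpm hp h1).const_mul (2 * (k : ℂ))).mono ?_
    rw [norm_mul, nk, Complex.norm_two]
    nlinarith [mul_le_mul_of_nonneg_left hle' hB]
  have t2 : L2Le (fun x => (k : ℂ) ^ 2 * (r₁ x * r₁ x)) (2 * ε * ε) := by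
    refine ((L2Le.mul h1.meas hs h1).const_mul ((k : ℂ) ^ 2)).mono ?_
    rw [norm_pow, nk]
    calc k ^ 2 * ((ε / k ^ 2 + ε / k ^ 2) * (ε / k ^ 2))
        = (k ^ 2 * (ε / k ^ 2)) * (2 * (ε / k ^ 2)) := by ring
      _ ≤ ε * (2 * ε) := by rw [hle2]; gcongr
      _ = 2 * ε * ε := by ring
  have t3 : L2Le (fun x => 2 * Complex.I * k * r₁ x) (2 * ε) := by
    refine (h1.const_mul (2 * Complex.I * k)).mono ?_
    rw [norm_mul, norm_mul, nk, Complex.norm_two, Complex.norm_I]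
    linarith
  exact ((((h2.add t1).add t2).sub t3).congr fun x _ => by ring).mono (by nlinarith)

/-- Comparison of the Riccati equations at two wave numbers eliminates the profile equation and shows
that `v''(·, kmax)` is of the size of the error in the tail form; as `v'(1, kmax) = 0`, the same
holds for `v'(·, kmax)`. -/
theorem tail_derivs_le (K : ℝ) (hK : 1 ≤ K) : ∃ C : ℝ, 1 ≤ C ∧
    ∀ (c₀ c₁ x₀ kmax η M : ℝ) (c : ℝ → ℝ) (u : ℝ → ℝ → ℂ) (W : ℝ → ℂ),
      1 ≤ kmax → kmax ≤ K → M ≤ K → 0 ≤ M → 0 ≤ η → η ≤ 1 → x₀ < 0 →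
      IsAdmissible c₀ c₁ c → (∀ x, 1 ≤ c x) →
      (∀ k, 0 < k → IsForwardSolution c x₀ k (fun x => u x k)) →
      (∀ x ∈ Icc (0 : ℝ) 1, ∀ k, kmax ≤ k → ‖highFreqFactor c x₀ u x k - 1‖ < 1 / 2) →
      TailForm c x₀ kmax u (M * η) → CLe (tailDeriv c x₀ kmax u 1) M →
      IsNormalizedField c x₀ kmax u W →
      CLe (logDeriv₁ kmax W) (C * η) ∧ L2Le (logDeriv₂ kmax W) (C * η) := by
  set C₁ : ℝ := (3 + 2 * (3 * K ^ 2) + 2 * K) * K with hC₁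
  have hC₁pos : 0 ≤ C₁ := by positivity
  refine ⟨4 * C₁ + K, by nlinarith, ?_⟩
  intro c₀ c₁ x₀ kmax η M c u W hk1 hkK hMK hM hη hη1 hx₀ hc hc1 hu hR hT hV hW
  obtain ⟨p, hp, hT⟩ := hT
  have hp' : ContDiff ℝ 1 (deriv p) := (contDiff_succ_iff_deriv (n := 1).1 hp).2.2
  have hp'' : Continuous (deriv (deriv p)) := hp'.continuous_deriv le_rfl
  have hMη : M * η ≤ K := by nlinarith
  have hMη0 : 0 ≤ M * η := by positivity
  -- The remainder at a wave number `k ≥ kmax`.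
  have key : ∀ k, kmax ≤ k → ∀ W, IsNormalizedField c x₀ k u W →
      (∀ x ∈ Icc (0 : ℝ) 1, W x ≠ 0) ∧
      IsPrimitive (fun x => logDeriv₁ k W x - deriv p x / k)
        (fun x => logDeriv₂ k W x - deriv (deriv p) x / k) ∧
      L2Le (fun x => logDeriv₁ k W x - deriv p x / k) (M * η / k ^ 2) ∧
      L2Le (fun x => logDeriv₂ k W x - deriv (deriv p) x / k) (M * η / k ^ 2) := by
    intro k hk W hW
    have hk0 : 0 < k := by linarith
    have hW0 : ∀ x ∈ Icc (0 : ℝ) 1, W x ≠ 0 := fun x hx =>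
      (hW.eventually_hasDerivAt_vField (kmax := kmax) hc hc1 hk0 hk (by linarith [hx.1])
        (hR x hx k hk)).self_of_nhds.1
    have dpk : ∀ x, deriv (fun y => p y / k) x = deriv p x / k := fun x =>
      deriv_div_const (k : ℂ)
    have dpk' : ∀ x, deriv (deriv fun y => p y / k) x = deriv (deriv p) x / k := fun x => by
      rw [funext dpk]
      exact deriv_div_const (k : ℂ)
    have hpr : IsPrimitive (fun x => deriv p x / k) (fun x => deriv (deriv p) x / k) :=
      IsPrimitive.of_hasDerivAt
        (fun x _ => (hasDerivAt_deriv_of_contDiff hp' le_rfl x).div_const _)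
        (hp''.div_const _).continuousOn
    have hv := hW.isPrimitive_logDeriv₁ hk0 hW0
    have hv2 : ContinuousOn (logDeriv₂ k W) (Icc 0 1) := by
      have hWc : ContinuousOn W (Icc 0 1) := hW.contDiff.continuous.continuousOn
      have hkC : (k : ℂ) ≠ 0 := by exact_mod_cast hk0.ne'
      refine (hW.continuous_deriv_deriv.continuousOn.div (continuousOn_const.mul hWc) ?_).sub
        ((hW.contDiff_deriv.continuous.continuousOn.pow 2).div
          (continuousOn_const.mul (hWc.pow 2)) ?_)
      · intro x hx; simp [hkC, hW0 x hx]
      · intro x hx; simp [hkC, hW0 x hx]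
    have hder := fun x (hx : x ∈ Icc (0 : ℝ) 1) =>
      hW.vField_derivs hc hc1 hk0 hk (by linarith [hx.1]) (hR x hx k hk)
        (g := fun y => p y / k) (hp.div_const _)
    have hε : 0 ≤ M * η / k ^ 2 := by positivity
    refine ⟨hW0, hv.sub hpr, ⟨hε, (hv.sub hpr).meas, ?_⟩, ⟨hε, ?_, ?_⟩⟩
    · refine le_trans (le_of_eq (eLpNorm_congr_ae ?_)) ((normL2_le_normH one_le_two _).trans (hT k hk))
      exact ae_unitMeasure fun x hx => by rw [(hder x hx).1, dpk]
    · exact aestronglyMeasurable_of_continuousOn (hv2.sub (hp''.div_const _).continuousOn)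
    · refine le_trans (le_of_eq (eLpNorm_congr_ae ?_)) ((normL2_le_normH le_rfl _).trans (hT k hk))
      exact ae_unitMeasure fun x hx => by rw [(hder x hx).2, dpk']
  obtain ⟨hW0, hr, h1, h2⟩ := key kmax le_rfl W hW
  have hk0 : 0 < kmax := by linarith
  have hkC : (kmax : ℂ) ≠ 0 := by exact_mod_cast hk0.ne'
  have hVW : ∀ x ∈ Icc (0 : ℝ) 1, tailDeriv c x₀ kmax u 1 x = logDeriv₁ kmax W x := fun x hx => by
    have := (hW.vField_derivs hc hc1 hk0 le_rfl (by linarith [hx.1]) (hR x hx kmax le_rfl)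
      (g := fun _ => 0) contDiff_const).1
    simpa [tailDeriv] using this
  have nk : ‖(kmax : ℂ)‖ = kmax := by rw [Complex.norm_real, Real.norm_of_nonneg hk0.le]
  have hleM : M * η / kmax ^ 2 ≤ M * η := div_le_self hMη0 (one_le_pow₀ hk1)
  have hpB : CLe (deriv p) (3 * K ^ 2) := by
    intro x hx
    have e1 : deriv p x = kmax * (tailDeriv c x₀ kmax u 1 x
        - (logDeriv₁ kmax W x - deriv p x / kmax)) := by
      rw [hVW x hx]; field_simp; ring
    have e2 := hV x hx
    have e3 := hr.norm_le h1 h2 x hx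
    have e4 : ‖tailDeriv c x₀ kmax u 1 x - (logDeriv₁ kmax W x - deriv p x / kmax)‖ ≤ 3 * K := by
      refine (norm_sub_le _ _).trans ?_
      linarith
    rw [e1, norm_mul, nk]
    calc kmax * _ ≤ K * (3 * K) := mul_le_mul hkK e4 (norm_nonneg _) (by linarith)
      _ = 3 * K ^ 2 := by ring
  have hpm : AEStronglyMeasurable (deriv p) unitMeasure :=
    aestronglyMeasurable_of_continuousOn hp'.continuous.continuousOn
  obtain ⟨W', hW'⟩ := (hu (2 * kmax) (by linarith)).exists_normalizedField hc hx₀ (by linarith)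
  obtain ⟨hW0', hr', h1', h2'⟩ := key (2 * kmax) (by linarith) W' hW'
  have hE := riccati_error_le hk1 hpB hpm hr h1 h2
  have hE' := riccati_error_le (by linarith) hpB hpm hr' h1' h2'
  have hbd : (3 + 2 * (3 * K ^ 2) + 2 * (M * η)) * (M * η) ≤ C₁ * η := by
    calc (3 + 2 * (3 * K ^ 2) + 2 * (M * η)) * (M * η)
        ≤ (3 + 2 * (3 * K ^ 2) + 2 * K) * (K * η) := by gcongr
      _ = C₁ * η := by rw [hC₁]; ring
  -- `p''` is the difference of the two Riccati equations.
  have hp2 : L2Le (fun x => deriv (deriv p) x / kmax) (4 * C₁ * η) := by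
    refine (((hE'.sub hE).const_mul 2).congr fun x hx => ?_).mono ?_
    · have a1 := hW.riccati hk0 (by linarith [hx.1]) (hW0 x hx)
      have a2 := hW'.riccati (by linarith) (by linarith [hx.1]) (hW0' x hx)
      have b2 : deriv p x / ((2 * kmax : ℝ) : ℂ) = deriv p x / kmax / 2 := by
        push_cast; field_simp
      have c2 : deriv (deriv p) x / ((2 * kmax : ℝ) : ℂ) = deriv (deriv p) x / kmax / 2 := by
        push_cast; field_simp
      have b1 : deriv p x = kmax * (deriv p x / kmax) := by field_simp
      rw [b2, c2]
      generalize deriv (deriv p) x / (kmax : ℂ) = P2 at *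
      generalize deriv p x / (kmax : ℂ) = P1 at *
      rw [b1]
      push_cast at a1 a2 ⊢
      linear_combination 2 * a2 - 2 * a1
    · rw [Complex.norm_two]
      linarith
  have hV2 : L2Le (logDeriv₂ kmax W) ((4 * C₁ + K) * η) := by
    refine ((hp2.add h2).congr fun x _ => by ring).mono ?_
    have : M * η ≤ K * η := by gcongr
    linarith
  refine ⟨fun x hx => ?_, hV2⟩
  have h1m : (1 : ℝ) ∈ Icc (0 : ℝ) 1 := by simp
  have e1 := (hW.isPrimitive_logDeriv₁ hk0 hW0).sub_eq h1m hx
  have e2 := hV2.norm_integral_le h1m hx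
  have e3 : logDeriv₁ kmax W 1 = 0 := by simp [logDeriv₁, hW.deriv_eq_zero 1 le_rfl]
  rwa [← e1, e3, sub_zero] at e2

/-- For every wave number the field `w` is constant to the right of the inhomogeneity, hence so is
`q`. -/
theorem qField_of_one_le {c₀ c₁ x₀ kmax k : ℝ} {c : ℝ → ℝ} {u : ℝ → ℝ → ℂ}
    (hc : IsAdmissible c₀ c₁ c) (hx₀ : x₀ < 0)
    (hu : ∀ k, 0 < k → IsForwardSolution c x₀ k (fun x => u x k))
    (hk : 0 < k) (hkm : k < kmax) {x : ℝ} (hx : 1 ≤ x) :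
    qField c x₀ kmax u x k = qField c x₀ kmax u 1 k := by
  have hw : ∀ s, 0 < s → wField x₀ u x s = wField x₀ u 1 s := fun s hs => by
    obtain ⟨W, hW⟩ := (hu s hs).exists_normalizedField hc hx₀ hs
    rw [hW.eq_wField x (by linarith), hW.eq_wField 1 (by linarith), hW.eq_one x hx]
  have hcx : c x = c 1 := by
    rw [hc.eq_one x (fun h => by linarith [h.2]), hc.eq_one 1 (by simp)]
  have hlog : logHigh c x₀ u x kmax = logHigh c x₀ u 1 kmax := by
    simp only [logHigh, highFreqFactor, hw kmax (by linarith), hcx, phase_of_one_le hc hx]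
  have hv : (fun s => vField c x₀ kmax u x s) =ᶠ[𝓝 k] fun s => vField c x₀ kmax u 1 s := by
    filter_upwards [Ioo_mem_nhds hk hkm] with s hs
    have hI : ∫ κ in s..kmax, deriv (fun s => wField x₀ u x s) κ / wField x₀ u x κ =
        ∫ κ in s..kmax, deriv (fun s => wField x₀ u 1 s) κ / wField x₀ u 1 κ := by
      refine intervalIntegral.integral_congr fun κ hκ => ?_
      rw [uIcc_of_le hs.2.le] at hκ
      have hκ0 : 0 < κ := hs.1.trans_le hκ.1
      have h1 : (fun s => wField x₀ u x s) =ᶠ[𝓝 κ] fun s => wField x₀ u 1 s := by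
        filter_upwards [Ioi_mem_nhds hκ0] with s hs using hw s hs
      simp only [h1.deriv_eq, hw κ hκ0]
    simp only [vField, logW, not_le.2 hs.2, if_false, hI, hlog]
  exact hv.deriv_eq

/-- The exact functions `q_n` satisfy the boundary condition at `1` of the quasi-reversibility
method. -/
theorem Represents.deriv_one_eq_zero {c₀ c₁ x₀ kmax h : ℝ} {c : ℝ → ℝ} {u : ℝ → ℝ → ℂ} {N n : ℕ}
    {qs : ℕ → SobolevFn 2} (hq : Represents c x₀ kmax h u N qs)
    (hc : IsAdmissible c₀ c₁ c) (hx₀ : x₀ < 0)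
    (hu : ∀ k, 0 < k → IsForwardSolution c x₀ k (fun x => u x k)) (hn : n ∈ Finset.Icc 1 N)
    (hk : 0 < grid kmax h n) (hkm : grid kmax h n < kmax) : (qs n).D 1 1 = 0 := by
  have h1 := ((hq n hn 1 (by simp)).2).hasDerivWithinAt (s := Ici 1)
  have h2 : HasDerivWithinAt (fun y => qField c x₀ kmax u y (grid kmax h n)) 0 (Ici 1) 1 :=
    (hasDerivWithinAt_const (1 : ℝ) (Ici (1 : ℝ)) (qField c x₀ kmax u 1 (grid kmax h n))).congr
      (fun y hy => qField_of_one_le hc hx₀ hu hk hkm hy) rfl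
  exact (uniqueDiffWithinAt_Ici (1 : ℝ)).eq_deriv _ h1 h2

/-! ### One step of the algorithm -/

/-- The bounds on the exact discretized solution, with a single constant `K`: `T₁`, `T₂` are the first
two derivatives of the exact tail. -/
structure ExactData (K η kmax h : ℝ) (N : ℕ) (c : ℝ → ℝ) (T₁ T₂ : ℝ → ℂ)
    (qs : ℕ → SobolevFn 2) : Prop where
  h_nonneg : 0 ≤ h
  h_mul_le : ∀ n ∈ Finset.Icc 1 N, h * n ≤ K
  grid_le : ∀ n ∈ Finset.Icc 1 N, ‖(grid kmax h n : ℂ)‖ ≤ K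
  tail_prim : IsPrimitive T₁ T₂
  tail_one : CLe T₁ K
  tail_two : L2Le T₂ K
  q_zero : ∀ n ∈ Finset.Icc 1 N, CLe ((qs n).D 0) K
  q_one : ∀ n ∈ Finset.Icc 1 N, CLe ((qs n).D 1) K
  q_two : ∀ n ∈ Finset.Icc 1 N, L2Le ((qs n).D 2) K
  q_end : ∀ n ∈ Finset.Icc 1 N, (qs n).D 1 1 = 0
  errG_le : ∀ n ∈ Finset.Icc 1 N, L2Le (fun x => (qs n).D 2 x
    + coeffA kmax h (fun j => (qs j).D) T₁ n x * (qs n).D 1 x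
    - rhsD kmax h (fun j => (qs j).D) T₁ n x) (K * η)
  errF_le : ∀ n ∈ Finset.Icc 1 N, L2Le (fun x => ((c x - 1 : ℝ) : ℂ)
    - betaExpr kmax h (fun j => (qs j).D) T₁ T₂ n x) (K * η)

/-- `y` is `e`-close to `s` in `C¹[0,1]` and in `H²(0,1)`. -/
structure IsClose (y : SobolevFn 3) (s : SobolevFn 2) (e : ℝ) : Prop where
  zero : CLe (fun x => y.D 0 x - s.D 0 x) e
  one : CLe (fun x => y.D 1 x - s.D 1 x) e
  two : L2Le (fun x => y.D 2 x - s.D 2 x) e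

theorem IsClose.mono {y : SobolevFn 3} {s : SobolevFn 2} {e e' : ℝ} (h : IsClose y s e)
    (he : e ≤ e') : IsClose y s e' :=
  ⟨fun x hx => (h.zero x hx).trans he, fun x hx => (h.one x hx).trans he, h.two.mono he⟩

section

variable {h K e : ℝ} {n : ℕ}

theorem norm_mul_sum_le (hh : 0 ≤ h) (hn : h * n ≤ K) (he : 0 ≤ e) {z : ℕ → ℂ}
    (hz : ∀ j ∈ Finset.Ico 1 n, ‖z j‖ ≤ e) : ‖(h : ℂ) * ∑ j ∈ Finset.Ico 1 n, z j‖ ≤ K * e := by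
  rw [norm_mul, Complex.norm_real, Real.norm_of_nonneg hh]
  have h1 : ‖∑ j ∈ Finset.Ico 1 n, z j‖ ≤ n * e := by
    refine (norm_sum_le_of_le _ hz).trans ?_
    rw [Finset.sum_const, Nat.card_Ico, nsmul_eq_mul]
    exact mul_le_mul_of_nonneg_right (by exact_mod_cast Nat.sub_le n 1) he
  calc h * _ ≤ h * (n * e) := mul_le_mul_of_nonneg_left h1 hh
    _ = h * n * e := by ring
    _ ≤ K * e := mul_le_mul_of_nonneg_right hn he

theorem L2Le.mul_sum (hh : 0 ≤ h) (hn : h * n ≤ K) (he : 0 ≤ e) {z : ℕ → ℝ → ℂ}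
    (hz : ∀ j ∈ Finset.Ico 1 n, L2Le (z j) e) :
    L2Le (fun x => (h : ℂ) * ∑ j ∈ Finset.Ico 1 n, z j x) (K * e) := by
  refine ((L2Le.sum _ hz).const_mul (h : ℂ)).mono ?_
  rw [Complex.norm_real, Real.norm_of_nonneg hh, Finset.sum_const, Nat.card_Ico, nsmul_eq_mul]
  calc h * (((n - 1 : ℕ) : ℝ) * e) ≤ h * (n * e) := by
        gcongr
        exact Nat.sub_le n 1
    _ = h * n * e := by ring
    _ ≤ K * e := mul_le_mul_of_nonneg_right hn he

theorem tailMinusQ_sub (q q' : ℕ → ℕ → ℝ → ℂ) (V V' : ℝ → ℂ) (s : ℕ) (x : ℝ) :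
    tailMinusQ h q V n s x - tailMinusQ h q' V' n s x =
      -((h : ℂ) * ∑ j ∈ Finset.Ico 1 n, (q j s x - q' j s x)) + (V x - V' x) := by
  simp only [tailMinusQ, Finset.sum_sub_distrib]
  ring

theorem tailMinusQ_sub_le (hh : 0 ≤ h) (hn : h * n ≤ K) (he : 0 ≤ e) {q q' : ℕ → ℕ → ℝ → ℂ}
    {V V' : ℝ → ℂ} {s : ℕ} (hV : CLe (fun x => V x - V' x) e)
    (hq : ∀ j ∈ Finset.Ico 1 n, CLe (fun x => q j s x - q' j s x) e) :
    CLe (fun x => tailMinusQ h q V n s x - tailMinusQ h q' V' n s x) ((K + 1) * e) := by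
  intro x hx
  simp only [tailMinusQ_sub]
  refine (norm_add_le _ _).trans ?_
  rw [norm_neg]
  have h1 := norm_mul_sum_le (n := n) hh hn he (z := fun j => q j s x - q' j s x)
    (fun j hj => hq j hj x hx)
  have h2 := hV x hx
  linarith

theorem L2Le.tailMinusQ_sub (hh : 0 ≤ h) (hn : h * n ≤ K) (he : 0 ≤ e) {q q' : ℕ → ℕ → ℝ → ℂ}
    {V V' : ℝ → ℂ} {s : ℕ} (hV : L2Le (fun x => V x - V' x) e)
    (hq : ∀ j ∈ Finset.Ico 1 n, L2Le (fun x => q j s x - q' j s x) e) :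
    L2Le (fun x => tailMinusQ h q V n s x - tailMinusQ h q' V' n s x) ((K + 1) * e) := by
  refine (((L2Le.mul_sum hh hn he hq).neg.add hV).congr fun x _ => ?_).mono (by linarith)
  rw [Helmholtz.tailMinusQ_sub]

theorem tailMinusQ_le (hh : 0 ≤ h) (hn : h * n ≤ K) (hK : 1 ≤ K) {q : ℕ → ℕ → ℝ → ℂ}
    {V : ℝ → ℂ} {s : ℕ} (hV : CLe V K) (hq : ∀ j ∈ Finset.Ico 1 n, CLe (q j s) K) :
    CLe (tailMinusQ h q V n s) ((K + 1) * K) := by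
  have := tailMinusQ_sub_le (n := n) (q := q) (q' := fun _ _ _ => 0) (V := V) (V' := fun _ => 0)
    (s := s) hh hn (by linarith) (by simpa using hV) (by simpa using hq)
  intro x hx
  simpa [tailMinusQ] using this x hx

theorem L2Le.tailMinusQ (hh : 0 ≤ h) (hn : h * n ≤ K) (hK : 1 ≤ K) {q : ℕ → ℕ → ℝ → ℂ}
    {V : ℝ → ℂ} {s : ℕ} (hV : L2Le V K) (hq : ∀ j ∈ Finset.Ico 1 n, L2Le (q j s) K) :
    L2Le (tailMinusQ h q V n s) ((K + 1) * K) := by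
  have := L2Le.tailMinusQ_sub (n := n) (q := q) (q' := fun _ _ _ => 0) (V := V) (V' := fun _ => 0)
    (s := s) hh hn (by linarith) (by simpa using hV) (by simpa using hq)
  exact this.congr fun x _ => by simp [Helmholtz.tailMinusQ]

theorem aestronglyMeasurable_tailMinusQ {q : ℕ → ℕ → ℝ → ℂ} {V : ℝ → ℂ} {s : ℕ}
    (hV : AEStronglyMeasurable V unitMeasure)
    (hq : ∀ j ∈ Finset.Ico 1 n, AEStronglyMeasurable (q j s) unitMeasure) :
    AEStronglyMeasurable (tailMinusQ h q V n s) unitMeasure :=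
  (((Finset.aestronglyMeasurable_fun_sum _ hq).const_mul (h : ℂ)).neg).add hV

theorem aestronglyMeasurable_vDisc {q : ℕ → ℕ → ℝ → ℂ} {V : ℝ → ℂ} {s : ℕ}
    (hV : AEStronglyMeasurable V unitMeasure)
    (hq : ∀ j ∈ Finset.Icc 1 n, AEStronglyMeasurable (q j s) unitMeasure) (hn : 1 ≤ n) :
    AEStronglyMeasurable (vDisc h q V n s) unitMeasure :=
  (((hq n (by simp [hn])).const_mul (h : ℂ)).neg).add
    (aestronglyMeasurable_tailMinusQ hV fun j hj => hq j (by
      rw [Finset.mem_Ico] at hj; rw [Finset.mem_Icc]; omega))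

theorem aestronglyMeasurable_coeffA {kmax : ℝ} {q : ℕ → ℕ → ℝ → ℂ} {V : ℝ → ℂ}
    (hV : AEStronglyMeasurable V unitMeasure)
    (hq : ∀ j ∈ Finset.Ico 1 n, AEStronglyMeasurable (q j 1) unitMeasure) :
    AEStronglyMeasurable (coeffA kmax h q V n) unitMeasure :=
  ((aestronglyMeasurable_tailMinusQ hV hq).const_mul _).sub aestronglyMeasurable_const

theorem aestronglyMeasurable_rhsD {kmax : ℝ} {q : ℕ → ℕ → ℝ → ℂ} {V : ℝ → ℂ}
    (hV : AEStronglyMeasurable V unitMeasure)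
    (hq : ∀ j ∈ Finset.Ico 1 n, AEStronglyMeasurable (q j 1) unitMeasure) :
    AEStronglyMeasurable (rhsD kmax h q V n) unitMeasure :=
  (((aestronglyMeasurable_tailMinusQ hV hq).pow 2).const_mul _).add
    ((aestronglyMeasurable_tailMinusQ hV hq).const_mul _)

theorem aestronglyMeasurable_betaExpr {kmax : ℝ} {q : ℕ → ℕ → ℝ → ℂ} {V V' : ℝ → ℂ}
    (hV : AEStronglyMeasurable V unitMeasure) (hV' : AEStronglyMeasurable V' unitMeasure)
    (hq1 : ∀ j ∈ Finset.Icc 1 n, AEStronglyMeasurable (q j 1) unitMeasure)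
    (hq2 : ∀ j ∈ Finset.Icc 1 n, AEStronglyMeasurable (q j 2) unitMeasure) (hn : 1 ≤ n) :
    AEStronglyMeasurable (betaExpr kmax h q V V' n) unitMeasure :=
  ((aestronglyMeasurable_vDisc hV' hq2 hn).neg.sub
    (((aestronglyMeasurable_vDisc hV hq1 hn).pow 2).const_mul _)).add
    ((aestronglyMeasurable_vDisc hV hq1 hn).const_mul _)

end

theorem isPrimitive_tailMinusQ {h : ℝ} {n : ℕ} {q : ℕ → ℕ → ℝ → ℂ} {V V' : ℝ → ℂ} {s : ℕ}
    (hV : IsPrimitive V V') (hq : ∀ j ∈ Finset.Ico 1 n, IsPrimitive (q j s) (q j (s + 1))) :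
    IsPrimitive (tailMinusQ h q V n s) (tailMinusQ h q V' n (s + 1)) :=
  (((IsPrimitive.sum _ hq).const_mul (-(h : ℂ))).add hV).congr
    (fun x _ => by simp [tailMinusQ]) (fun x _ => by simp [tailMinusQ])

theorem mem_Icc_of_mem_Ico {n N j : ℕ} (hn : n ∈ Finset.Icc 1 N) (hj : j ∈ Finset.Ico 1 n) :
    j ∈ Finset.Icc 1 N := by
  rw [Finset.mem_Icc] at hn ⊢
  rw [Finset.mem_Ico] at hj
  omega

theorem mem_Icc_of_mem_Icc {n N j : ℕ} (hn : n ∈ Finset.Icc 1 N) (hj : j ∈ Finset.Icc 1 n) :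
    j ∈ Finset.Icc 1 N := by
  rw [Finset.mem_Icc] at hn hj ⊢
  omega

/-- The equation for `q_n`: the error of the QRM solution is of the order of the errors of the tail
and of the previous `q_j`. -/
theorem q_step (K : ℝ) (hK : 1 ≤ K) : ∃ C : ℝ, 1 ≤ C ∧
    ∀ (η kmax h e : ℝ) (N n : ℕ) (c : ℝ → ℝ) (T₁ T₂ : ℝ → ℂ) (qs : ℕ → SobolevFn 2)
      (q : ℕ → SobolevFn 3) (V : ℝ → ℂ) (p₀ p₁ : ℂ),
      ExactData K η kmax h N c T₁ T₂ qs → n ∈ Finset.Icc 1 N → 0 ≤ η → η ≤ e → C * e ≤ 1 →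
      AEStronglyMeasurable V unitMeasure → CLe (fun x => V x - T₁ x) e →
      (∀ j ∈ Finset.Ico 1 n, IsClose (q j) (qs j) e) →
      ‖p₀ - (qs n).D 0 0‖ ≤ e → ‖p₁ - (qs n).D 1 0‖ ≤ e →
      IsQRMSolution (η ^ 2) (coeffA kmax h (fun j => (q j).D) V n) 0
        (rhsD kmax h (fun j => (q j).D) V n) p₀ p₁ (q n) →
      IsClose (q n) (qs n) (C * e) := by
  -- `B` bounds the exact and the computed values of `-Q_{n-1}' + V'`.
  set B : ℝ := (K + 1) * K + (K + 1) with hB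
  have hB0 : 0 ≤ B := by positivity
  have hBge : (K + 1) * K ≤ B := by linarith
  set A : ℝ := 2 * K ^ 2 * B + 2 * K with hA
  set F : ℝ := 2 * K * B ^ 2 + 2 * B + A * K with hF
  set F' : ℝ := (4 * K * B + 2) * B + (K * (2 * K ^ 2 * B) + A * K) with hF'
  have hA0 : 0 ≤ A := by positivity
  have hF0 : 0 ≤ F := by positivity
  have hF'0 : 0 ≤ F' := by positivity
  obtain ⟨C₁, hC₁, H⟩ := qrm_stability (K + A + F + F') (by positivity)
  set C₂ : ℝ := 1 + K + 2 * K ^ 2 * ((K + 1) * K) + (4 * K * B + 2) * (K + 1) with hC₂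
  have hC₂1 : 1 ≤ C₂ := by
    have : 0 ≤ K + 2 * K ^ 2 * ((K + 1) * K) + (4 * K * B + 2) * (K + 1) := by positivity
    linarith
  refine ⟨C₁ * C₂, one_le_mul_of_one_le_of_one_le hC₁ hC₂1, ?_⟩
  intro η kmax h e N n c T₁ T₂ qs q V p₀ p₁ hX hn hη hηe hCe hVm hV hq hp₀ hp₁ hQ
  have he : 0 ≤ e := hη.trans hηe
  have hC₂e : C₂ * e ≤ 1 := by
    refine le_trans ?_ hCe
    rw [mul_assoc]
    exact le_mul_of_one_le_left (by positivity) hC₁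
  have hee : e ≤ C₂ * e := le_mul_of_one_le_left he hC₂1
  have hh := hX.h_nonneg
  have hhn := hX.h_mul_le n hn
  have hm := fun j (hj : j ∈ Finset.Ico 1 n) => mem_Icc_of_mem_Ico hn hj
  have hk := hX.grid_le n hn
  set κ : ℂ := (grid kmax h n : ℂ) with hκ
  set P := tailMinusQ h (fun j => (q j).D) V n 1 with hP
  set Ps := tailMinusQ h (fun j => (qs j).D) T₁ n 1 with hPs
  set Ps' := tailMinusQ h (fun j => (qs j).D) T₂ n 2 with hPs'
  set a := coeffA kmax h (fun j => (q j).D) V n with ha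
  set as := coeffA kmax h (fun j => (qs j).D) T₁ n with has
  set d := rhsD kmax h (fun j => (q j).D) V n with hd
  set ds := rhsD kmax h (fun j => (qs j).D) T₁ n with hds
  have ea : ∀ x, a x = 2 * κ ^ 2 * P x - 2 * Complex.I * κ := fun x => rfl
  have eas : ∀ x, as x = 2 * κ ^ 2 * Ps x - 2 * Complex.I * κ := fun x => rfl
  have ed : ∀ x, d x = -2 * κ * P x ^ 2 + 2 * Complex.I * P x := fun x => rfl
  have eds : ∀ x, ds x = -2 * κ * Ps x ^ 2 + 2 * Complex.I * Ps x := fun x => rfl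
  have hPP : CLe (fun x => P x - Ps x) ((K + 1) * e) :=
    tailMinusQ_sub_le hh hhn he hV fun j hj => (hq j hj).one
  have hPsB' : CLe Ps ((K + 1) * K) := tailMinusQ_le hh hhn hK hX.tail_one
    fun j hj => hX.q_one j (hm j hj)
  have hPsB : CLe Ps B := fun x hx => (hPsB' x hx).trans hBge
  have he1 : e ≤ 1 := hee.trans hC₂e
  have hPB : CLe P B := fun x hx => by
    have h1 := hPP x hx
    have h2 := hPsB' x hx
    have h3 := norm_sub_norm_le (P x) (Ps x)
    have h4 : (K + 1) * e ≤ K + 1 := mul_le_of_le_one_right (by linarith) he1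
    simp only [hB]
    linarith
  have hPs'2 : L2Le Ps' B := (L2Le.tailMinusQ hh hhn hK hX.tail_two
    fun j hj => hX.q_two j (hm j hj)).mono hBge
  have hPprim : IsPrimitive Ps Ps' := isPrimitive_tailMinusQ hX.tail_prim
    fun j _ => (qs j).isPrimitive (by norm_num)
  have hs₀ : IsPrimitive ((qs n).D 0) ((qs n).D 1) := (qs n).isPrimitive (by norm_num)
  have hs₁ : IsPrimitive ((qs n).D 1) ((qs n).D 2) := (qs n).isPrimitive (by norm_num)
  have n2 : ‖(2 : ℂ)‖ = 2 := Complex.norm_two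
  have nκ2 : ‖2 * κ ^ 2‖ ≤ 2 * K ^ 2 := by
    rw [norm_mul, norm_pow, n2]
    gcongr
  have nIκ : ‖2 * Complex.I * κ‖ ≤ 2 * K := by
    rw [norm_mul, norm_mul, n2, Complex.norm_I]
    linarith
  have bA : ∀ z : ℂ, ‖z‖ ≤ B → ‖2 * κ ^ 2 * z - 2 * Complex.I * κ‖ ≤ A := fun z hz => by
    refine (norm_sub_le _ _).trans (add_le_add ?_ nIκ)
    rw [norm_mul]
    gcongr
  have haA : CLe a A := fun x hx => by rw [ea]; exact bA _ (hPB x hx)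
  have hasA : CLe as A := fun x hx => by rw [eas]; exact bA _ (hPsB x hx)
  have ham : AEStronglyMeasurable a unitMeasure := aestronglyMeasurable_coeffA hVm
    fun j _ => ((q j).isPrimitive (j := 1) (by norm_num)).meas
  have hdm : AEStronglyMeasurable d unitMeasure := aestronglyMeasurable_rhsD hVm
    fun j _ => ((q j).isPrimitive (j := 1) (by norm_num)).meas
  have hasm : AEStronglyMeasurable as unitMeasure := aestronglyMeasurable_coeffA hX.tail_prim.meas
    fun j _ => ((qs j).isPrimitive (j := 1) (by norm_num)).meas
  have hdsm : AEStronglyMeasurable ds unitMeasure := aestronglyMeasurable_rhsD hX.tail_prim.meas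
    fun j _ => ((qs j).isPrimitive (j := 1) (by norm_num)).meas
  -- The exact `q_n''` is close to the function `ds - as q_n'`, which is bounded in `H¹(0,1)`.
  have hasprim : IsPrimitive as (fun x => 2 * κ ^ 2 * Ps' x) :=
    ((hPprim.const_mul (2 * κ ^ 2)).sub (IsPrimitive.const (2 * Complex.I * κ))).congr
      (fun x _ => (eas x).symm) (fun x _ => by ring)
  have hfprim : IsPrimitive (fun x => ds x - as x * (qs n).D 1 x)
      (fun x => (-4 * κ * Ps x + 2 * Complex.I) * Ps' x
        - ((qs n).D 1 x * (2 * κ ^ 2 * Ps' x) + as x * (qs n).D 2 x)) :=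
    ((((hPprim.mul hPprim).const_mul (-2 * κ)).add (hPprim.const_mul (2 * Complex.I))).sub
      (hasprim.mul hs₁)).congr (fun x _ => by rw [eds]; ring) (fun x _ => by ring)
  have hfF : CLe (fun x => ds x - as x * (qs n).D 1 x) F := fun x hx => by
    have h1 : ‖ds x‖ ≤ 2 * K * B ^ 2 + 2 * B := by
      rw [eds]
      refine (norm_add_le _ _).trans ?_
      rw [norm_mul, norm_mul, norm_mul, norm_mul, norm_pow, norm_neg, n2, Complex.norm_I]
      have := hPsB x hx
      have : 2 * ‖κ‖ * ‖Ps x‖ ^ 2 ≤ 2 * K * B ^ 2 := by gcongr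
      linarith
    have h2 : ‖as x * (qs n).D 1 x‖ ≤ A * K := by
      rw [norm_mul]
      exact mul_le_mul (hasA x hx) (hX.q_one n hn x hx) (norm_nonneg _) hA0
    exact (norm_sub_le _ _).trans (add_le_add h1 h2)
  have hfF' : L2Le (fun x => (-4 * κ * Ps x + 2 * Complex.I) * Ps' x
        - ((qs n).D 1 x * (2 * κ ^ 2 * Ps' x) + as x * (qs n).D 2 x)) F' := by
    have h1 : CLe (fun x => -4 * κ * Ps x + 2 * Complex.I) (4 * K * B + 2) := fun x hx => by
      refine (norm_add_le _ _).trans ?_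
      rw [norm_mul, norm_mul, norm_mul, norm_neg, n2, Complex.norm_I]
      have := hPsB x hx
      have h4 : ‖(4 : ℂ)‖ = 4 := by simp
      rw [h4]
      have : 4 * ‖κ‖ * ‖Ps x‖ ≤ 4 * K * B := by gcongr
      linarith
    have t1 := L2Le.mul ((hPprim.meas.const_mul (-4 * κ)).add aestronglyMeasurable_const) h1 hPs'2
    have t2 := L2Le.mul hs₁.meas (hX.q_one n hn)
      ((hPs'2.const_mul (2 * κ ^ 2)).mono (mul_le_mul_of_nonneg_right nκ2 hB0))
    have t3 := L2Le.mul hasm hasA (hX.q_two n hn)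
    exact t1.sub (t2.add t3)
  have hG := hX.errG_le n hn
  have hKη : K * η ≤ K * e := mul_le_mul_of_nonneg_left hηe (by linarith)
  have hnn : 0 ≤ 2 * K ^ 2 * ((K + 1) * K) * e ∧ 0 ≤ (4 * K * B + 2) * (K + 1) * e ∧ 0 ≤ K * e := by
    refine ⟨?_, ?_, ?_⟩ <;> positivity
  have hC₂e' : C₂ * e = e + K * e + 2 * K ^ 2 * ((K + 1) * K) * e + (4 * K * B + 2) * (K + 1) * e := by
    rw [hC₂]; ring
  have hfs : L2Le (fun x => (qs n).D 2 x - (ds x - as x * (qs n).D 1 x)) (C₂ * e) :=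
    (hG.congr fun x _ => by ring).mono (by rw [hC₂e']; linarith)
  have hda : L2Le (fun x => (qs n).D 1 x * (2 * κ ^ 2 * (P x - Ps x)))
      (2 * K ^ 2 * ((K + 1) * K) * e) := by
    have hPm : AEStronglyMeasurable (fun x => P x - Ps x) unitMeasure :=
      (aestronglyMeasurable_tailMinusQ hVm
        fun j _ => ((q j).isPrimitive (j := 1) (by norm_num)).meas).sub hPprim.meas
    refine (L2Le.mul hs₁.meas (hX.q_one n hn)
      ((L2Le.of_bound hPm hPP).const_mul (2 * κ ^ 2))).mono ?_
    calc K * (‖2 * κ ^ 2‖ * ((K + 1) * e)) ≤ K * (2 * K ^ 2 * ((K + 1) * e)) := by gcongr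
      _ = _ := by ring
  have hdd : L2Le (fun x => d x - ds x) ((4 * K * B + 2) * (K + 1) * e) := by
    refine L2Le.of_bound (hdm.sub hdsm) fun x hx => ?_
    have e1 : d x - ds x = (-2 * κ * (P x + Ps x) + 2 * Complex.I) * (P x - Ps x) := by
      rw [ed, eds]; ring
    rw [e1, norm_mul, mul_assoc (4 * K * B + 2)]
    refine mul_le_mul ?_ (hPP x hx) (norm_nonneg _) (by positivity)
    refine (norm_add_le _ _).trans ?_
    rw [norm_mul, norm_mul, norm_mul, norm_neg, n2, Complex.norm_I]
    have h1 : ‖P x + Ps x‖ ≤ 2 * B := (norm_add_le _ _).trans (by linarith [hPB x hx, hPsB x hx])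
    have : 2 * ‖κ‖ * ‖P x + Ps x‖ ≤ 2 * K * (2 * B) := by gcongr
    linarith
  have hres : L2Le (fun x => (qs n).D 2 x + a x * (qs n).D 1 x + (0 : ℝ → ℂ) x * (qs n).D 0 x - d x)
      (C₂ * e) :=
    (((hG.add hda).sub hdd).congr fun x _ => by
      have e1 : coeffA kmax h (fun j => (qs j).D) T₁ n x = as x := rfl
      have e2 : rhsD kmax h (fun j => (qs j).D) T₁ n x = ds x := rfl
      rw [e1, e2, ea, eas]; simp only [Pi.zero_apply]; ring).mono (by rw [hC₂e']; linarith)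
  have big : ∀ {y : ℝ}, y ≤ K ∨ y ≤ A ∨ y ≤ F ∨ y ≤ F' → y ≤ K + A + F + F' := by
    rintro y (h | h | h | h) <;> linarith
  obtain ⟨r0, r1, r2⟩ := H ((qs n).D 0) ((qs n).D 1) ((qs n).D 2) _ _ a 0 d p₀ p₁ (C₂ * e) (η ^ 2) η
    (q n) (by positivity) hC₂e hs₀ hs₁ (hX.q_end n hn) hfprim
    (fun x hx => big (Or.inr (Or.inr (Or.inl (hfF x hx)))))
    (hfF'.mono (big (Or.inr (Or.inr (Or.inr le_rfl))))) hfs (hp₀.trans hee) (hp₁.trans hee)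
    (big (Or.inl (hX.q_zero n hn 0 (by simp)))) (big (Or.inl (hX.q_one n hn 0 (by simp))))
    (fun x hx => big (Or.inr (Or.inl (haA x hx))))
    (fun x _ => by simp only [Pi.zero_apply, norm_zero]; positivity) ham aestronglyMeasurable_const
    hdm hres rfl hη (hηe.trans hee) hQ
  rw [← mul_assoc] at r0 r1 r2
  exact ⟨r0, r1, r2⟩

/-- The reconstruction of the coefficient: truncation does not increase the error. -/
theorem beta_step (K : ℝ) (hK : 1 ≤ K) : ∃ C : ℝ, 1 ≤ C ∧
    ∀ (c₀ c₁ η kmax h e : ℝ) (N n : ℕ) (c : ℝ → ℝ) (T₁ T₂ : ℝ → ℂ) (qs : ℕ → SobolevFn 2)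
      (q : ℕ → SobolevFn 3) (V' V'' : ℝ → ℂ) (β : ℝ → ℝ),
      ExactData K η kmax h N c T₁ T₂ qs → n ∈ Finset.Icc 1 N → 0 ≤ η → η ≤ e → e ≤ 1 →
      (∀ x, c x ∈ Icc c₀ c₁) → (∀ x, 1 ≤ c x) →
      AEStronglyMeasurable V' unitMeasure → CLe (fun x => V' x - T₁ x) e →
      L2Le (fun x => V'' x - T₂ x) e →
      (∀ j ∈ Finset.Icc 1 n, IsClose (q j) (qs j) e) →
      (∀ x, β x = min (max ‖betaExpr kmax h (fun j => (q j).D) V' V'' n x‖ (c₀ - 1)) (c₁ - 1)) →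
      AEStronglyMeasurable (fun x => (β x : ℂ)) unitMeasure ∧
        L2Le (fun x => ((β x - (c x - 1) : ℝ) : ℂ)) (C * e) := by
  -- `D * e` bounds the error of `v_n'`, and `B` the exact `v_n'`.
  set D : ℝ := 2 * K + 1 with hD
  set B : ℝ := (2 * K + 1) * K with hB
  have hB0 : 0 ≤ B := by positivity
  refine ⟨1 + K + D + (K ^ 2 * (2 * B + D) + 2 * K) * D, ?_, ?_⟩
  · have : 0 ≤ K + D + (K ^ 2 * (2 * B + D) + 2 * K) * D := by positivity
    linarith
  intro c₀ c₁ η kmax h e N n c T₁ T₂ qs q V' V'' β hX hn hη hηe he1 hc hc1 hVm hV hV2 hq hβ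
  have he : 0 ≤ e := hη.trans hηe
  have hn1 : 1 ≤ n := (Finset.mem_Icc.1 hn).1
  have hh := hX.h_nonneg
  have hhn := hX.h_mul_le n hn
  have hhK : h ≤ K := by
    have : h * 1 ≤ h * n := mul_le_mul_of_nonneg_left (by exact_mod_cast hn1) hh
    linarith
  have nh : ‖(h : ℂ)‖ ≤ K := by rwa [Complex.norm_real, Real.norm_of_nonneg hh]
  have hnn : n ∈ Finset.Icc 1 n := by simp [hn1]
  have hmn : ∀ j ∈ Finset.Ico 1 n, j ∈ Finset.Icc 1 n := fun j hj => by
    rw [Finset.mem_Ico] at hj; rw [Finset.mem_Icc]; omega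
  have hm := fun j (hj : j ∈ Finset.Ico 1 n) => mem_Icc_of_mem_Ico hn hj
  have hk := hX.grid_le n hn
  set κ : ℂ := (grid kmax h n : ℂ) with hκ
  set v₁ := vDisc h (fun j => (q j).D) V' n 1 with hv₁
  set v₂ := vDisc h (fun j => (q j).D) V'' n 2 with hv₂
  set s₁ := vDisc h (fun j => (qs j).D) T₁ n 1 with hs₁
  set s₂ := vDisc h (fun j => (qs j).D) T₂ n 2 with hs₂
  set E := betaExpr kmax h (fun j => (q j).D) V' V'' n with hE
  set Es := betaExpr kmax h (fun j => (qs j).D) T₁ T₂ n with hEs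
  have eE : ∀ x, E x = -v₂ x - κ ^ 2 * v₁ x ^ 2 + 2 * Complex.I * κ * v₁ x := fun x => rfl
  have eEs : ∀ x, Es x = -s₂ x - κ ^ 2 * s₁ x ^ 2 + 2 * Complex.I * κ * s₁ x := fun x => rfl
  have hV2m : AEStronglyMeasurable V'' unitMeasure :=
    (hV2.meas.add hX.tail_two.meas).congr (ae_unitMeasure fun x _ => by simp)
  have m1 : ∀ j ∈ Finset.Icc 1 n, AEStronglyMeasurable ((q j).D 1) unitMeasure :=
    fun j _ => ((q j).isPrimitive (j := 1) (by norm_num)).meas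
  have m2 : ∀ j ∈ Finset.Icc 1 n, AEStronglyMeasurable ((q j).D 2) unitMeasure :=
    fun j _ => ((q j).isPrimitive (j := 2) (by norm_num)).meas
  have ms1 : ∀ j ∈ Finset.Icc 1 n, AEStronglyMeasurable ((qs j).D 1) unitMeasure :=
    fun j _ => ((qs j).isPrimitive (j := 1) (by norm_num)).meas
  have hEm : AEStronglyMeasurable E unitMeasure :=
    aestronglyMeasurable_betaExpr hVm hV2m m1 m2 hn1
  have hv₁m : AEStronglyMeasurable v₁ unitMeasure := aestronglyMeasurable_vDisc hVm m1 hn1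
  have hs₁m : AEStronglyMeasurable s₁ unitMeasure :=
    aestronglyMeasurable_vDisc hX.tail_prim.meas ms1 hn1
  have d1 : CLe (fun x => v₁ x - s₁ x) (D * e) := fun x hx => by
    have h1 := tailMinusQ_sub_le (q := fun j => (q j).D) (q' := fun j => (qs j).D) (s := 1)
      hh hhn he hV (fun j hj => (hq j (hmn j hj)).one) x hx
    have h2 : ‖(h : ℂ) * ((q n).D 1 x - (qs n).D 1 x)‖ ≤ K * e := by
      rw [norm_mul]
      exact mul_le_mul nh ((hq n hnn).one x hx) (norm_nonneg _) (by linarith)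
    have e1 : v₁ x - s₁ x = -((h : ℂ) * ((q n).D 1 x - (qs n).D 1 x))
        + (tailMinusQ h (fun j => (q j).D) V' n 1 x - tailMinusQ h (fun j => (qs j).D) T₁ n 1 x) := by
      simp only [hv₁, hs₁, vDisc]; ring
    refine (congrArg norm e1).trans_le ((norm_add_le _ _).trans ?_)
    rw [norm_neg, hD]
    linarith
  have d2 : L2Le (fun x => v₂ x - s₂ x) (D * e) := by
    have h1 := L2Le.tailMinusQ_sub (q := fun j => (q j).D) (q' := fun j => (qs j).D) (s := 2)
      hh hhn he hV2 (fun j hj => (hq j (hmn j hj)).two)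
    have h2 : L2Le (fun x => (h : ℂ) * ((q n).D 2 x - (qs n).D 2 x)) (K * e) :=
      ((hq n hnn).two.const_mul _).mono (mul_le_mul_of_nonneg_right nh he)
    refine ((h2.neg.add h1).congr fun x _ => ?_).mono (by rw [hD]; linarith)
    simp only [hv₂, hs₂, vDisc]; ring
  have b1 : CLe s₁ B := fun x hx => by
    have h1 := tailMinusQ_le (q := fun j => (qs j).D) (s := 1) hh hhn hK hX.tail_one
      (fun j hj => hX.q_one j (hm j hj)) x hx
    have h2 : ‖(h : ℂ) * (qs n).D 1 x‖ ≤ K * K := by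
      rw [norm_mul]
      exact mul_le_mul nh (hX.q_one n hn x hx) (norm_nonneg _) (by linarith)
    simp only [hs₁, vDisc]
    refine (norm_add_le _ _).trans ?_
    rw [norm_neg, hB]
    linarith
  have dsq : CLe (fun x => -(κ ^ 2 * (v₁ x + s₁ x)) + 2 * Complex.I * κ)
      (K ^ 2 * (2 * B + D) + 2 * K) := fun x hx => by
    have h1 : ‖v₁ x + s₁ x‖ ≤ 2 * B + D := by
      have e1 : v₁ x + s₁ x = (v₁ x - s₁ x) + 2 * s₁ x := by ring
      rw [e1]
      refine (norm_add_le _ _).trans ?_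
      rw [norm_mul, Complex.norm_two]
      have h2 : D * e ≤ D := mul_le_of_le_one_right (by linarith) he1
      linarith [d1 x hx, b1 x hx]
    refine (norm_add_le _ _).trans (add_le_add ?_ ?_)
    · rw [norm_neg, norm_mul, norm_pow]
      gcongr
    · rw [norm_mul, norm_mul, Complex.norm_two, Complex.norm_I]
      linarith
  have hdE : L2Le (fun x => E x - Es x) (D * e + (K ^ 2 * (2 * B + D) + 2 * K) * (D * e)) := by
    have t := L2Le.mul ((((hv₁m.add hs₁m).const_mul (κ ^ 2)).neg).add aestronglyMeasurable_const)
      dsq (L2Le.of_bound (hv₁m.sub hs₁m) d1)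
    refine (d2.neg.add t).congr fun x _ => ?_
    simp only [Pi.add_apply, Pi.neg_apply, Pi.sub_apply]
    rw [eE, eEs]; ring
  have hKη : K * η ≤ K * e := mul_le_mul_of_nonneg_left hηe (by linarith)
  have hEβ := hdE.sub (hX.errF_le n hn)
  have hβm : AEStronglyMeasurable (fun x => (β x : ℂ)) unitMeasure := by
    have h1 : AEStronglyMeasurable (fun x => min (max ‖E x‖ (c₀ - 1)) (c₁ - 1)) unitMeasure :=
      (hEm.norm.sup aestronglyMeasurable_const).inf aestronglyMeasurable_const
    refine (Complex.continuous_ofReal.comp_aestronglyMeasurable h1).congr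
      (ae_unitMeasure fun x _ => ?_)
    simp only [hβ x]
  -- The exact coefficient is measurable, being the sum of two measurable functions.
  have hcm : AEStronglyMeasurable (fun x => ((c x - 1 : ℝ) : ℂ)) unitMeasure := by
    have ms2 : ∀ j ∈ Finset.Icc 1 n, AEStronglyMeasurable ((qs j).D 2) unitMeasure :=
      fun j hj => (hX.q_two j (mem_Icc_of_mem_Icc hn hj)).meas
    refine ((hX.errF_le n hn).meas.add (aestronglyMeasurable_betaExpr (kmax := kmax) (h := h)
      hX.tail_prim.meas
      hX.tail_two.meas ms1 ms2 hn1)).congr (ae_unitMeasure fun x _ => ?_)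
    simp only [Pi.add_apply]
    ring
  refine ⟨hβm, ?_⟩
  refine (hEβ.of_le_mul zero_le_one ((hβm.sub hcm).congr (ae_unitMeasure fun x _ => by
    simp)) fun x hx => ?_).mono ?_
  · rw [Complex.norm_real, Real.norm_eq_abs, one_mul]
    have hcx := hc x
    have e1 : c x - 1 = min (max (c x - 1) (c₀ - 1)) (c₁ - 1) := by
      rw [max_eq_left (by linarith [hcx.1]), min_eq_left (by linarith [hcx.2])]
    have e2 : ‖((c x - 1 : ℝ) : ℂ)‖ = c x - 1 := by
      rw [Complex.norm_real, Real.norm_of_nonneg (by linarith [hc1 x])]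
    have e3 : |‖E x‖ - (c x - 1)| ≤ ‖E x - ((c x - 1 : ℝ) : ℂ)‖ := by
      have := abs_norm_sub_norm_le (E x) ((c x - 1 : ℝ) : ℂ)
      rwa [e2] at this
    have e4 : |β x - (c x - 1)| ≤ |‖E x‖ - (c x - 1)| := by
      rw [hβ x]
      nth_rewrite 1 [e1]
      exact (abs_min_sub_min_le_max _ _ _ _).trans (by
        rw [sub_self, abs_zero, max_eq_left (abs_nonneg _)]
        exact (abs_max_sub_max_le_max _ _ _ _).trans (by
          rw [sub_self, abs_zero, max_eq_left (abs_nonneg _)]))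
    refine e4.trans (e3.trans (le_of_eq ?_))
    congr 1
    ring
  · linarith

/-- The equation for `w_n`. The competitor is built from `f = 0`, since the exact `w''` is small. -/
theorem w_step (K : ℝ) (hK : 1 ≤ K) : ∃ C : ℝ, 1 ≤ C ∧
    ∀ (η k e x₀ : ℝ) (c : ℝ → ℝ) (u : ℝ → ℝ → ℂ) (W : ℝ → ℂ) (β : ℝ → ℝ) (g : ℂ) (w : SobolevFn 3),
      1 ≤ k → k ≤ K → x₀ < 0 → 0 ≤ η → η ≤ e → C * e ≤ 1 → IsNormalizedField c x₀ k u W →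
      CLe W (3 / 2) → CLe (deriv W) K → L2Le (deriv (deriv W)) e → (∀ x, |β x| ≤ K) →
      AEStronglyMeasurable (fun x => (β x : ℂ)) unitMeasure →
      L2Le (fun x => ((β x - (c x - 1) : ℝ) : ℂ)) e → ‖g - W 0‖ ≤ η →
      IsQRMSolution (η ^ 2) (fun _ => -2 * Complex.I * k) (fun x => (k : ℂ) ^ 2 * β x) 0
        g (2 * Complex.I * k * (g - 1)) w →
      CLe (fun x => w.D 0 x - W x) (C * e) ∧ CLe (fun x => w.D 1 x - deriv W x) (C * e) ∧
        L2Le (fun x => w.D 2 x - deriv (deriv W) x) (C * e) := by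
  obtain ⟨C₁, hC₁, H⟩ := qrm_stability (2 * K + K ^ 3 + 2) (by positivity)
  set C₂ : ℝ := 2 * K + K ^ 2 * (3 / 2) with hC₂
  have hC₂1 : 1 ≤ C₂ := by
    have : 0 ≤ K ^ 2 * (3 / 2) := by positivity
    linarith
  refine ⟨C₁ * C₂, one_le_mul_of_one_le_of_one_le hC₁ hC₂1, ?_⟩
  intro η k e x₀ c u W β g w hk1 hkK hx₀ hη hηe hCe hW hW0 hW1 hW2 hβ hβm hβe hg hQ
  have he : 0 ≤ e := hη.trans hηe
  have hC₂e : C₂ * e ≤ 1 := by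
    refine le_trans ?_ hCe
    rw [mul_assoc]
    exact le_mul_of_one_le_left (by positivity) hC₁
  have hee : e ≤ C₂ * e := le_mul_of_one_le_left he hC₂1
  have nk : ‖(k : ℂ)‖ = k := by rw [Complex.norm_real, Real.norm_of_nonneg (by linarith)]
  have hC₂e' : C₂ * e = 2 * K * e + K ^ 2 * (3 / 2) * e := by rw [hC₂]; ring
  have hpos : 0 ≤ K * e ∧ 0 ≤ K ^ 2 * (3 / 2) * e := ⟨by positivity, by positivity⟩
  have hWm : AEStronglyMeasurable W unitMeasure :=
    aestronglyMeasurable_of_continuousOn hW.contDiff.continuous.continuousOn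
  have hs₀ : IsPrimitive W (deriv W) := IsPrimitive.of_hasDerivAt (fun x _ => hW.hasDerivAt x)
    hW.contDiff_deriv.continuous.continuousOn
  have hs₁ : IsPrimitive (deriv W) (deriv (deriv W)) :=
    IsPrimitive.of_hasDerivAt (fun x _ => hW.hasDerivAt_deriv x)
      hW.continuous_deriv_deriv.continuousOn
  have hres : L2Le (fun x => deriv (deriv W) x + (-2 * Complex.I * k) * deriv W x
      + (k : ℂ) ^ 2 * β x * W x - (0 : ℝ → ℂ) x) (C₂ * e) := by
    refine (((L2Le.mul hWm hW0 hβe).const_mul ((k : ℂ) ^ 2)).congr fun x hx => ?_).mono ?_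
    · have := hW.ode x (by linarith [hx.1])
      push_cast at this ⊢
      simp only [Pi.zero_apply]
      linear_combination -this
    · rw [norm_pow, nk]
      calc k ^ 2 * (3 / 2 * e) ≤ K ^ 2 * (3 / 2 * e) := by gcongr
        _ ≤ C₂ * e := by rw [hC₂e']; linarith
  have hp₁ : ‖2 * Complex.I * k * (g - 1) - deriv W 0‖ ≤ C₂ * e := by
    have e1 : 2 * Complex.I * k * (g - 1) - deriv W 0 = 2 * Complex.I * k * (g - W 0) := by
      rw [hW.deriv_zero]; ring
    rw [e1, norm_mul, norm_mul, norm_mul, Complex.norm_two, Complex.norm_I, nk]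
    calc 2 * 1 * k * ‖g - W 0‖ ≤ 2 * 1 * K * e := by gcongr; exact hg.trans hηe
      _ ≤ C₂ * e := by rw [hC₂e']; linarith
  have hK3 : 0 ≤ K ^ 3 := by positivity
  have zero : L2Le (fun _ => (0 : ℂ)) (2 * K + K ^ 3 + 2) :=
    L2Le.of_bound aestronglyMeasurable_const fun _ _ => by simp; positivity
  obtain ⟨r0, r1, r2⟩ := H W (deriv W) (deriv (deriv W)) (fun _ => 0) (fun _ => 0)
    (fun _ => -2 * Complex.I * k) (fun x => (k : ℂ) ^ 2 * β x) 0 g (2 * Complex.I * k * (g - 1))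
    (C₂ * e) (η ^ 2) η w (by positivity) hC₂e hs₀ hs₁ (hW.deriv_eq_zero 1 le_rfl)
    (IsPrimitive.const 0) (fun _ _ => by simp; positivity) zero
    ((hW2.congr fun x _ => by ring).mono hee) ((hg.trans hηe).trans hee) hp₁
    ((hW0 0 (by simp)).trans (by linarith)) ((hW1 0 (by simp)).trans (by linarith))
    (fun x _ => by
      rw [norm_mul, norm_mul, norm_neg, Complex.norm_two, Complex.norm_I, nk]
      linarith)
    (fun x _ => by
      rw [norm_mul, norm_pow, nk, Complex.norm_real, Real.norm_eq_abs]
      have : k ^ 2 * |β x| ≤ K ^ 2 * K := by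
        gcongr
        exact hβ x
      have e3 : K ^ 2 * K = K ^ 3 := by ring
      linarith)
    aestronglyMeasurable_const (hβm.const_mul _) aestronglyMeasurable_const hres rfl hη
    (hηe.trans hee) hQ
  rw [← mul_assoc] at r0 r1 r2
  exact ⟨r0, r1, r2⟩

/-- The logarithmic derivatives of `w` depend on `w` in a Lipschitz way as long as `w` stays away from
zero. -/
theorem tail_update (K : ℝ) (hK : 1 ≤ K) : ∃ C : ℝ, 1 ≤ C ∧
    ∀ (k e : ℝ) (W₀ W₁ W₂ : ℝ → ℂ) (w : SobolevFn 3), 1 ≤ k → 0 ≤ e → e ≤ 1 →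
      ContinuousOn W₀ (Icc 0 1) → ContinuousOn W₁ (Icc 0 1) →
      (∀ x ∈ Icc (0 : ℝ) 1, W₀ x ≠ 0 ∧ ‖(W₀ x)⁻¹‖ ≤ K) →
      (∀ x ∈ Icc (0 : ℝ) 1, w.D 0 x ≠ 0 ∧ ‖(w.D 0 x)⁻¹‖ ≤ K) → CLe W₁ K → L2Le W₂ K →
      CLe (fun x => w.D 0 x - W₀ x) e → CLe (fun x => w.D 1 x - W₁ x) e →
      L2Le (fun x => w.D 2 x - W₂ x) e →
      CLe (fun x => w.D 1 x / ((k : ℂ) ^ 2 * w.D 0 x) - W₁ x / ((k : ℂ) ^ 2 * W₀ x)) (C * e) ∧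
      L2Le (fun x => w.D 2 x / ((k : ℂ) ^ 2 * w.D 0 x) - w.D 1 x ^ 2 / ((k : ℂ) ^ 2 * w.D 0 x ^ 2)
        - (W₂ x / ((k : ℂ) ^ 2 * W₀ x) - W₁ x ^ 2 / ((k : ℂ) ^ 2 * W₀ x ^ 2))) (C * e) := by
  set A : ℝ := K + K ^ 3 with hA
  set B : ℝ := (2 * K + 1) * K with hB
  have hA0 : 0 ≤ A := by positivity
  have hB0 : 0 ≤ B := by positivity
  refine ⟨A + A + A * B, ?_, ?_⟩
  · have : 0 ≤ K ^ 3 ∧ 0 ≤ A * B := ⟨by positivity, by positivity⟩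
    linarith
  intro k e W₀ W₁ W₂ w hk he he1 hW₀c hW₁c hW₀ hw₀ hW₁ hW₂ d0 d1 d2
  have hk0 : (k : ℂ) ≠ 0 := by exact_mod_cast (by linarith : (0 : ℝ) < k).ne'
  have nρ : ‖((k : ℂ) ^ 2)⁻¹‖ ≤ 1 := by
    rw [norm_inv, norm_pow, Complex.norm_real, Real.norm_of_nonneg (by linarith)]
    exact inv_le_one_of_one_le₀ (one_le_pow₀ hk)
  have w0c := (w.isPrimitive (j := 0) (by norm_num)).continuousOn
  have w1c := (w.isPrimitive (j := 1) (by norm_num)).continuousOn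
  -- The errors of `1 / w` and of `w' / w`.
  set ι : ℝ → ℂ := fun x => (w.D 0 x)⁻¹ - (W₀ x)⁻¹ with hι
  have hιle : CLe ι (K ^ 2 * e) := fun x hx => by
    obtain ⟨h1, h2⟩ := hW₀ x hx
    obtain ⟨h3, h4⟩ := hw₀ x hx
    have e1 : ι x = -((w.D 0 x)⁻¹ * (W₀ x)⁻¹ * (w.D 0 x - W₀ x)) := by
      simp only [hι]; field_simp; ring
    rw [e1, norm_neg, norm_mul, norm_mul]
    calc _ ≤ K * K * e := by gcongr; exact d0 x hx
      _ = K ^ 2 * e := by ring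
  have ιm : AEStronglyMeasurable ι unitMeasure := aestronglyMeasurable_of_continuousOn
    ((w0c.inv₀ fun x hx => (hw₀ x hx).1).sub (hW₀c.inv₀ fun x hx => (hW₀ x hx).1))
  have im : AEStronglyMeasurable (fun x => (w.D 0 x)⁻¹) unitMeasure :=
    aestronglyMeasurable_of_continuousOn (w0c.inv₀ fun x hx => (hw₀ x hx).1)
  set τ : ℝ → ℂ := fun x => w.D 1 x * (w.D 0 x)⁻¹ - W₁ x * (W₀ x)⁻¹ with hτ
  have hτle : CLe τ (A * e) := fun x hx => by
    have e1 : τ x = (w.D 1 x - W₁ x) * (w.D 0 x)⁻¹ + W₁ x * ι x := by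
      simp only [hτ, hι]; ring
    rw [e1]
    refine (norm_add_le _ _).trans ?_
    rw [norm_mul, norm_mul]
    have h1 : ‖w.D 1 x - W₁ x‖ * ‖(w.D 0 x)⁻¹‖ ≤ e * K :=
      mul_le_mul (d1 x hx) (hw₀ x hx).2 (norm_nonneg _) he
    have h2 : ‖W₁ x‖ * ‖ι x‖ ≤ K * (K ^ 2 * e) :=
      mul_le_mul (hW₁ x hx) (hιle x hx) (norm_nonneg _) (by linarith)
    have e2 : A * e = e * K + K * (K ^ 2 * e) := by rw [hA]; ring
    linarith
  have τm : AEStronglyMeasurable τ unitMeasure := aestronglyMeasurable_of_continuousOn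
    ((w1c.mul (w0c.inv₀ fun x hx => (hw₀ x hx).1)).sub
      (hW₁c.mul (hW₀c.inv₀ fun x hx => (hW₀ x hx).1)))
  have hAB : 0 ≤ A * e ∧ 0 ≤ A * B * e := ⟨by positivity, by positivity⟩
  have hC : (A + A + A * B) * e = A * e + A * e + A * B * e := by ring
  constructor
  · intro x hx
    have e1 : w.D 1 x / ((k : ℂ) ^ 2 * w.D 0 x) - W₁ x / ((k : ℂ) ^ 2 * W₀ x) =
        ((k : ℂ) ^ 2)⁻¹ * τ x := by
      simp only [hτ, div_eq_mul_inv, mul_inv]; ring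
    refine (congrArg norm e1).trans_le ?_
    rw [norm_mul]
    have : ‖((k : ℂ) ^ 2)⁻¹‖ * ‖τ x‖ ≤ 1 * (A * e) :=
      mul_le_mul nρ (hτle x hx) (norm_nonneg _) zero_le_one
    rw [hC]
    linarith
  · set σ : ℝ → ℂ := fun x => w.D 1 x * (w.D 0 x)⁻¹ + W₁ x * (W₀ x)⁻¹ with hσ
    have hσle : CLe σ B := fun x hx => by
      refine (norm_add_le _ _).trans ?_
      rw [norm_mul, norm_mul]
      have h0 : ‖w.D 1 x‖ ≤ K + 1 := by
        have := norm_sub_norm_le (w.D 1 x) (W₁ x)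
        linarith [d1 x hx, hW₁ x hx]
      have h1 : ‖w.D 1 x‖ * ‖(w.D 0 x)⁻¹‖ ≤ (K + 1) * K :=
        mul_le_mul h0 (hw₀ x hx).2 (norm_nonneg _) (by linarith)
      have h2 : ‖W₁ x‖ * ‖(W₀ x)⁻¹‖ ≤ K * K :=
        mul_le_mul (hW₁ x hx) (hW₀ x hx).2 (norm_nonneg _) (by linarith)
      rw [hB]
      linarith
    have σm : AEStronglyMeasurable σ unitMeasure := aestronglyMeasurable_of_continuousOn
      ((w1c.mul (w0c.inv₀ fun x hx => (hw₀ x hx).1)).add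
        (hW₁c.mul (hW₀c.inv₀ fun x hx => (hW₀ x hx).1)))
    have t1 := L2Le.mul im (fun x hx => (hw₀ x hx).2) d2
    have t2 := L2Le.mul ιm hιle hW₂
    have t3 := L2Le.mul σm hσle (L2Le.of_bound τm hτle)
    have t4 := ((t1.add t2).sub t3).const_mul (((k : ℂ) ^ 2)⁻¹)
    refine (t4.congr fun x hx => ?_).mono ?_
    · simp only [hτ, hι, hσ, div_eq_mul_inv, mul_inv]; ring
    · have h0 : 0 ≤ K * e + K ^ 2 * e * K + B * (A * e) := by positivity
      have h1 := mul_le_mul_of_nonneg_right nρ h0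
      have e2 : A * e = K * e + K ^ 2 * e * K := by rw [hA]; ring
      rw [hC]
      linarith

/-- The initial tail. The competitor is built from `f = 0`, since the second derivative of the exact
tail is small. -/
theorem initial_tail (K : ℝ) (hK : 1 ≤ K) : ∃ C : ℝ, 1 ≤ C ∧
    ∀ (c₀ c₁ δ k e x₀ : ℝ) (c : ℝ → ℝ) (u : ℝ → ℝ → ℂ) (W : ℝ → ℂ) (g l : ℂ) (V₀ : SobolevFn 3),
      1 ≤ k → x₀ < 0 → 0 ≤ δ → δ ≤ e → C * e ≤ 1 → IsAdmissible c₀ c₁ c → (∀ x, 1 ≤ c x) →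
      IsNormalizedField c x₀ k u W →
      (∀ x ∈ Icc (0 : ℝ) 1, ‖highFreqFactor c x₀ u x k - 1‖ < 1 / 2) →
      CLe (logDeriv₁ k W) K → L2Le (logDeriv₂ k W) e →
      ‖g - W 0‖ ≤ δ → ‖l - logHigh c x₀ u 0 k‖ ≤ δ →
      IsQRMSolution (δ ^ 2) 0 0 0 (l / (k : ℂ) ^ 2)
        (2 * Complex.I * k * (g - 1) / ((k : ℂ) ^ 2 * g)) V₀ →
      CLe (fun x => V₀.D 1 x - logDeriv₁ k W x) (C * e) ∧
        L2Le (fun x => V₀.D 2 x - logDeriv₂ k W x) (C * e) := by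
  obtain ⟨C₁, hC₁, H⟩ := qrm_stability (K + 5) (by positivity)
  refine ⟨C₁ * 16, by linarith, ?_⟩
  intro c₀ c₁ δ k e x₀ c u W g l V₀ hk1 hx₀ hδ hδe hCe hc hc1 hW hR hV1 hV2 hg hl hQ
  have he : 0 ≤ e := hδ.trans hδe
  have h16 : 16 * e ≤ 1 := by
    refine le_trans ?_ hCe
    rw [mul_assoc]
    exact le_mul_of_one_le_left (by positivity) hC₁
  have hee : e ≤ 16 * e := by linarith
  have hk0 : 0 < k := by linarith
  have hkC : (k : ℂ) ≠ 0 := by exact_mod_cast hk0.ne'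
  have nk : ‖(k : ℂ)‖ = k := by rw [Complex.norm_real, Real.norm_of_nonneg hk0.le]
  have h0m : (0 : ℝ) ∈ Icc (0 : ℝ) 1 := by simp
  have hev := fun x (hx : x ∈ Icc (0 : ℝ) 1) =>
    (hW.eventually_hasDerivAt_vField hc hc1 hk0 le_rfl (by linarith [hx.1]) (hR x hx)).self_of_nhds
  have hs₁ := hW.isPrimitive_logDeriv₁ hk0 fun x hx => (hev x hx).1
  have hs₀ := IsPrimitive.of_hasDerivAt (fun x hx => (hev x hx).2) hs₁.continuousOn
  obtain ⟨hw1, hlog⟩ := norm_logHigh_zero_le hc hx₀ (hR 0 h0m)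
  rw [hW.eq_wField 0 hx₀.le] at hw1
  have hv0 : vField c x₀ k u 0 k = logHigh c x₀ u 0 k / (k : ℂ) ^ 2 := by simp [vField, logW]
  have hdivk : ∀ z : ℂ, ‖z / (k : ℂ) ^ 2‖ ≤ ‖z‖ := fun z => by
    rw [norm_div, norm_pow, nk]
    exact div_le_self (norm_nonneg _) (one_le_pow₀ hk1)
  have hp₀ : ‖l / (k : ℂ) ^ 2 - vField c x₀ k u 0 k‖ ≤ 16 * e := by
    rw [hv0, ← sub_div]
    exact (hdivk _).trans (hl.trans (hδe.trans hee))
  have hW0 : 1 / 2 ≤ ‖W 0‖ := by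
    have := norm_sub_norm_le (1 : ℂ) (W 0)
    rw [norm_one, norm_sub_rev] at this
    linarith
  have hg0 : 1 / 4 ≤ ‖g‖ := by
    have := norm_sub_norm_le (W 0) g
    rw [norm_sub_rev] at this
    linarith
  have hp₁ : ‖2 * Complex.I * k * (g - 1) / ((k : ℂ) ^ 2 * g) - logDeriv₁ k W 0‖ ≤ 16 * e := by
    have g0 : g ≠ 0 := norm_pos_iff.1 (by linarith)
    have W0 : W 0 ≠ 0 := norm_pos_iff.1 (by linarith)
    have e1 : 2 * Complex.I * k * (g - 1) / ((k : ℂ) ^ 2 * g) - logDeriv₁ k W 0 =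
        2 * Complex.I * (g - W 0) / (k * g * W 0) := by
      rw [logDeriv₁, hW.deriv_zero]
      field_simp
      ring
    rw [e1, norm_div, norm_mul, norm_mul, norm_mul, norm_mul, Complex.norm_two, Complex.norm_I, nk]
    have h1 : 1 / 8 ≤ k * ‖g‖ * ‖W 0‖ := by
      calc (1 : ℝ) / 8 = 1 * (1 / 4) * (1 / 2) := by norm_num
        _ ≤ k * ‖g‖ * ‖W 0‖ := by gcongr
    rw [div_le_iff₀ (by linarith)]
    have h2 : 16 * e * (1 / 8) ≤ 16 * e * (k * ‖g‖ * ‖W 0‖) :=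
      mul_le_mul_of_nonneg_left h1 (by linarith)
    linarith
  have zero : L2Le (fun _ => (0 : ℂ)) (K + 5) :=
    L2Le.of_bound aestronglyMeasurable_const fun _ _ => by simp; positivity
  obtain ⟨-, r1, r2⟩ := H (fun y => vField c x₀ k u y k) (logDeriv₁ k W) (logDeriv₂ k W)
    (fun _ => 0) (fun _ => 0) 0 0 0 _ _ (16 * e) (δ ^ 2) δ V₀ (by positivity) h16 hs₀ hs₁
    (by simp [logDeriv₁, hW.deriv_eq_zero 1 le_rfl]) (IsPrimitive.const 0)
    (fun _ _ => by simp; positivity) zero ((hV2.congr fun x _ => by ring).mono hee) hp₀ hp₁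
    (by rw [hv0]; exact (hdivk _).trans (hlog.trans (by linarith)))
    ((hV1 0 h0m).trans (by linarith)) (fun _ _ => by simp; positivity)
    (fun _ _ => by simp; positivity) aestronglyMeasurable_const aestronglyMeasurable_const
    aestronglyMeasurable_const ((hV2.congr fun x _ => by simp).mono hee) rfl hδ
    (hδe.trans hee) hQ
  rw [← mul_assoc] at r1 r2
  exact ⟨r1, r2⟩

/-- The second derivative of the exact field is as small as the derivatives of the exact tail. -/
theorem IsNormalizedField.second_deriv_le {c : ℝ → ℝ} {x₀ k K ε : ℝ} {u : ℝ → ℝ → ℂ} {W : ℝ → ℂ}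
    (hW : IsNormalizedField c x₀ k u W) (hk1 : 1 ≤ k) (hkK : k ≤ K)
    (h0 : ∀ x ∈ Icc (0 : ℝ) 1, W x ≠ 0) (hWb : CLe W (3 / 2)) (hV1 : CLe (logDeriv₁ k W) K)
    (hV1' : CLe (logDeriv₁ k W) ε) (hV2 : L2Le (logDeriv₂ k W) ε) :
    L2Le (deriv (deriv W)) (K ^ 2 * (3 / 2) * (1 + K ^ 3) * ε) := by
  have hk0 : 0 < k := by linarith
  have hkC : (k : ℂ) ≠ 0 := by exact_mod_cast hk0.ne'
  have nk : ‖(k : ℂ)‖ = k := by rw [Complex.norm_real, Real.norm_of_nonneg hk0.le]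
  have hε := hV2.nonneg
  have hK0 : 0 < K := by linarith
  have m1 := (hW.isPrimitive_logDeriv₁ hk0 h0).meas
  have hWm : AEStronglyMeasurable W unitMeasure :=
    aestronglyMeasurable_of_continuousOn hW.contDiff.continuous.continuousOn
  have t1 := (L2Le.mul m1 hV1 (L2Le.of_bound m1 hV1')).const_mul ((k : ℂ) ^ 2)
  have t2 := (L2Le.mul hWm hWb (hV2.add t1)).const_mul ((k : ℂ) ^ 2)
  refine (t2.congr fun x hx => ?_).mono ?_
  · have := h0 x hx
    simp only [logDeriv₁, logDeriv₂]
    field_simp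
    ring
  · rw [norm_pow, nk]
    calc k ^ 2 * (3 / 2 * (ε + k ^ 2 * (K * ε))) ≤ K ^ 2 * (3 / 2 * (ε + K ^ 2 * (K * ε))) := by
          gcongr
      _ = _ := by ring

/-- One full step of the algorithm multiplies the error by at most a constant. -/
theorem algorithm_step (K : ℝ) (hK : 1 ≤ K) (C₀ : ℝ) (hC₀ : 1 ≤ C₀) : ∃ C : ℝ, 1 ≤ C ∧
    ∀ (c₀ c₁ η kmax h e x₀ : ℝ) (N n : ℕ) (c : ℝ → ℝ) (u : ℝ → ℝ → ℂ) (W T₁ T₂ : ℝ → ℂ)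
      (qs : ℕ → SobolevFn 2) (q : ℕ → SobolevFn 3) (V' V'' : ℝ → ℂ) (β : ℝ → ℝ) (p₀ p₁ g : ℂ)
      (w : SobolevFn 3),
      ExactData K η kmax h N c T₁ T₂ qs → n ∈ Finset.Icc 1 N → 1 ≤ kmax → kmax ≤ K → x₀ < 0 →
      0 ≤ η → η ≤ e → C * e ≤ 1 / (4 * c₁ ^ (1 / 4 : ℝ)) → 0 < c₀ → c₁ ≤ K →
      4 * c₁ ^ (1 / 4 : ℝ) ≤ K → IsAdmissible c₀ c₁ c → (∀ x, 1 ≤ c x) →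
      IsNormalizedField c x₀ kmax u W →
      (∀ x ∈ Icc (0 : ℝ) 1, ‖highFreqFactor c x₀ u x kmax - 1‖ < 1 / 2) →
      (∀ x ∈ Icc (0 : ℝ) 1, T₁ x = logDeriv₁ kmax W x ∧ T₂ x = logDeriv₂ kmax W x) →
      CLe (deriv W) K → L2Le (deriv (deriv W)) K → L2Le (deriv (deriv W)) (C₀ * η) →
      AEStronglyMeasurable V' unitMeasure → CLe (fun x => V' x - T₁ x) (C₀ * e) →
      L2Le (fun x => V'' x - T₂ x) (C₀ * e) → (∀ j ∈ Finset.Ico 1 n, IsClose (q j) (qs j) e) →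
      ‖p₀ - (qs n).D 0 0‖ ≤ η → ‖p₁ - (qs n).D 1 0‖ ≤ η →
      IsQRMSolution (η ^ 2) (coeffA kmax h (fun j => (q j).D) V' n) 0
        (rhsD kmax h (fun j => (q j).D) V' n) p₀ p₁ (q n) →
      (∀ x, β x = min (max ‖betaExpr kmax h (fun j => (q j).D) V' V'' n x‖ (c₀ - 1)) (c₁ - 1)) →
      ‖g - W 0‖ ≤ η →
      IsQRMSolution (η ^ 2) (fun _ => -2 * Complex.I * kmax) (fun x => (kmax : ℂ) ^ 2 * β x) 0
        g (2 * Complex.I * kmax * (g - 1)) w →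
      L2Le (fun x => ((β x - (c x - 1) : ℝ) : ℂ)) (C * e) ∧ IsClose (q n) (qs n) (C * e / 2) ∧
      (∀ x ∈ Icc (0 : ℝ) 1, w.D 0 x ≠ 0) ∧
      AEStronglyMeasurable (fun x => w.D 1 x / ((kmax : ℂ) ^ 2 * w.D 0 x)) unitMeasure ∧
      CLe (fun x => w.D 1 x / ((kmax : ℂ) ^ 2 * w.D 0 x) - T₁ x) (C * e) ∧
      L2Le (fun x => w.D 2 x / ((kmax : ℂ) ^ 2 * w.D 0 x)
        - w.D 1 x ^ 2 / ((kmax : ℂ) ^ 2 * w.D 0 x ^ 2) - T₂ x) (C * e) := by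
  obtain ⟨Cq, hCq, Hq⟩ := q_step K hK
  obtain ⟨Cβ, hCβ, Hβ⟩ := beta_step K hK
  obtain ⟨Cw, hCw, Hw⟩ := w_step (K + 1) (by linarith)
  obtain ⟨Cu, hCu, Hu⟩ := tail_update K hK
  refine ⟨2 * (Cu * (Cw * (Cβ * (Cq * C₀)))), ?_, ?_⟩
  · have := one_le_mul_of_one_le_of_one_le hCu (one_le_mul_of_one_le_of_one_le hCw
      (one_le_mul_of_one_le_of_one_le hCβ (one_le_mul_of_one_le_of_one_le hCq hC₀)))
    linarith
  intro c₀ c₁ η kmax h e x₀ N n c u W T₁ T₂ qs q V' V'' β p₀ p₁ g w hX hn hk1 hkK hx₀ hη hηe hsmall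
    hc₀ hc₁K hc₁K' hc hc1 hW hR hT hW1 hW2K hW2 hVm hV1 hV2 hq hp₀ hp₁ hQ hβ hg hQw
  have he : 0 ≤ e := hη.trans hηe
  -- The errors after the successive parts of the step.
  set ea := C₀ * e with hea
  set eb := Cq * ea with heb
  set ec := Cβ * eb with hec
  set ed := Cw * ec with hed
  set ef := Cu * ed with hef
  have e_ea : e ≤ ea := le_mul_of_one_le_left he hC₀
  have ea0 : 0 ≤ ea := he.trans e_ea
  have ea_eb : ea ≤ eb := le_mul_of_one_le_left ea0 hCq
  have eb0 : 0 ≤ eb := ea0.trans ea_eb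
  have eb_ec : eb ≤ ec := le_mul_of_one_le_left eb0 hCβ
  have ec0 : 0 ≤ ec := eb0.trans eb_ec
  have ec_ed : ec ≤ ed := le_mul_of_one_le_left ec0 hCw
  have ed0 : 0 ≤ ed := ec0.trans ec_ed
  have ed_ef : ed ≤ ef := le_mul_of_one_le_left ed0 hCu
  have hCe : 2 * (Cu * (Cw * (Cβ * (Cq * C₀)))) * e = 2 * ef := by
    simp only [hef, hed, hec, heb, hea]; ring
  rw [hCe] at hsmall ⊢
  have hc₁1 : 1 ≤ c₁ := (hc1 0).trans (hc.mem_Icc 0).2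
  have hr1 : 1 ≤ c₁ ^ (1 / 4 : ℝ) := Real.one_le_rpow hc₁1 (by norm_num)
  have hef1 : ef ≤ 1 / (4 * c₁ ^ (1 / 4 : ℝ)) := by linarith
  have hef2 : ef ≤ 1 := hef1.trans (by
    rw [div_le_one (by linarith)]; linarith)
  have hb := fun x (hx : x ∈ Icc (0 : ℝ) 1) => hW.norm_bounds hc hc1 (by linarith [hx.1]) (hR x hx)
  have hqn : IsClose (q n) (qs n) eb :=
    Hq η kmax h ea N n c T₁ T₂ qs q V' p₀ p₁ hX hn hη (hηe.trans e_ea) (by linarith) hVm hV1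
      (fun j hj => (hq j hj).mono e_ea) (hp₀.trans (hηe.trans e_ea))
      (hp₁.trans (hηe.trans e_ea)) hQ
  have hqj : ∀ j ∈ Finset.Icc 1 n, IsClose (q j) (qs j) eb := fun j hj => by
    rcases eq_or_ne j n with rfl | hjn
    · exact hqn
    · refine (hq j ?_).mono (e_ea.trans ea_eb)
      rw [Finset.mem_Icc] at hj
      rw [Finset.mem_Ico]
      omega
  obtain ⟨hβm, hβe⟩ := Hβ c₀ c₁ η kmax h eb N n c T₁ T₂ qs q V' V'' β hX hn hη
    (hηe.trans (e_ea.trans ea_eb)) (by linarith) hc.mem_Icc hc1 hVm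
    (fun x hx => (hV1 x hx).trans ea_eb) (hV2.mono ea_eb) hqj hβ
  have hβb : ∀ x, |β x| ≤ K + 1 := fun x => by
    have h1 : β x ≤ c₁ - 1 := by rw [hβ x]; exact min_le_right _ _
    have h2 : c₀ - 1 ≤ β x := by
      rw [hβ x]
      refine le_min (le_max_right _ _) ?_
      linarith [(hc.mem_Icc 0).1, (hc.mem_Icc 0).2]
    rw [abs_le]
    constructor <;> linarith
  have hW2c : L2Le (deriv (deriv W)) ec := hW2.mono (by
    have : C₀ * η ≤ ea := mul_le_mul_of_nonneg_left hηe (by linarith)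
    linarith)
  obtain ⟨w0, w1, w2⟩ := Hw η kmax ec x₀ c u W β g w hk1 (by linarith) hx₀ hη (by linarith)
    (by linarith) hW (fun x hx => (hb x hx).2) (fun x hx => (hW1 x hx).trans (by linarith)) hW2c
    hβb hβm hβe hg hQw
  -- Nonvanishing: the exact field is at least `1 / (2 c₁^{1/4})` in modulus.
  have hhalf : 1 / (2 * c₁ ^ (1 / 4 : ℝ)) = 2 * (1 / (4 * c₁ ^ (1 / 4 : ℝ))) := by
    field_simp; norm_num
  have hquart : 1 / K ≤ 1 / (4 * c₁ ^ (1 / 4 : ℝ)) := one_div_le_one_div_of_le (by linarith) hc₁K'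
  have hK0 : 0 < 1 / K := by positivity
  have hinv : ∀ z : ℂ, 1 / (4 * c₁ ^ (1 / 4 : ℝ)) ≤ ‖z‖ → z ≠ 0 ∧ ‖z⁻¹‖ ≤ K := fun z hz => by
    have hz0 : 0 < ‖z‖ := by linarith
    refine ⟨norm_pos_iff.1 hz0, ?_⟩
    rw [norm_inv, inv_le_comm₀ hz0 (by linarith), ← one_div]
    linarith
  have hWinv : ∀ x ∈ Icc (0 : ℝ) 1, W x ≠ 0 ∧ ‖(W x)⁻¹‖ ≤ K := fun x hx =>
    hinv _ (by linarith [(hb x hx).1])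
  have hwinv : ∀ x ∈ Icc (0 : ℝ) 1, w.D 0 x ≠ 0 ∧ ‖(w.D 0 x)⁻¹‖ ≤ K := fun x hx => by
    refine hinv _ ?_
    have h1 := w0 x hx
    have h2 := norm_sub_norm_le (W x) (w.D 0 x)
    rw [norm_sub_rev] at h2
    linarith [(hb x hx).1]
  obtain ⟨t1, t2⟩ := Hu kmax ed W (deriv W) (deriv (deriv W)) w hk1 ed0 (by linarith)
    hW.contDiff.continuous.continuousOn hW.contDiff_deriv.continuous.continuousOn hWinv hwinv hW1
    hW2K w0 w1 w2
  refine ⟨hβe.mono (by linarith), hqn.mono (by linarith), fun x hx => (hwinv x hx).1, ?_, ?_, ?_⟩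
  · refine aestronglyMeasurable_of_continuousOn
      ((w.isPrimitive (j := 1) (by norm_num)).continuousOn.div
        (continuousOn_const.mul (w.isPrimitive (j := 0) (by norm_num)).continuousOn) fun x hx => ?_)
    have : (kmax : ℂ) ≠ 0 := by exact_mod_cast (by linarith : (0 : ℝ) < kmax).ne'
    simp [this, (hwinv x hx).1]
  · intro x hx
    have := t1 x hx
    simp only [(hT x hx).1, logDeriv₁]
    linarith
  · refine (t2.congr fun x hx => ?_).mono (by linarith)
    rw [(hT x hx).2, logDeriv₂]

/-- The assumptions on the exact solution, with `M` replaced by a larger constant `K`. -/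
theorem ExactBounds.exactData {K c₀ c₁ η kmin kmax h M x₀ : ℝ} {N : ℕ} {c : ℝ → ℝ} {u : ℝ → ℝ → ℂ}
    {qs : ℕ → SobolevFn 2} (hex : ExactBounds c x₀ kmax h η M u N qs)
    (hrep : Represents c x₀ kmax h u N qs) (hkmin : 0 < kmin) (hh0 : 0 < h)
    (hh : h = (kmax - kmin) / N) (hη : 0 ≤ η) (hM : 0 ≤ M) (hMK : M ≤ K) (hkK : kmax ≤ K) (hx₀ : x₀ < 0)
    (hc : IsAdmissible c₀ c₁ c) (hu : ∀ k, 0 < k → IsForwardSolution c x₀ k (fun x => u x k))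
    (hTprim : IsPrimitive (tailDeriv c x₀ kmax u 1) (tailDeriv c x₀ kmax u 2))
    (hT2m : AEStronglyMeasurable (tailDeriv c x₀ kmax u 2) unitMeasure) :
    ExactData K η kmax h N c (tailDeriv c x₀ kmax u 1) (tailDeriv c x₀ kmax u 2) qs := by
  have hnh : ∀ n ∈ Finset.Icc 1 N, 0 < n * h ∧ n * h ≤ kmax - kmin := fun n hn => by
    rw [Finset.mem_Icc] at hn
    have h1 : (0 : ℝ) < n := by exact_mod_cast hn.1
    have h2 : (n : ℝ) ≤ N := by exact_mod_cast hn.2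
    refine ⟨mul_pos h1 hh0, (mul_le_mul_of_nonneg_right h2 hh0.le).trans (le_of_eq ?_)⟩
    have h3 : (N : ℝ) ≠ 0 := by linarith
    rw [hh]
    field_simp
  have hMη : ENNReal.ofReal (M * η) ≤ ENNReal.ofReal (K * η) :=
    ENNReal.ofReal_le_ofReal (mul_le_mul_of_nonneg_right hMK hη)
  have hKη : 0 ≤ K * η := mul_nonneg (by linarith) hη
  have ms1 : ∀ j, AEStronglyMeasurable ((qs j).D 1) unitMeasure := fun j =>
    ((qs j).isPrimitive (j := 1) (by norm_num)).meas
  have ms2 : ∀ j, AEStronglyMeasurable ((qs j).D 2) unitMeasure := fun j => (qs j).memLp_top.1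
  exact
    { h_nonneg := hh0.le
      h_mul_le := fun n hn => by linarith [(hnh n hn).2]
      grid_le := fun n hn => by
        rw [Complex.norm_real, Real.norm_eq_abs, abs_le, grid]
        constructor <;> linarith [(hnh n hn).1, (hnh n hn).2]
      tail_prim := hTprim
      tail_one := fun x hx => (hex.tail_one x hx).trans hMK
      tail_two := ⟨by linarith, hT2m, hex.tail_two.trans (ENNReal.ofReal_le_ofReal hMK)⟩
      q_zero := fun n hn x hx => by
        have := hex.q_C1 n hn x hx x hx
        linarith [norm_nonneg ((qs n).D 1 x)]
      q_one := fun n hn x hx => by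
        have := hex.q_C1 n hn x hx x hx
        linarith [norm_nonneg ((qs n).D 0 x)]
      q_two := fun n hn => ⟨by linarith, ms2 n, (normL2_le_normH le_rfl _).trans
        ((hex.q_H2 n hn).trans (ENNReal.ofReal_le_ofReal hMK))⟩
      q_end := fun n hn => hrep.deriv_one_eq_zero hc hx₀ hu hn
        (by rw [grid]; linarith [(hnh n hn).2]) (by rw [grid]; linarith [(hnh n hn).1])
      errG_le := fun n hn => ⟨hKη, ((ms2 n).add ((aestronglyMeasurable_coeffA hTprim.meas
        fun j _ => ms1 j).mul (ms1 n))).sub (aestronglyMeasurable_rhsD hTprim.meas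
        fun j _ => ms1 j), (hex.errG_le n hn).trans hMη⟩
      errF_le := fun n hn => ⟨hKη, (aestronglyMeasurable_of_continuousOn
        (Complex.continuous_ofReal.comp
          (hc.contDiff.continuous.sub continuous_const)).continuousOn).sub
        (aestronglyMeasurable_betaExpr hTprim.meas hT2m (fun j _ => ms1 j) (fun j _ => ms2 j)
          (Finset.mem_Icc.1 hn).1), (hex.errF_le n hn).trans hMη⟩ }

theorem pow_mul_le_of_lt_one_div {B a η : ℝ} {n N : ℕ} (hB : 1 ≤ B) (ha : 1 ≤ a) (hη : 0 ≤ η)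
    (hn : n ≤ N) (h : η < 1 / (a * B ^ (2 * N))) : B ^ n * η ≤ 1 / a := by
  have h1 : (0 : ℝ) < B ^ (2 * N) := by positivity
  have h2 : B ^ n ≤ B ^ (2 * N) := pow_le_pow_right₀ hB (by omega)
  rw [lt_div_iff₀ (by positivity)] at h
  rw [le_div_iff₀ (by positivity)]
  calc B ^ n * η * a ≤ B ^ (2 * N) * η * a := by gcongr
    _ = η * (a * B ^ (2 * N)) := by ring
    _ ≤ 1 := h.le

theorem pow_mul_lt_sqrt_of_lt_one_div {B a η : ℝ} {n N : ℕ} (hB : 1 ≤ B) (ha : 1 ≤ a) (hη : 0 < η)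
    (hn : n ≤ N) (h : η < 1 / (a * B ^ (2 * N))) : B ^ n * η < Real.sqrt η := by
  have h1 : (0 : ℝ) < B ^ (2 * N) := by positivity
  rw [lt_div_iff₀ (by positivity)] at h
  rw [Real.lt_sqrt (by positivity)]
  have h2 : B ^ (2 * n) ≤ B ^ (2 * N) := pow_le_pow_right₀ hB (by omega)
  have h3 : B ^ (2 * N) * η < 1 := by
    calc B ^ (2 * N) * η ≤ a * (B ^ (2 * N) * η) := le_mul_of_one_le_left (by positivity) ha
      _ = η * (a * B ^ (2 * N)) := by ring
      _ < 1 := h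
  calc (B ^ n * η) ^ 2 = B ^ (2 * n) * η * η := by ring
    _ ≤ B ^ (2 * N) * η * η := by gcongr
    _ < 1 * η := by gcongr
    _ = η := one_mul η

end Helmholtz

/-! ### The convergence theorem -/

open Helmholtz in
theorem theorem5p1 :
    ∃ M₁ : ℝ → ℝ, (∀ s, 0 < M₁ s) ∧
      ∀ (c₀ c₁ kmin kmax x₀ h δ η M : ℝ) (N N₁ : ℕ) (c : ℝ → ℝ) (u : ℝ → ℝ → ℂ)
        (qs : ℕ → SobolevFn 2) (g₀ l : ℝ → ℂ),
        0 < c₀ → c₀ < c₁ → 1 < kmin → kmin < kmax → x₀ < 0 →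
        -- the grid, the noise level and the error parameter
        1 ≤ N → h = (kmax - kmin) / N → 0 < δ → η = h + δ → 1 ≤ N₁ → N₁ ≤ N →
        -- the exact coefficient and its wave field
        IsAdmissible c₀ c₁ c → (∀ x, 1 ≤ c x) →
        (∀ k, 0 < k → IsForwardSolution c x₀ k (fun x => u x k)) →
        (∀ x ∈ Set.Icc (0 : ℝ) 1, ∀ k, kmax ≤ k → ‖highFreqFactor c x₀ u x k - 1‖ < 1 / 2) →
        TailForm c x₀ kmax u (M * η) →
        -- the data errors
        DataError kmin kmax δ g₀ l (fun k => wField x₀ u 0 k) (fun k => logW c x₀ kmax u 0 k) →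
        Represents c x₀ kmax h u N qs →
        (∀ n ∈ Finset.Icc 1 N, ‖psi0 kmax h l n - (qs n).D 0 0‖ ≤ η ∧
          ‖psi1 kmax h g₀ n - (qs n).D 1 0‖ ≤ η) →
        -- the constant `M` and the smallness of the error parameter
        1 < M → 24 * kmax ^ 2 < M → 16 * Real.sqrt c₁ < M →
        ExactBounds c x₀ kmax h η M u N qs →
        η < 1 / (4 * c₁ ^ (1 / 4 : ℝ) * (M₁ (M * kmax ^ 2) * M ^ 16) ^ (2 * N₁)) →
        ∀ (V₀ : SobolevFn 3) (q w : ℕ → SobolevFn 3) (β : ℕ → ℝ → ℝ) (V' V'' : ℕ → ℝ → ℂ),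
          IsAlgorithmRun c₀ c₁ kmax h δ η N₁ g₀ l V₀ q w β V' V'' →
          ∀ n ∈ Finset.Icc 1 N₁,
            (M₁ (M * kmax ^ 2) * M ^ 16) ^ n * η < Real.sqrt η ∧
            normL2 (fun x => ((β n x - (c x - 1) : ℝ) : ℂ))
              ≤ ENNReal.ofReal ((M₁ (M * kmax ^ 2) * M ^ 16) ^ n * η) ∧
            C1Le (fun j x => (q n).D j x - (qs n).D j x)
              ((M₁ (M * kmax ^ 2) * M ^ 16) ^ n * η) ∧
            normH 2 (fun j x => (q n).D j x - (qs n).D j x)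
              ≤ ENNReal.ofReal ((M₁ (M * kmax ^ 2) * M ^ 16) ^ n * η) ∧
            (∀ x ∈ Set.Icc (0 : ℝ) 1, (w n).D 0 x ≠ 0) ∧
            CLe (fun x => V' (n + 1) x - tailDeriv c x₀ kmax u 1 x)
              ((M₁ (M * kmax ^ 2) * M ^ 16) ^ n * η) ∧
            normL2 (fun x => V'' (n + 1) x - tailDeriv c x₀ kmax u 2 x)
              ≤ ENNReal.ofReal ((M₁ (M * kmax ^ 2) * M ^ 16) ^ n * η) := by
  have hKs : ∀ s : ℝ, 1 ≤ 1 + s ^ 2 := fun s => by nlinarith [sq_nonneg s]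
  choose Ct hCt Ht using fun s : ℝ => tail_derivs_le (1 + s ^ 2) (hKs s)
  choose Ci hCi Hi using fun s : ℝ => initial_tail (1 + s ^ 2) (hKs s)
  -- `C₀ s * η` bounds the error of the initial tail and the second derivative of the exact field.
  set C₀ : ℝ → ℝ := fun s => Ci s * Ct s +
    (1 + s ^ 2) ^ 2 * (3 / 2) * (1 + (1 + s ^ 2) ^ 3) * Ct s with hC₀def
  have hC₀ : ∀ s, 1 ≤ C₀ s := fun s => by
    have h1 := one_le_mul_of_one_le_of_one_le (hCi s) (hCt s)
    have h2 : 0 ≤ (1 + s ^ 2) ^ 2 * (3 / 2) * (1 + (1 + s ^ 2) ^ 3) * Ct s :=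
      mul_nonneg (by positivity) (by linarith [hCt s])
    simp only [hC₀def]
    linarith
  choose Cs hCs Hs using fun s : ℝ => algorithm_step (1 + s ^ 2) (hKs s) (C₀ s) (hC₀ s)
  refine ⟨fun s => Cs s + C₀ s, fun s => by linarith [hCs s, hC₀ s], ?_⟩
  intro c₀ c₁ kmin kmax x₀ h δ η M N N₁ c u qs g₀ l hc₀ hc₀₁ hkmin hkk hx₀ hN hh hδ hη hN₁ hN₁N hc hc1
    hu hR hT hdata hrep hpsi hM hMk hMc hex hsmall V₀ q w β V' V'' hrun
  set s : ℝ := M * kmax ^ 2 with hs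
  set K : ℝ := 1 + s ^ 2 with hK
  set B : ℝ := (Cs s + C₀ s) * M ^ 16 with hB
  have hk1 : 1 < kmax := hkmin.trans hkk
  have hk0 : 0 < kmax := by linarith
  -- All quantities are bounded in terms of `s`.
  have hkk2 : 1 ≤ kmax ^ 2 := one_le_pow₀ hk1.le
  have hMs : M ≤ s := le_mul_of_one_le_right (by linarith) hkk2
  have hs1 : 1 ≤ s := by linarith
  have hsK : s ≤ K := by nlinarith
  have hks : kmax ≤ s := by
    have h1 : kmax ≤ kmax ^ 2 := by nlinarith
    have h2 : kmax ^ 2 ≤ s := le_mul_of_one_le_left (by positivity) hM.le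
    linarith
  have hMK : M ≤ K := hMs.trans hsK
  have hkK : kmax ≤ K := hks.trans hsK
  have hc₁1 : 1 ≤ c₁ := (hc1 0).trans (hc.mem_Icc 0).2
  have hc₁M : 256 * c₁ ≤ s ^ 2 := by
    have h1 : (16 * Real.sqrt c₁) ^ 2 ≤ s ^ 2 :=
      pow_le_pow_left₀ (by positivity) (hMc.le.trans hMs) 2
    rwa [mul_pow, Real.sq_sqrt (by linarith), show (16 : ℝ) ^ 2 = 256 by norm_num] at h1
  have hc₁K : c₁ ≤ K := by linarith
  have hr1 : 1 ≤ c₁ ^ (1 / 4 : ℝ) := Real.one_le_rpow hc₁1 (by norm_num)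
  have hrc : c₁ ^ (1 / 4 : ℝ) ≤ c₁ := by
    have := Real.rpow_le_rpow_of_exponent_le hc₁1 (show (1 / 4 : ℝ) ≤ 1 by norm_num)
    rwa [Real.rpow_one] at this
  have hc₁K' : 4 * c₁ ^ (1 / 4 : ℝ) ≤ K := by linarith
  have hBC : Cs s + C₀ s ≤ B := le_mul_of_one_le_right (by linarith [hCs s, hC₀ s])
    (one_le_pow₀ hM.le)
  have hBCs : Cs s ≤ B := by linarith [hC₀ s]
  have hBC₀ : C₀ s ≤ B := by linarith [hCs s]
  have hB1 : 1 ≤ B := (hCs s).trans hBCs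
  have hN0 : (0 : ℝ) < N := by exact_mod_cast hN
  have hh0 : 0 < h := by rw [hh]; exact div_pos (by linarith) hN0
  have hη0 : 0 < η := by linarith
  have hδη : δ ≤ η := by linarith
  -- The smallness condition.
  have hBpow : ∀ n ≤ N₁, B ^ n * η ≤ 1 / (4 * c₁ ^ (1 / 4 : ℝ)) :=
    fun n hn => pow_mul_le_of_lt_one_div hB1 (by linarith) hη0.le hn hsmall
  have hquart : 1 / (4 * c₁ ^ (1 / 4 : ℝ)) ≤ 1 := by
    rw [div_le_one (by linarith)]; linarith
  have hBpow1 : ∀ n ≤ N₁, B ^ n * η ≤ 1 := fun n hn => (hBpow n hn).trans hquart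
  have hη1 : η ≤ 1 := by simpa using hBpow1 0 (Nat.zero_le _)
  -- The exact field and the exact tail at `kmax`.
  obtain ⟨W, hW⟩ := (hu kmax hk0).exists_normalizedField hc hx₀ hk0
  have hRk : ∀ x ∈ Set.Icc (0 : ℝ) 1, ‖highFreqFactor c x₀ u x kmax - 1‖ < 1 / 2 :=
    fun x hx => hR x hx kmax le_rfl
  have hpos : ∀ x ∈ Set.Icc (0 : ℝ) 1, x₀ < x := fun x hx => hx₀.trans_le hx.1
  have hW0 : ∀ x ∈ Set.Icc (0 : ℝ) 1, W x ≠ 0 := fun x hx =>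
    (hW.eventually_hasDerivAt_logHigh hc hc1 (hpos x hx) (hRk x hx)).self_of_nhds.1
  have hTW : ∀ x ∈ Set.Icc (0 : ℝ) 1, tailDeriv c x₀ kmax u 1 x = logDeriv₁ kmax W x ∧
      tailDeriv c x₀ kmax u 2 x = logDeriv₂ kmax W x := fun x hx => by
    have := hW.vField_derivs hc hc1 hk0 le_rfl (hpos x hx) (hRk x hx) (g := fun _ => 0)
      contDiff_const
    simpa [tailDeriv] using this
  have hWfield : ∀ x ∈ Set.Icc (0 : ℝ) 1, (fun y => wField x₀ u y kmax) =ᶠ[𝓝 x] W := fun x hx => by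
    filter_upwards [Ioi_mem_nhds (hpos x hx)] with y hy using hW.eq_wField y (le_of_lt hy)
  have hW1 : CLe (deriv W) K := fun x hx => by
    have h1 := hex.w_one x hx
    rw [iteratedDeriv_one, (hWfield x hx).deriv_eq] at h1
    exact h1.trans hMK
  have hW2 : L2Le (deriv (deriv W)) K := by
    refine ⟨by linarith, aestronglyMeasurable_of_continuousOn
      hW.continuous_deriv_deriv.continuousOn, ?_⟩
    refine le_trans (le_of_eq (eLpNorm_congr_ae (ae_unitMeasure fun x hx => ?_)))
      (hex.w_two.trans (ENNReal.ofReal_le_ofReal hMK))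
    rw [iteratedDeriv_succ, iteratedDeriv_one, (hWfield x hx).deriv.deriv_eq]
  obtain ⟨hv1, hv2⟩ := Ht s c₀ c₁ x₀ kmax η M c u W hk1.le hkK hMK (by linarith) hη0.le hη1 hx₀ hc hc1
    hu hR hT hex.tail_one hW
  have hv1K : CLe (logDeriv₁ kmax W) K := fun x hx => by
    rw [← (hTW x hx).1]
    exact (hex.tail_one x hx).trans hMK
  have hW2' : L2Le (deriv (deriv W)) (C₀ s * η) := by
    refine (hW.second_deriv_le hk1.le hkK hW0
      (fun x hx => (hW.norm_bounds hc hc1 (hpos x hx).le (hRk x hx)).2) hv1K hv1 hv2).mono ?_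
    have h1 : 0 ≤ Ci s * Ct s * η := by
      have := hCi s
      have := hCt s
      positivity
    simp only [hC₀def]
    linarith
  -- The exact discretized solution.
  have hTprim : IsPrimitive (tailDeriv c x₀ kmax u 1) (tailDeriv c x₀ kmax u 2) :=
    (hW.isPrimitive_logDeriv₁ hk0 hW0).congr (fun x hx => (hTW x hx).1.symm)
      (fun x hx => (hTW x hx).2.symm)
  have hT2m : AEStronglyMeasurable (tailDeriv c x₀ kmax u 2) unitMeasure :=
    (hv2.congr fun x hx => (hTW x hx).2.symm).meas
  have hX := hex.exactData hrep (by linarith) hh0 hh hη0.le (by linarith) hMK hkK hx₀ hc hu hTprim hT2m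
  -- The data at `kmax`.
  have hkmem : kmax ∈ Set.Icc kmin kmax := ⟨hkk.le, le_rfl⟩
  have hg : ‖g₀ kmax - W 0‖ ≤ δ := by
    rw [← hW.eq_wField 0 hx₀.le]
    exact hdata.val_le kmax hkmem
  have hl : ‖l kmax - logHigh c x₀ u 0 kmax‖ ≤ δ := by
    have := hdata.log_le kmax hkmem
    simpa [logW] using this
  -- The initial tail.
  have hCtη : η ≤ Ct s * η := le_mul_of_one_le_left hη0.le (hCt s)
  have hCiCt : Ci s * (Ct s * η) ≤ C₀ s * η := by
    have h1 : 0 ≤ (1 + s ^ 2) ^ 2 * (3 / 2) * (1 + (1 + s ^ 2) ^ 3) * Ct s * η :=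
      mul_nonneg (mul_nonneg (by positivity) (by linarith [hCt s])) hη0.le
    simp only [hC₀def]
    linarith
  obtain ⟨i1, i2⟩ := Hi s c₀ c₁ δ kmax (Ct s * η) x₀ c u W (g₀ kmax) (l kmax) V₀ hk1.le hx₀ hδ.le
    (hδη.trans hCtη) (by
      have h1 := hBpow1 1 hN₁
      rw [pow_one] at h1
      have h2 : C₀ s * η ≤ B * η := mul_le_mul_of_nonneg_right hBC₀ hη0.le
      linarith) hc hc1 hW hRk hv1K hv2 hg hl hrun.init
  -- Induction over the steps.
  have key : ∀ n ≤ N₁,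
      (AEStronglyMeasurable (V' (n + 1)) unitMeasure ∧
        CLe (fun x => V' (n + 1) x - tailDeriv c x₀ kmax u 1 x) (C₀ s * (B ^ n * η)) ∧
        L2Le (fun x => V'' (n + 1) x - tailDeriv c x₀ kmax u 2 x) (C₀ s * (B ^ n * η))) ∧
      ∀ j ∈ Finset.Icc 1 n, L2Le (fun x => ((β j x - (c x - 1) : ℝ) : ℂ)) (B ^ j * η) ∧
        IsClose (q j) (qs j) (B ^ j * η / 2) ∧ (∀ x ∈ Set.Icc (0 : ℝ) 1, (w j).D 0 x ≠ 0) ∧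
        CLe (fun x => V' (j + 1) x - tailDeriv c x₀ kmax u 1 x) (B ^ j * η) ∧
        L2Le (fun x => V'' (j + 1) x - tailDeriv c x₀ kmax u 2 x) (B ^ j * η) := by
    intro n
    induction n with
    | zero =>
      intro _
      rw [zero_add, hrun.tail_one.1, hrun.tail_one.2, pow_zero, one_mul]
      refine ⟨⟨(V₀.isPrimitive (j := 1) (by norm_num)).meas, fun x hx => ?_, ?_⟩, by simp⟩
      · simp only [(hTW x hx).1]
        exact (i1 x hx).trans hCiCt
      · exact (i2.congr fun x hx => by rw [(hTW x hx).2]).mono hCiCt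
    | succ n ih =>
      intro hn
      obtain ⟨⟨hVm, hV1, hV2⟩, hj⟩ := ih (by omega)
      have hn1 : n + 1 ∈ Finset.Icc 1 N₁ := by rw [Finset.mem_Icc]; omega
      have hnN : n + 1 ∈ Finset.Icc 1 N := by rw [Finset.mem_Icc]; omega
      set e : ℝ := B ^ n * η with he
      have he0 : 0 ≤ e := by positivity
      have hηe : η ≤ e := le_mul_of_one_le_left hη0.le (one_le_pow₀ hB1)
      have hBe : B ^ (n + 1) * η = B * e := by rw [pow_succ, he]; ring
      have hCe : Cs s * e ≤ B ^ (n + 1) * η := by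
        rw [hBe]; exact mul_le_mul_of_nonneg_right hBCs he0
      have hstep := Hs s c₀ c₁ η kmax h e x₀ N (n + 1) c u W (tailDeriv c x₀ kmax u 1)
        (tailDeriv c x₀ kmax u 2) qs q (V' (n + 1)) (V'' (n + 1)) (β (n + 1)) _ _ (g₀ kmax)
        (w (n + 1)) hX hnN hk1.le hkK hx₀ hη0.le hηe (hCe.trans (hBpow _ hn)) hc₀ hc₁K hc₁K' hc hc1 hW
        hRk hTW hW1 hW2 hW2' hVm hV1 hV2 (fun j hjn => by
          rw [Finset.mem_Ico] at hjn
          have hjn' : j ≤ n := by omega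
          refine ((hj j (by rw [Finset.mem_Icc]; omega)).2.1).mono ?_
          have h1 : B ^ j * η ≤ e :=
            mul_le_mul_of_nonneg_right (pow_le_pow_right₀ hB1 hjn') hη0.le
          have h2 : 0 ≤ B ^ j * η := by positivity
          linarith) (hpsi _ hnN).1 (hpsi _ hnN).2 (hrun.step_q _ hn1) (hrun.step_β _ hn1)
        (hg.trans hδη) (hrun.step_w _ hn1)
      obtain ⟨s1, s2, s3, s4, s5, s6⟩ := hstep
      have hV'eq : V' (n + 1 + 1) = fun x =>
          (w (n + 1)).D 1 x / ((kmax : ℂ) ^ 2 * (w (n + 1)).D 0 x) :=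
        funext (hrun.step_V' _ hn1)
      have hV''eq : V'' (n + 1 + 1) = fun x =>
          (w (n + 1)).D 2 x / ((kmax : ℂ) ^ 2 * (w (n + 1)).D 0 x)
            - (w (n + 1)).D 1 x ^ 2 / ((kmax : ℂ) ^ 2 * (w (n + 1)).D 0 x ^ 2) :=
        funext (hrun.step_V'' _ hn1)
      have hC₀B : B ^ (n + 1) * η ≤ C₀ s * (B ^ (n + 1) * η) :=
        le_mul_of_one_le_left (by positivity) (hC₀ s)
      refine ⟨⟨?_, ?_, ?_⟩, fun j hjn => ?_⟩
      · rw [hV'eq]; exact s4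
      · rw [hV'eq]; exact fun x hx => (s5 x hx).trans (hCe.trans hC₀B)
      · rw [hV''eq]; exact s6.mono (hCe.trans hC₀B)
      · rcases eq_or_ne j (n + 1) with rfl | hne
        · refine ⟨s1.mono hCe, s2.mono (by linarith), s3, ?_, ?_⟩
          · rw [hV'eq]; exact fun x hx => (s5 x hx).trans hCe
          · rw [hV''eq]; exact s6.mono hCe
        · exact hj j (by rw [Finset.mem_Icc] at hjn ⊢; omega)
  intro n hn
  have hnN₁ := (Finset.mem_Icc.1 hn).2
  obtain ⟨r1, r2, r3, r4, r5⟩ := (key N₁ le_rfl).2 n hn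
  have hEn : (0 : ℝ) ≤ B ^ n * η := by positivity
  refine ⟨?_, r1.norm_le, ?_, ?_, r3, r4, r5.norm_le⟩
  · exact pow_mul_lt_sqrt_of_lt_one_div hB1 (by linarith) hη0 hnN₁ hsmall
  · intro x hx y hy
    have h1 := r2.zero x hx
    have h2 := r2.one y hy
    simp only
    linarith
  · refine (normH_two_le (e := B ^ n * η / 2) fun j hj => ?_).trans_eq (by congr 1; ring)
    interval_cases j
    · exact L2Le.of_bound (((q n).isPrimitive (j := 0) (by norm_num)).meas.sub
        ((qs n).isPrimitive (j := 0) (by norm_num)).meas) r2.zero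
    · exact L2Le.of_bound (((q n).isPrimitive (j := 1) (by norm_num)).meas.sub
        ((qs n).isPrimitive (j := 1) (by norm_num)).meas) r2.one
    · exact r2.two
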